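/- Let $\gamma\in C^{3}(\mathbb{R})$ be a real-valued function that is either odd or even, with $\gamma(0)=\gamma'(0)=0$, convex on $(0,\infty)$, and such that (i) $\frac{\gamma'(2t)}{\gamma'(t)}$ is (weakly) decreasing on $(0,\infty)$ and bounded above there by a constant $C_1$; (ii) there is a constant $C_2>0$ with $\frac{t\gamma''(t)}{\gamma'(t)}\le C_2$ for all $t\in(0,\infty)$; (iii) there is a constant $C_3>0$ with $\left|\left(\frac{\gamma''}{\gamma'}\right)'(t)\right|\ge \frac{C_3}{t^2}$ for all $t\in(0,\infty)$; (iv) $\frac{\gamma'''(t)}{\gamma''(t)}$ is strictly monotone or equal to a constant on $(0,\infty)$. For a measurable function $u:\mathbb{R}\to\mathbb{R}$, define $$\mathcal{C}_{u,\gamma}f(x):=\mathrm{p.v.}\int_{-\infty}^{\infty}e^{iu(x)\gamma(t)}f(x-t)\,\frac{dt}{t}=\lim_{\varepsilon\to0^+}\int_{|t|>\varepsilon}e^{iu(x)\gamma(t)}f(x-t)\,\frac{dt}{t}.$$ Then for every $p\in(1,\infty)$ there is a constant $C>0$, not depending on $u$, such that for every measurable $u:\mathbb{R}\to\mathbb{R}$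 the following holds. If $f:\mathbb{R}\to\mathbb{C}$ is a Schwartz function, the principal value defining $\mathcal{C}_{u,\gamma}f(x)$ exists for every $x\in\mathbb{R}$. If $f\in L^p(\mathbb{R})$ is complex-valued, it exists for almost every $x\in\mathbb{R}$, the function $\mathcal{C}_{u,\gamma}f$ belongs to $L^p(\mathbb{R})$, and $$\|\mathcal{C}_{u,\gamma}f\|_{L^p(\mathbb{R})}\le C\,\|f\|_{L^p(\mathbb{R})}.$$ -/

import Mathlib

open Set Filter Topology MeasureTheory
open scoped NNReal ENNReal SchwartzMap

/-- The integral of `F` over the line with the symmetric interval `[-ε, ε]` removed. -/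
noncomputable def truncatedIntegral (F : ℝ → ℂ) (ε : ℝ) : ℂ :=
  ∫ t in {t : ℝ | ε < |t|}, F t

/-- The principal-value integral `p.v. ∫ F(t) dt`, singular at the origin, exists and equals `L`:
`F` is absolutely integrable on `{|t| > ε}` for every `ε > 0`, and the integrals over these sets
converge to `L` as `ε → 0+`. -/
def HasPrincipalValue (F : ℝ → ℂ) (L : ℂ) : Prop :=
  (∀ ε : ℝ, 0 < ε → IntegrableOn F {t : ℝ | ε < |t|} volume) ∧
    Tendsto (truncatedIntegral F) (𝓝[>] 0) (𝓝 L)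

/-- The number `p.v. ∫ F(t) dt` (only meaningful together with `HasPrincipalValue`). -/
noncomputable def principalValue (F : ℝ → ℂ) : ℂ :=
  limUnder (𝓝[>] (0 : ℝ)) (truncatedIntegral F)

/-- The function `t ↦ e^{i u(x) γ(t)} f(x - t) / t`. -/
noncomputable def carlesonIntegrand (u γ : ℝ → ℝ) (f : ℝ → ℂ) (x t : ℝ) : ℂ :=
  Complex.exp (Complex.I * ((u x * γ t : ℝ) : ℂ)) * f (x - t) / (t : ℂ)

/-- The Carleson operator along the curve `γ`,
`C_{u,γ} f(x) = p.v. ∫ e^{i u(x) γ(t)} f(x - t) dt / t`. -/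
noncomputable def carlesonOperator (u γ : ℝ → ℝ) (f : ℝ → ℂ) (x : ℝ) : ℂ :=
  principalValue (carlesonIntegrand u γ f x)

/-!
The principal value along the curve is compared, at each point `x`, with that of the Hilbert
transform. Let `t₀(x)` be the scale with `|u(x)| γ(t₀(x)) = 1`. For `|t| ≤ t₀(x)` convexity gives
`|e^{i u(x) γ(t)} - 1| ≤ |t| / t₀(x)`, so replacing the exponential by `1` there costs at most a
Hardy–Littlewood maximal function. What is left is a difference of truncated Hilbert transforms and
the tails `|t| > t₀(x)`, on which the phase oscillates. Hence the principal value exists wherever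
that of the Hilbert transform does (`IsNondegeneratePhase.hasPrincipalValue_carlesonOperator`), and
it is bounded on `Lᵖ` once the maximal functions and the tails are. No modulation invariant
analysis is needed: since `γ` has no linear part at the origin, the oscillation is genuinely of
higher order, and a `T T*` argument in the spirit of Stein and Wainger suffices.

*The tails.* By convexity the phase is at least `2ᵏ` at the scale `2ᵏ t₀(x)`, so it is enough that
the piece of the operator at a variable scale `R(x)`, where the phase is at least `L`, has norm
`O(L^{-δ})`. On `L²` this comes from the kernel of `T T*`, which is an integral over `t` of
`e^{i (u(x) γ(t + s) - u(y) γ(t))}`, `s = x - y`, against a decreasing amplitude. The first two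
derivatives of this phase are combinations of `u(x) γ'(t + s)` and `u(y) γ'(t)` whose determinant is
the difference of the values of `γ'' / γ'` at `t` and `t + s`. The lower bound on `(γ'' / γ')'`
therefore keeps the derivatives from being small simultaneously
(`IsNondegeneratePhase.phase_derivs_not_small`), while monotonicity of `γ''' / γ''` makes the second
derivative change sign at most once. Van der Corput's lemma then bounds the kernel away from the
diagonal, uniformly in `u`, and near the diagonal it has small support; either way it is dominated
by a small multiple of a maximal function (`IsNondegeneratePhase.exists_lintegral_curvePiece_sq_le`).
Each piece is also bounded pointwise by the maximal function, so interpolation carries the decay to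
`Lᵖ`, and the dyadic pieces can be summed (`IsNondegeneratePhase.exists_lintegral_tail_rpow_le`).

*The maximal functions.* The Hardy–Littlewood maximal function is bounded by a covering argument
and real interpolation. For the maximal truncated Hilbert transform, the Cauchy transform `F` of a
bounded nonnegative function of compact support is analytic with positive real part on the upper
half-plane, and the integral of `Fᵖ` over horizontal lines vanishes. Since `|F|ᵖ` is dominated by
`(Re F)ᵖ` and `Re Fᵖ` unless `p` is an odd integer, this bounds `F` on `Lᵖ`, and truncated
integrals are compared with `F` at height `ε` (`exists_lintegral_hilbertMax_rpow_le`). The exceptional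
exponents follow by interpolation.
-/

/-! ### The Hardy–Littlewood maximal function -/

/-- The centred Hardy–Littlewood maximal function on the line, of a function with values in
`[0, ∞]`. Open balls make it lower semicontinuous, hence measurable, for every `f`. -/
noncomputable def hlMaximal (f : ℝ → ℝ≥0∞) (x : ℝ) : ℝ≥0∞ :=
  ⨆ (r : ℝ) (_ : 0 < r), (ENNReal.ofReal (2 * r))⁻¹ * ∫⁻ y in Metric.ball x r, f y

lemma lt_hlMaximal_iff {f : ℝ → ℝ≥0∞} {x : ℝ} {c : ℝ≥0∞} :
    c < hlMaximal f x ↔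
      ∃ r : ℝ, 0 < r ∧ c < (ENNReal.ofReal (2 * r))⁻¹ * ∫⁻ y in Metric.ball x r, f y := by
  simp [hlMaximal, lt_iSup_iff]

lemma lintegral_ball_le_hlMaximal (f : ℝ → ℝ≥0∞) (x : ℝ) {r : ℝ} (hr : 0 < r) :
    ∫⁻ y in Metric.ball x r, f y ≤ ENNReal.ofReal (2 * r) * hlMaximal f x := by
  have h : (ENNReal.ofReal (2 * r))⁻¹ * ∫⁻ y in Metric.ball x r, f y ≤ hlMaximal f x :=
    le_iSup₂_of_le r hr le_rfl
  have h0 : ENNReal.ofReal (2 * r) ≠ 0 := by simpa using hr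
  calc _ = ENNReal.ofReal (2 * r) * ((ENNReal.ofReal (2 * r))⁻¹ * ∫⁻ y in Metric.ball x r, f y) := by
        rw [← mul_assoc, ENNReal.mul_inv_cancel h0 ENNReal.ofReal_ne_top, one_mul]
    _ ≤ _ := by gcongr

lemma lowerSemicontinuous_hlMaximal (f : ℝ → ℝ≥0∞) : LowerSemicontinuous (hlMaximal f) := by
  intro x c hc
  obtain ⟨r, hr, h⟩ := lt_hlMaximal_iff.1 hc
  -- slightly enlarging the radius keeps the average above `c`
  have hcont : Tendsto (fun r' : ℝ => (ENNReal.ofReal (2 * r'))⁻¹ * ∫⁻ y in Metric.ball x r, f y)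
      (𝓝 r) (𝓝 ((ENNReal.ofReal (2 * r))⁻¹ * ∫⁻ y in Metric.ball x r, f y)) := by
    refine ENNReal.Tendsto.mul_const ?_ (Or.inl ?_)
    · refine tendsto_inv_iff.2 ?_
      exact (ENNReal.continuous_ofReal.comp (continuous_const.mul continuous_id)).tendsto r
    · exact ENNReal.inv_ne_zero.2 ENNReal.ofReal_ne_top
  obtain ⟨δ, hδ, hδ'⟩ := Metric.eventually_nhds_iff.1 (hcont.eventually (lt_mem_nhds h))
  filter_upwards [Metric.ball_mem_nhds x (half_pos hδ)] with x' hx'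
  refine lt_hlMaximal_iff.2 ⟨r + δ / 2, by positivity, ?_⟩
  have h1 := @hδ' (r + δ / 2) (by
    rw [Real.dist_eq, add_sub_cancel_left, abs_of_pos (half_pos hδ)]; linarith)
  refine h1.trans_le ?_
  gcongr
  apply Metric.ball_subset_ball'
  rw [dist_comm]
  linarith [Metric.mem_ball.1 hx']

lemma measurable_hlMaximal (f : ℝ → ℝ≥0∞) : Measurable (hlMaximal f) :=
  (lowerSemicontinuous_hlMaximal f).measurable

/-- The weak type `(1, 1)` inequality, from the Vitali covering theorem. -/
lemma mul_volume_lt_hlMaximal_le (f : ℝ → ℝ≥0∞) (c : ℝ≥0∞) :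
    c * volume {x | c < hlMaximal f x} ≤ 4 * ∫⁻ y, f y := by
  rcases eq_or_ne c 0 with rfl | hc0
  · simp
  rcases eq_or_ne c ∞ with rfl | hct
  · simp
  rcases eq_or_ne (∫⁻ y, f y) ∞ with hI | hI
  · simp [hI]
  have key : ∀ x : {x | c < hlMaximal f x}, ∃ r : ℝ, 0 < r ∧
      c < (ENNReal.ofReal (2 * r))⁻¹ * ∫⁻ y in Metric.ball (x : ℝ) r, f y :=
    fun x => lt_hlMaximal_iff.1 x.2
  choose r hr0 hr using key
  have hr' : ∀ x, c * ENNReal.ofReal (2 * r x) ≤ ∫⁻ y in Metric.ball (x : ℝ) (r x), f y := by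
    intro x
    have h0 : ENNReal.ofReal (2 * r x) ≠ 0 := by simpa using hr0 x
    rw [mul_comm]
    calc _ ≤ ENNReal.ofReal (2 * r x) *
          ((ENNReal.ofReal (2 * r x))⁻¹ * ∫⁻ y in Metric.ball (x : ℝ) (r x), f y) := by
          gcongr; exact (hr x).le
      _ = _ := by rw [← mul_assoc, ENNReal.mul_inv_cancel h0 ENNReal.ofReal_ne_top, one_mul]
  obtain ⟨v, -, hdisj, hcov⟩ := Vitali.exists_disjoint_subfamily_covering_enlargement_ball
    (univ : Set {x | c < hlMaximal f x}) (fun x => (x : ℝ)) r ((∫⁻ y, f y) / c).toReal (by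
      intro x _
      have h1 : ENNReal.ofReal (2 * r x) ≤ (∫⁻ y, f y) / c := by
        rw [ENNReal.le_div_iff_mul_le (Or.inl hc0) (Or.inl hct), mul_comm]
        exact (hr' x).trans (setLIntegral_le_lintegral _ _)
      have h2 := ENNReal.toReal_mono (ENNReal.div_ne_top hI hc0) h1
      rw [ENNReal.toReal_ofReal (by linarith [hr0 x])] at h2
      linarith [hr0 x]) 4 (by norm_num)
  have hcount : v.Countable := hdisj.countable_of_isOpen (fun _ _ => Metric.isOpen_ball)
    (fun x _ => Metric.nonempty_ball.2 (hr0 x))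
  have hsub : {x | c < hlMaximal f x} ⊆ ⋃ x ∈ v, Metric.ball (x : ℝ) (4 * r x) := by
    intro x hx
    obtain ⟨b, hb, hsub⟩ := hcov ⟨x, hx⟩ (mem_univ _)
    exact mem_iUnion₂.2 ⟨b, hb, hsub (Metric.mem_ball_self (hr0 _))⟩
  calc c * volume {x | c < hlMaximal f x}
      ≤ c * ∑' x : v, volume (Metric.ball (x : ℝ) (4 * r x)) := by
        gcongr
        exact (measure_mono hsub).trans (measure_biUnion_le _ hcount _)
    _ = ∑' x : v, 4 * (c * ENNReal.ofReal (2 * r x)) := by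
        rw [← ENNReal.tsum_mul_left]
        refine tsum_congr fun x => ?_
        rw [Real.volume_ball, show 2 * (4 * r x) = 4 * (2 * r x) by ring,
          ENNReal.ofReal_mul (by norm_num)]
        rw [show ENNReal.ofReal 4 = 4 by norm_num]
        ring
    _ ≤ ∑' x : v, 4 * ∫⁻ y in Metric.ball (x : ℝ) (r x), f y := by
        gcongr with x; exact hr' _
    _ = 4 * ∫⁻ y in ⋃ x ∈ v, Metric.ball (x : ℝ) (r x), f y := by
        rw [ENNReal.tsum_mul_left, lintegral_biUnion hcount
          (fun _ _ => Metric.isOpen_ball.measurableSet) hdisj]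
    _ ≤ _ := mul_le_mul_right (setLIntegral_le_lintegral _ _) _

/-- Jensen's inequality for the averages defining the maximal function. -/
lemma hlMaximal_rpow_le {f : ℝ → ℝ≥0∞} (hf : Measurable f) {q : ℝ} (hq : 1 ≤ q) (x : ℝ) :
    hlMaximal f x ^ q ≤ hlMaximal (fun y => f y ^ q) x := by
  have hq0 : 0 < q := by linarith
  rw [← ENNReal.le_rpow_inv_iff hq0]
  refine iSup₂_le fun r hr => ?_
  rw [ENNReal.le_rpow_inv_iff hq0]
  have h0 : ENNReal.ofReal (2 * r) ≠ 0 := by simpa using hr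
  have ht : ENNReal.ofReal (2 * r) ≠ ∞ := ENNReal.ofReal_ne_top
  refine le_trans ?_ (le_iSup₂_of_le (f := fun (r : ℝ) (_ : 0 < r) =>
    (ENNReal.ofReal (2 * r))⁻¹ * ∫⁻ y in Metric.ball x r, f y ^ q) r hr le_rfl)
  rcases hq.eq_or_lt with rfl | hq1
  · simp
  have hH := ENNReal.lintegral_mul_le_Lp_mul_Lq (volume.restrict (Metric.ball x r))
    (Real.HolderConjugate.conjExponent hq1) hf.aemeasurable (aemeasurable_const (b := (1 : ℝ≥0∞)))
  simp only [Pi.mul_apply, mul_one, ENNReal.one_rpow, lintegral_const, one_mul,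
    Measure.restrict_apply_univ, Real.volume_ball] at hH
  set V := ENNReal.ofReal (2 * r)
  have hconj := Real.HolderConjugate.conjExponent hq1
  calc (V⁻¹ * ∫⁻ y in Metric.ball x r, f y) ^ q
      ≤ (V⁻¹ * ((∫⁻ y in Metric.ball x r, f y ^ q) ^ (1 / q) * V ^ (1 / q.conjExponent))) ^ q := by
        gcongr
    _ = V⁻¹ * ∫⁻ y in Metric.ball x r, f y ^ q := by
        rw [ENNReal.mul_rpow_of_nonneg _ _ hq0.le, ENNReal.mul_rpow_of_nonneg _ _ hq0.le,
          ← ENNReal.rpow_mul, ← ENNReal.rpow_mul, one_div_mul_cancel hq0.ne', ENNReal.rpow_one,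
          mul_comm (∫⁻ y in Metric.ball x r, f y ^ q), ← mul_assoc, ← ENNReal.rpow_neg_one V,
          ← ENNReal.rpow_mul, ← ENNReal.rpow_add _ _ h0 ht]
        congr 2
        have h2 : 1 / q.conjExponent = 1 - 1 / q := by
          have := hconj.inv_add_inv_eq_one
          rw [one_div, one_div]; linarith
        rw [h2]; field_simp; ring

lemma hlMaximal_weak_type {f : ℝ → ℝ≥0∞} (hf : Measurable f) {q : ℝ} (hq : 1 ≤ q)
    (c : ℝ≥0∞) :
    c ^ q * volume {x | c < hlMaximal f x} ≤ 4 * ∫⁻ y, f y ^ q := by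
  refine le_trans ?_ (mul_volume_lt_hlMaximal_le (fun y => f y ^ q) (c ^ q))
  refine mul_le_mul_right (measure_mono fun x hx => ?_) _
  exact (ENNReal.rpow_lt_rpow hx (by linarith)).trans_le (hlMaximal_rpow_le hf hq x)

/-- The maximal function dominates convolutions with the Poisson kernel. -/
lemma lintegral_poisson_le_hlMaximal {f : ℝ → ℝ≥0∞} (hf : Measurable f) (x : ℝ) {ε : ℝ}
    (hε : 0 < ε) :
    ∫⁻ y, ENNReal.ofReal (ε / ((x - y) ^ 2 + ε ^ 2)) * f y ≤ 16 * hlMaximal f x := by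
  -- the kernel is at most `4 / (4 ^ k ε)` where `|x - y| ≥ 2 ^ (k - 1) ε`
  have hpt : ∀ y, ENNReal.ofReal (ε / ((x - y) ^ 2 + ε ^ 2)) * f y ≤
      ∑' k : ℕ, ENNReal.ofReal (4 / (4 ^ k * ε)) * (Metric.ball x (2 ^ k * ε)).indicator f y := by
    intro y
    have hex : ∃ k : ℕ, |x - y| < 2 ^ k * ε := by
      obtain ⟨k, hk⟩ := pow_unbounded_of_one_lt (|x - y| / ε) (one_lt_two)
      exact ⟨k, by rwa [div_lt_iff₀ hε] at hk⟩
    classical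
    have hk := Nat.find_spec hex
    have hmin := fun m => @Nat.find_min _ _ hex m
    set k := Nat.find hex
    refine le_trans ?_ (ENNReal.le_tsum k)
    rw [indicator_of_mem (by rwa [Metric.mem_ball, dist_comm, Real.dist_eq])]
    gcongr ENNReal.ofReal ?_ * _
    rcases hkz : k with _ | m
    · rw [pow_zero, one_mul, div_le_div_iff₀ (by positivity) hε]
      nlinarith [sq_nonneg (x - y), sq_nonneg ε]
    · have h1 := hmin m (by omega)
      rw [not_lt] at h1
      have h2 : 4 ^ m * ε ^ 2 ≤ (x - y) ^ 2 := by
        rw [← sq_abs (x - y)]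
        calc (4 : ℝ) ^ m * ε ^ 2 = (2 ^ m * ε) ^ 2 := by
              rw [mul_pow, ← pow_mul, mul_comm m 2, pow_mul]; norm_num
          _ ≤ _ := by gcongr
      rw [div_le_div_iff₀ (by positivity) (by positivity), pow_succ]
      nlinarith [sq_nonneg ε]
  calc _ ≤ ∫⁻ y, ∑' k : ℕ,
        ENNReal.ofReal (4 / (4 ^ k * ε)) * (Metric.ball x (2 ^ k * ε)).indicator f y :=
        lintegral_mono hpt
    _ = ∑' k : ℕ, ENNReal.ofReal (4 / (4 ^ k * ε)) * ∫⁻ y in Metric.ball x (2 ^ k * ε), f y := by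
        rw [lintegral_tsum fun k =>
          ((hf.indicator Metric.isOpen_ball.measurableSet).const_mul _).aemeasurable]
        refine tsum_congr fun k => ?_
        rw [lintegral_const_mul _ (hf.indicator Metric.isOpen_ball.measurableSet),
          lintegral_indicator Metric.isOpen_ball.measurableSet]
    _ ≤ ∑' k : ℕ, ENNReal.ofReal (4 / (4 ^ k * ε)) *
          (ENNReal.ofReal (2 * (2 ^ k * ε)) * hlMaximal f x) := by
        gcongr with k
        exact lintegral_ball_le_hlMaximal f x (by positivity)
    _ = ∑' k : ℕ, 8 * (2⁻¹ : ℝ≥0∞) ^ k * hlMaximal f x := by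
        refine tsum_congr fun k => ?_
        rw [← mul_assoc, ← ENNReal.ofReal_mul (by positivity)]
        congr 1
        have h4 : (4 : ℝ) ^ k = 2 ^ k * 2 ^ k := by rw [← mul_pow]; norm_num
        have : 4 / (4 ^ k * ε) * (2 * (2 ^ k * ε)) = 8 * (2⁻¹ : ℝ) ^ k := by
          rw [h4, inv_pow]; field_simp; norm_num
        rw [this, ENNReal.ofReal_mul (by norm_num), ENNReal.ofReal_pow (by norm_num),
          ENNReal.ofReal_inv_of_pos (by norm_num)]
        norm_num
    _ = 16 * hlMaximal f x := by
        rw [ENNReal.tsum_mul_right, ENNReal.tsum_mul_left, ENNReal.tsum_geometric,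
          ENNReal.one_sub_inv_two, inv_inv]
        norm_num

/-! ### Real interpolation -/

lemma lintegral_Ioo_rpow_sub_one {s c : ℝ} (hs : 0 < s) (hc : 0 ≤ c) :
    ∫⁻ l in Ioo 0 c, ENNReal.ofReal (l ^ (s - 1)) = ENNReal.ofReal (c ^ s / s) := by
  rw [setLIntegral_congr Ioo_ae_eq_Ioc, ← ofReal_integral_eq_lintegral_ofReal]
  · rw [← intervalIntegral.integral_of_le hc, integral_rpow (Or.inl (by linarith)),
      Real.zero_rpow (by linarith)]
    simp
  · have := intervalIntegral.intervalIntegrable_rpow' (a := 0) (b := c) (r := s - 1) (by linarith)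
    rwa [intervalIntegrable_iff_integrableOn_Ioc_of_le hc] at this
  · filter_upwards [ae_restrict_mem measurableSet_Ioc] with l hl
    exact Real.rpow_nonneg hl.1.le _

lemma lintegral_Ici_rpow_neg_sub_one {s c : ℝ} (hs : 0 < s) (hc : 0 < c) :
    ∫⁻ l in Ici c, ENNReal.ofReal (l ^ (-s - 1)) = ENNReal.ofReal (c ^ (-s) / s) := by
  rw [setLIntegral_congr Ioi_ae_eq_Ici.symm, ← ofReal_integral_eq_lintegral_ofReal]
  · rw [integral_Ioi_rpow_of_lt (by linarith) hc]
    congr 1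
    rw [show -s - 1 + 1 = -s by ring, neg_div_neg_eq]
  · exact integrableOn_Ioi_rpow_of_lt (by linarith) hc
  · filter_upwards [ae_restrict_mem measurableSet_Ioi] with l hl
    exact Real.rpow_nonneg (hc.le.trans (le_of_lt hl)) _

lemma rpow_le_lintegral_Ioi_indicator {p : ℝ} (hp : 0 < p) (a : ℝ≥0∞) :
    a ^ p ≤ ∫⁻ l in Ioi (0 : ℝ), ENNReal.ofReal (p * 2 ^ p) * ENNReal.ofReal (l ^ (p - 1)) *
      {l : ℝ | ENNReal.ofReal (2 * l) < a}.indicator 1 l := by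
  have key : ∀ c : ℝ, 0 ≤ c → ENNReal.ofReal c ≤ a →
      ENNReal.ofReal c ^ p ≤ ∫⁻ l in Ioi (0 : ℝ), ENNReal.ofReal (p * 2 ^ p) *
        ENNReal.ofReal (l ^ (p - 1)) * {l : ℝ | ENNReal.ofReal (2 * l) < a}.indicator 1 l := by
    intro c hc hca
    calc ENNReal.ofReal c ^ p
        = ∫⁻ l in Ioo 0 (c / 2), ENNReal.ofReal (p * 2 ^ p) * ENNReal.ofReal (l ^ (p - 1)) := by
          rw [lintegral_const_mul _ (by fun_prop), lintegral_Ioo_rpow_sub_one hp (by positivity),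
            ← ENNReal.ofReal_mul (by positivity), ENNReal.ofReal_rpow_of_nonneg hc hp.le,
            Real.div_rpow hc (by norm_num)]
          congr 1
          have : (2 : ℝ) ^ p ≠ 0 := by positivity
          field_simp
      _ ≤ ∫⁻ l in Ioo 0 (c / 2), ENNReal.ofReal (p * 2 ^ p) *
        ENNReal.ofReal (l ^ (p - 1)) * {l : ℝ | ENNReal.ofReal (2 * l) < a}.indicator 1 l := by
          refine setLIntegral_mono' measurableSet_Ioo fun l hl => ?_
          rw [indicator_of_mem, Pi.one_apply, mul_one]
          refine lt_of_lt_of_le ?_ hca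
          rw [ENNReal.ofReal_lt_ofReal_iff_of_nonneg (by linarith [hl.1])]
          linarith [hl.2]
      _ ≤ _ := lintegral_mono_set Ioo_subset_Ioi_self
  rcases eq_or_ne a ∞ with rfl | ha
  · rw [ENNReal.top_rpow_of_pos hp]
    refine top_le_iff.2 (ENNReal.eq_top_of_forall_nnreal_le fun r => ?_)
    have := key ((r : ℝ) ^ p⁻¹) (by positivity) le_top
    rwa [ENNReal.ofReal_rpow_of_nonneg (by positivity) hp.le, ← Real.rpow_mul (by positivity),
      inv_mul_cancel₀ hp.ne', Real.rpow_one, ENNReal.ofReal_coe_nnreal] at this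
  · have := key a.toReal ENNReal.toReal_nonneg (ENNReal.ofReal_toReal ha).le
    rwa [ENNReal.ofReal_toReal ha] at this

/-- The Marcinkiewicz interpolation argument, stated for the distribution function of a single
function `F`: the part of `f` above height `A l` is controlled with exponent `q₀ < p`, the part
below with exponent `q₁ > p`. The free parameter `A` balances the constants `N₀` and `N₁`. -/
lemma lintegral_rpow_le_of_distribution {f F : ℝ → ℝ≥0∞} (hf : Measurable f) (hF : Measurable F)
    (hfin : ∀ x, f x ≠ ∞) {q₀ p q₁ A : ℝ} (hq₀ : 0 < q₀) (h₀ : q₀ < p) (h₁ : p < q₁) (hA : 0 < A)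
    {N₀ N₁ : ℝ≥0∞}
    (h : ∀ l : ℝ, 0 < l → volume {x | ENNReal.ofReal (2 * l) < F x} ≤
      N₀ * ENNReal.ofReal (l ^ (-q₀)) * (∫⁻ x in {x | ENNReal.ofReal (A * l) < f x}, f x ^ q₀) +
      N₁ * ENNReal.ofReal (l ^ (-q₁)) * ∫⁻ x in {x | f x ≤ ENNReal.ofReal (A * l)}, f x ^ q₁) :
    ∫⁻ x, F x ^ p ≤ ENNReal.ofReal (p * 2 ^ p) * (N₀ * ENNReal.ofReal (A ^ (q₀ - p) / (p - q₀)) +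
      N₁ * ENNReal.ofReal (A ^ (q₁ - p) / (q₁ - p))) * ∫⁻ x, f x ^ p := by
  have hp : 0 < p := hq₀.trans h₀
  have hms : ∀ l : ℝ, MeasurableSet {x | ENNReal.ofReal (A * l) < f x} := fun l =>
    measurableSet_lt measurable_const hf
  have hms' : ∀ l : ℝ, MeasurableSet {x | f x ≤ ENNReal.ofReal (A * l)} := fun l =>
    measurableSet_le hf measurable_const
  have hpair : MeasurableSet {z : ℝ × ℝ | ENNReal.ofReal (A * z.1) < f z.2} :=
    measurableSet_lt (by fun_prop) (by fun_prop)
  have hpair' : MeasurableSet {z : ℝ × ℝ | f z.2 ≤ ENNReal.ofReal (A * z.1)} :=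
    measurableSet_le (by fun_prop) (by fun_prop)
  -- the contribution of the large values of `f`
  have T₀ : ∫⁻ l in Ioi (0 : ℝ), ENNReal.ofReal (l ^ (p - q₀ - 1)) *
      ∫⁻ x in {x | ENNReal.ofReal (A * l) < f x}, f x ^ q₀ =
      ENNReal.ofReal (A ^ (q₀ - p) / (p - q₀)) * ∫⁻ x, f x ^ p := by
    calc _ = ∫⁻ l in Ioi (0 : ℝ), ∫⁻ x, ENNReal.ofReal (l ^ (p - q₀ - 1)) *
          ({z : ℝ × ℝ | ENNReal.ofReal (A * z.1) < f z.2}.indicator 1 (l, x) * f x ^ q₀) := by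
          refine lintegral_congr fun l => ?_
          rw [lintegral_const_mul _ (by
            refine Measurable.mul ?_ (by fun_prop)
            exact (measurable_one.indicator hpair).comp measurable_prodMk_left),
            ← lintegral_indicator (hms l)]
          congr 1
          refine lintegral_congr fun x => ?_
          by_cases hx : ENNReal.ofReal (A * l) < f x <;> simp [indicator, hx]
      _ = ∫⁻ x, ∫⁻ l in Ioi (0 : ℝ), ENNReal.ofReal (l ^ (p - q₀ - 1)) *
          ({z : ℝ × ℝ | ENNReal.ofReal (A * z.1) < f z.2}.indicator 1 (l, x) * f x ^ q₀) := by
          refine lintegral_lintegral_swap (Measurable.aemeasurable ?_)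
          refine Measurable.mul (by fun_prop) (Measurable.mul ?_ (by fun_prop))
          exact measurable_one.indicator hpair
      _ = ∫⁻ x, ENNReal.ofReal (A ^ (q₀ - p) / (p - q₀)) * f x ^ p := by
          refine lintegral_congr fun x => ?_
          obtain ⟨c, hc, hfc⟩ : ∃ c : ℝ, 0 ≤ c ∧ f x = ENNReal.ofReal c :=
            ⟨_, ENNReal.toReal_nonneg, (ENNReal.ofReal_toReal (hfin x)).symm⟩
          calc _ = ∫⁻ l in Ioo 0 (c / A), ENNReal.ofReal (l ^ (p - q₀ - 1)) * f x ^ q₀ := by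
                rw [← lintegral_indicator measurableSet_Ioi, ← lintegral_indicator measurableSet_Ioo]
                refine lintegral_congr fun l => ?_
                by_cases hl : 0 < l
                · have : ENNReal.ofReal (A * l) < f x ↔ l < c / A := by
                    rw [hfc, ENNReal.ofReal_lt_ofReal_iff_of_nonneg (by positivity),
                      lt_div_iff₀ hA, mul_comm]
                  by_cases hl' : l < c / A <;> simp [indicator, hl, this, hl']
                · simp [indicator, hl]
            _ = ENNReal.ofReal ((c / A) ^ (p - q₀) / (p - q₀)) * f x ^ q₀ := by
                rw [lintegral_mul_const _ (by fun_prop),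
                  lintegral_Ioo_rpow_sub_one (by linarith) (by positivity)]
            _ = _ := by
                rw [hfc, ENNReal.ofReal_rpow_of_nonneg hc hq₀.le,
                  ENNReal.ofReal_rpow_of_nonneg hc hp.le, ← ENNReal.ofReal_mul (by
                    have : 0 < p - q₀ := by linarith
                    positivity), ← ENNReal.ofReal_mul (by
                    have : 0 < p - q₀ := by linarith
                    positivity)]
                congr 1
                rw [Real.div_rpow hc hA.le, show c ^ p = c ^ (p - q₀) * c ^ q₀ by
                  rw [← Real.rpow_add' hc (by linarith)]; congr 1; ring,
                  show q₀ - p = -(p - q₀) by ring, Real.rpow_neg hA.le]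
                ring
      _ = _ := lintegral_const_mul _ (by fun_prop)
  have T₁ : ∫⁻ l in Ioi (0 : ℝ), ENNReal.ofReal (l ^ (-(q₁ - p) - 1)) *
      ∫⁻ x in {x | f x ≤ ENNReal.ofReal (A * l)}, f x ^ q₁ =
      ENNReal.ofReal (A ^ (q₁ - p) / (q₁ - p)) * ∫⁻ x, f x ^ p := by
    calc _ = ∫⁻ l in Ioi (0 : ℝ), ∫⁻ x, ENNReal.ofReal (l ^ (-(q₁ - p) - 1)) *
          ({z : ℝ × ℝ | f z.2 ≤ ENNReal.ofReal (A * z.1)}.indicator 1 (l, x) * f x ^ q₁) := by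
          refine lintegral_congr fun l => ?_
          rw [lintegral_const_mul _ (by
            refine Measurable.mul ?_ (by fun_prop)
            exact (measurable_one.indicator hpair').comp measurable_prodMk_left),
            ← lintegral_indicator (hms' l)]
          congr 1
          refine lintegral_congr fun x => ?_
          by_cases hx : f x ≤ ENNReal.ofReal (A * l) <;> simp [indicator, hx]
      _ = ∫⁻ x, ∫⁻ l in Ioi (0 : ℝ), ENNReal.ofReal (l ^ (-(q₁ - p) - 1)) *
          ({z : ℝ × ℝ | f z.2 ≤ ENNReal.ofReal (A * z.1)}.indicator 1 (l, x) * f x ^ q₁) := by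
          refine lintegral_lintegral_swap (Measurable.aemeasurable ?_)
          refine Measurable.mul (by fun_prop) (Measurable.mul ?_ (by fun_prop))
          exact measurable_one.indicator hpair'
      _ = ∫⁻ x, ENNReal.ofReal (A ^ (q₁ - p) / (q₁ - p)) * f x ^ p := by
          refine lintegral_congr fun x => ?_
          obtain ⟨c, hc, hfc⟩ : ∃ c : ℝ, 0 ≤ c ∧ f x = ENNReal.ofReal c :=
            ⟨_, ENNReal.toReal_nonneg, (ENNReal.ofReal_toReal (hfin x)).symm⟩
          rcases hc.eq_or_lt with rfl | hc'
          · rw [hfc, ENNReal.ofReal_zero, ENNReal.zero_rpow_of_pos (hp.trans h₁),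
              ENNReal.zero_rpow_of_pos hp]
            simp
          calc _ = ∫⁻ l in Ici (c / A), ENNReal.ofReal (l ^ (-(q₁ - p) - 1)) * f x ^ q₁ := by
                rw [← lintegral_indicator measurableSet_Ioi, ← lintegral_indicator measurableSet_Ici]
                refine lintegral_congr fun l => ?_
                by_cases hl : 0 < l
                · have : f x ≤ ENNReal.ofReal (A * l) ↔ c / A ≤ l := by
                    rw [hfc, ENNReal.ofReal_le_ofReal_iff (by positivity), div_le_iff₀ hA, mul_comm]
                  by_cases hl' : c / A ≤ l <;> simp [indicator, hl, this, hl']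
                · have : ¬ c / A ≤ l := fun h => hl (lt_of_lt_of_le (by positivity) h)
                  simp [indicator, hl, this]
            _ = ENNReal.ofReal ((c / A) ^ (-(q₁ - p)) / (q₁ - p)) * f x ^ q₁ := by
                rw [lintegral_mul_const _ (by fun_prop),
                  lintegral_Ici_rpow_neg_sub_one (by linarith) (by positivity)]
            _ = _ := by
                rw [hfc, ENNReal.ofReal_rpow_of_nonneg hc (by linarith),
                  ENNReal.ofReal_rpow_of_nonneg hc hp.le, ← ENNReal.ofReal_mul (by
                    have : 0 < q₁ - p := by linarith
                    positivity), ← ENNReal.ofReal_mul (by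
                    have : 0 < q₁ - p := by linarith
                    positivity)]
                congr 1
                rw [Real.div_rpow hc hA.le, show c ^ p = c ^ (-(q₁ - p)) * c ^ q₁ by
                  rw [← Real.rpow_add hc']; congr 1; ring, Real.rpow_neg hA.le]
                field_simp
      _ = _ := lintegral_const_mul _ (by fun_prop)
  have hm₀ : Measurable fun l : ℝ => ∫⁻ x in {x | ENNReal.ofReal (A * l) < f x}, f x ^ q₀ := by
    have : (fun l : ℝ => ∫⁻ x in {x | ENNReal.ofReal (A * l) < f x}, f x ^ q₀) = fun l : ℝ =>
        ∫⁻ x, {z : ℝ × ℝ | ENNReal.ofReal (A * z.1) < f z.2}.indicator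
          (fun z => f z.2 ^ q₀) (l, x) := by
      funext l
      rw [← lintegral_indicator (hms l)]
      rfl
    rw [this]
    exact Measurable.lintegral_prod_right (Measurable.indicator (by fun_prop) hpair)
  calc ∫⁻ x, F x ^ p
      ≤ ∫⁻ x, ∫⁻ l in Ioi (0 : ℝ), ENNReal.ofReal (p * 2 ^ p) * ENNReal.ofReal (l ^ (p - 1)) *
          {l : ℝ | ENNReal.ofReal (2 * l) < F x}.indicator 1 l :=
        lintegral_mono fun x => rpow_le_lintegral_Ioi_indicator hp _
    _ = ∫⁻ l in Ioi (0 : ℝ), ∫⁻ x, ENNReal.ofReal (p * 2 ^ p) * ENNReal.ofReal (l ^ (p - 1)) *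
          {l : ℝ | ENNReal.ofReal (2 * l) < F x}.indicator 1 l := by
        refine lintegral_lintegral_swap (Measurable.aemeasurable ?_)
        refine Measurable.mul (by fun_prop) ?_
        exact (measurable_one.indicator (s := {z : ℝ × ℝ | ENNReal.ofReal (2 * z.2) < F z.1})
          (measurableSet_lt (by fun_prop) (by fun_prop)))
    _ = ∫⁻ l in Ioi (0 : ℝ), ENNReal.ofReal (p * 2 ^ p) * ENNReal.ofReal (l ^ (p - 1)) *
          volume {x | ENNReal.ofReal (2 * l) < F x} := by
        refine lintegral_congr fun l => ?_
        have hm : MeasurableSet {x | ENNReal.ofReal (2 * l) < F x} :=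
          measurableSet_lt measurable_const hF
        rw [← lintegral_indicator_one hm, ← lintegral_const_mul _ (measurable_one.indicator hm)]
        rfl
    _ ≤ ∫⁻ l in Ioi (0 : ℝ), ENNReal.ofReal (p * 2 ^ p) * (N₀ * (ENNReal.ofReal (l ^ (p - q₀ - 1)) *
          ∫⁻ x in {x | ENNReal.ofReal (A * l) < f x}, f x ^ q₀) +
          N₁ * (ENNReal.ofReal (l ^ (-(q₁ - p) - 1)) *
          ∫⁻ x in {x | f x ≤ ENNReal.ofReal (A * l)}, f x ^ q₁)) := by
        refine setLIntegral_mono' measurableSet_Ioi fun l (hl : 0 < l) => ?_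
        rw [mul_assoc]
        refine mul_le_mul_right ?_ _
        refine (mul_le_mul_right (h l hl) _).trans (le_of_eq ?_)
        rw [show p - q₀ - 1 = (p - 1) + -q₀ by ring, show -(q₁ - p) - 1 = (p - 1) + -q₁ by ring,
          Real.rpow_add hl, Real.rpow_add hl, ENNReal.ofReal_mul (p := l ^ (p - 1)) (by positivity),
          ENNReal.ofReal_mul (p := l ^ (p - 1)) (by positivity)]
        ring
    _ = ENNReal.ofReal (p * 2 ^ p) * (N₀ * (∫⁻ l in Ioi (0 : ℝ), ENNReal.ofReal (l ^ (p - q₀ - 1)) *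
          ∫⁻ x in {x | ENNReal.ofReal (A * l) < f x}, f x ^ q₀) +
          N₁ * ∫⁻ l in Ioi (0 : ℝ), ENNReal.ofReal (l ^ (-(q₁ - p) - 1)) *
          ∫⁻ x in {x | f x ≤ ENNReal.ofReal (A * l)}, f x ^ q₁) := by
        have hm₁ : Measurable fun l : ℝ => ∫⁻ x in {x | f x ≤ ENNReal.ofReal (A * l)}, f x ^ q₁ := by
          have : (fun l : ℝ => ∫⁻ x in {x | f x ≤ ENNReal.ofReal (A * l)}, f x ^ q₁) = fun l : ℝ =>
              ∫⁻ x, {z : ℝ × ℝ | f z.2 ≤ ENNReal.ofReal (A * z.1)}.indicator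
                (fun z => f z.2 ^ q₁) (l, x) := by
            funext l
            rw [← lintegral_indicator (hms' l)]
            rfl
          rw [this]
          exact Measurable.lintegral_prod_right (Measurable.indicator (by fun_prop) hpair')
        have e₀ : Measurable fun l : ℝ => ENNReal.ofReal (l ^ (p - q₀ - 1)) *
          ∫⁻ x in {x | ENNReal.ofReal (A * l) < f x}, f x ^ q₀ := by fun_prop
        have e₁ : Measurable fun l : ℝ => ENNReal.ofReal (l ^ (-(q₁ - p) - 1)) *
          ∫⁻ x in {x | f x ≤ ENNReal.ofReal (A * l)}, f x ^ q₁ := by fun_prop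
        rw [lintegral_const_mul _ (by fun_prop), lintegral_add_left (by fun_prop),
          lintegral_const_mul _ e₀, lintegral_const_mul _ e₁]
    _ = _ := by rw [T₀, T₁]; ring

/-- The Hardy–Littlewood maximal function is bounded on `L^p`, `1 < p < ∞`. -/
lemma exists_lintegral_hlMaximal_rpow_le {p : ℝ} (hp : 1 < p) :
    ∃ C : ℝ≥0∞, C ≠ ∞ ∧ ∀ f : ℝ → ℝ≥0∞, Measurable f → (∀ x, f x ≠ ∞) →
      ∫⁻ x, hlMaximal f x ^ p ≤ C * ∫⁻ x, f x ^ p := by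
  refine ⟨_, ?_, fun f hf hfin => lintegral_rpow_le_of_distribution (q₀ := 1) (p := p)
    (q₁ := p + 1) (A := 1) (N₀ := 4) (N₁ := 4) hf (measurable_hlMaximal f) hfin one_pos hp
    (by linarith) one_pos ?_⟩
  · finiteness
  intro l hl
  set S := {x | ENNReal.ofReal (1 * l) < f x}
  have hS : MeasurableSet S := measurableSet_lt measurable_const hf
  have hSc : {x | f x ≤ ENNReal.ofReal (1 * l)} = Sᶜ := by ext x; simp [S]
  have hsub : {x | ENNReal.ofReal (2 * l) < hlMaximal f x} ⊆
      {x | ENNReal.ofReal l < hlMaximal (S.indicator f) x} ∪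
        {x | ENNReal.ofReal l < hlMaximal (Sᶜ.indicator f) x} := by
    intro x hx
    by_contra hcon
    simp only [mem_union, mem_ofPred_eq, not_or, not_lt] at hcon hx
    have hadd : hlMaximal f x ≤ hlMaximal (S.indicator f) x + hlMaximal (Sᶜ.indicator f) x := by
      refine iSup₂_le fun r hr => ?_
      have : ∫⁻ y in Metric.ball x r, f y = (∫⁻ y in Metric.ball x r, S.indicator f y) +
          ∫⁻ y in Metric.ball x r, Sᶜ.indicator f y := by
        rw [← lintegral_add_left (hf.indicator hS)]
        refine lintegral_congr fun y => ?_
        exact (congrFun (indicator_self_add_compl S f) y).symm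
      rw [this, mul_add]
      exact add_le_add (le_iSup₂_of_le r hr le_rfl) (le_iSup₂_of_le r hr le_rfl)
    have := hx.trans_le (hadd.trans (add_le_add hcon.1 hcon.2))
    rw [← ENNReal.ofReal_add hl.le hl.le, ← two_mul] at this
    exact lt_irrefl _ this
  have weak : ∀ q : ℝ, 1 ≤ q → ∀ T : Set ℝ, MeasurableSet T →
      volume {x | ENNReal.ofReal l < hlMaximal (T.indicator f) x} ≤
        4 * ENNReal.ofReal (l ^ (-q)) * ∫⁻ x in T, f x ^ q := by
    intro q hq T hT
    have h1 := hlMaximal_weak_type (hf.indicator hT) hq (ENNReal.ofReal l)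
    have h2 : ∫⁻ y, T.indicator f y ^ q = ∫⁻ x in T, f x ^ q := by
      rw [← lintegral_indicator hT]
      refine lintegral_congr fun y => ?_
      by_cases hy : y ∈ T <;> simp [hy, ENNReal.zero_rpow_of_pos (show 0 < q by linarith)]
    rw [h2] at h1
    have h3 : ENNReal.ofReal (l ^ (-q)) * ENNReal.ofReal l ^ q = 1 := by
      rw [ENNReal.ofReal_rpow_of_pos hl, ← ENNReal.ofReal_mul (by positivity), ← Real.rpow_add hl]
      simp
    calc _ = ENNReal.ofReal (l ^ (-q)) * (ENNReal.ofReal l ^ q *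
          volume {x | ENNReal.ofReal l < hlMaximal (T.indicator f) x}) := by
          rw [← mul_assoc, h3, one_mul]
      _ ≤ ENNReal.ofReal (l ^ (-q)) * (4 * ∫⁻ x in T, f x ^ q) := by gcongr
      _ = _ := by ring
  refine (measure_mono hsub).trans ((measure_union_le _ _).trans ?_)
  rw [hSc]
  exact add_le_add (weak 1 le_rfl S hS) (weak (p + 1) (by linarith) Sᶜ hS.compl)

/-! ### Analytic functions in the upper half-plane -/

/-- An analytic function on the closed upper half-plane decaying like `‖z‖ ^ (-q)`, `q > 1`, has
vanishing integral over the real line: push the contour to infinity. -/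
lemma integral_eq_zero_of_upperHalfPlane_decay {G : ℂ → ℂ} {q C R₀ : ℝ} (hq : 1 < q)
    (hG : ∀ z : ℂ, 0 ≤ z.im → DifferentiableAt ℂ G z)
    (hb : ∀ z : ℂ, 0 ≤ z.im → R₀ ≤ ‖z‖ → ‖G z‖ ≤ C * ‖z‖ ^ (-q)) :
    ∫ x : ℝ, G x = 0 := by
  by_cases hint : Integrable (fun x : ℝ => G x)
  swap
  · exact integral_undef hint
  have hlim : Tendsto (fun R : ℝ => ∫ x in (-R)..R, G x) atTop (𝓝 (∫ x : ℝ, G x)) :=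
    intervalIntegral_tendsto_integral hint tendsto_neg_atTop_atBot tendsto_id
  have hzero : Tendsto (fun R : ℝ => ∫ x in (-R)..R, G x) atTop (𝓝 0) := by
    have hdec : Tendsto (fun R : ℝ => 4 * C * R ^ (-(q - 1))) atTop (𝓝 0) := by
      simpa using (tendsto_rpow_neg_atTop (sub_pos.2 hq)).const_mul (4 * C)
    refine squeeze_zero_norm' ?_ hdec
    filter_upwards [eventually_ge_atTop R₀, eventually_gt_atTop 0] with R hR hR0
    have hC : 0 ≤ C := by
      have h1 := hb (R : ℂ) (by simp) (by simpa [abs_of_pos hR0] using hR)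
      have h2 : 0 < ‖(R : ℂ)‖ ^ (-q) := Real.rpow_pos_of_pos (by simpa using hR0.ne') _
      exact nonneg_of_mul_nonneg_left ((norm_nonneg _).trans h1) h2
    have hfar : ∀ z : ℂ, 0 ≤ z.im → R ≤ ‖z‖ → ‖G z‖ ≤ C * R ^ (-q) := fun z hz hzR => by
      refine (hb z hz (hR.trans hzR)).trans ?_
      gcongr C * ?_
      exact Real.rpow_le_rpow_of_nonpos hR0 hzR (by linarith)
    have hrect := Complex.integral_boundary_rect_eq_zero_of_differentiableOn G (-R : ℂ)
      (R + R * Complex.I) (by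
        intro z hz
        refine (hG z ?_).differentiableWithinAt
        have := hz.2
        simp [uIcc_of_le hR0.le] at this
        exact this.1)
    simp only [Complex.neg_re, Complex.ofReal_re, Complex.add_re, Complex.mul_re, Complex.I_re,
      mul_zero, Complex.ofReal_im, Complex.I_im, mul_one, sub_self, add_zero, Complex.neg_im,
      neg_zero, Complex.ofReal_zero, zero_mul, Complex.add_im, Complex.mul_im, zero_add] at hrect
    have htop : ‖∫ x in (-R)..R, G (x + R * Complex.I)‖ ≤ C * R ^ (-q) * |R - -R| := by
      refine intervalIntegral.norm_integral_le_of_norm_le_const fun x _ => ?_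
      refine hfar _ (by simpa using hR0.le) ?_
      calc R = |(x + R * Complex.I : ℂ).im| := by simp [abs_of_pos hR0]
        _ ≤ _ := Complex.abs_im_le_norm _
    have hright : ‖∫ y in (0 : ℝ)..R, G (R + y * Complex.I)‖ ≤ C * R ^ (-q) * |R - 0| := by
      refine intervalIntegral.norm_integral_le_of_norm_le_const fun y hy => ?_
      rw [uIoc_of_le hR0.le] at hy
      refine hfar _ (by simpa using hy.1.le) ?_
      calc R = |(R + y * Complex.I : ℂ).re| := by simp [abs_of_pos hR0]
        _ ≤ _ := Complex.abs_re_le_norm _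
    have hleft : ‖∫ y in (0 : ℝ)..R, G (-R + y * Complex.I)‖ ≤ C * R ^ (-q) * |R - 0| := by
      refine intervalIntegral.norm_integral_le_of_norm_le_const fun y hy => ?_
      rw [uIoc_of_le hR0.le] at hy
      refine hfar _ (by simpa using hy.1.le) ?_
      calc R = |(-R + y * Complex.I : ℂ).re| := by simp [abs_of_pos hR0]
        _ ≤ _ := Complex.abs_re_le_norm _
    have heq : ∫ x in (-R)..R, G x = (∫ x in (-R)..R, G (x + R * Complex.I)) -
        Complex.I • (∫ y in (0 : ℝ)..R, G (R + y * Complex.I)) +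
        Complex.I • ∫ y in (0 : ℝ)..R, G (-R + y * Complex.I) := by
      push_cast at hrect
      linear_combination hrect
    have hRq : R ^ (-(q - 1)) = R ^ (-q) * R := by
      rw [← Real.rpow_add_one hR0.ne']; congr 1; ring
    rw [heq, hRq]
    refine (norm_add_le _ _).trans ((add_le_add_left (norm_sub_le _ _) _).trans ?_)
    rw [norm_smul, norm_smul, Complex.norm_I, one_mul, one_mul]
    rw [show R - -R = 2 * R by ring, abs_of_pos (by positivity)] at htop
    rw [sub_zero, abs_of_pos hR0] at hright hleft
    linarith
  exact tendsto_nhds_unique hlim hzero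

/-- The Poisson formula for a bounded analytic function `F`, in the form needed here: it follows
from `integral_eq_zero_of_upperHalfPlane_decay` applied to
`ζ ↦ (F ζ - F z) / ((ζ - z) (ζ - conj z))`. -/
lemma enorm_le_hlMaximal_of_bounded_analytic {F : ℂ → ℂ} {C : ℝ}
    (hF : ∀ z : ℂ, 0 ≤ z.im → DifferentiableAt ℂ F z) (hC : ∀ z : ℂ, 0 ≤ z.im → ‖F z‖ ≤ C)
    (x : ℝ) {y : ℝ} (hy : 0 < y) :
    ‖F (x + y * Complex.I)‖ₑ ≤ 16 * hlMaximal (fun t : ℝ => ‖F t‖ₑ) x := by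
  set w : ℂ := x + y * Complex.I with hw
  set w' : ℂ := x - y * Complex.I with hw'
  have hw_im : w.im = y := by simp [hw]
  have hw'_im : w'.im = -y := by simp [hw']
  have hww' : ‖w'‖ = ‖w‖ := by
    have : w' = (starRingEnd ℂ) w := by simp [hw, hw', sub_eq_add_neg]
    rw [this, Complex.norm_conj]
  have hne : ∀ z : ℂ, 0 ≤ z.im → z - w' ≠ 0 := fun z hz h => by
    have := congrArg Complex.im h
    simp [hw'_im] at this
    linarith
  have hC0 : 0 ≤ C := (norm_nonneg _).trans (hC 0 (by simp))
  have hzero : ∫ t : ℝ, dslope F w t / (t - w') = 0 := by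
    refine integral_eq_zero_of_upperHalfPlane_decay (q := 2) (C := 8 * C) (R₀ := 2 * ‖w‖ + 1)
      (G := fun z => dslope F w z / (z - w')) one_lt_two (fun z hz => ?_) (fun z hz hzR => ?_)
    · refine DifferentiableAt.div ?_ (by fun_prop) (hne z hz)
      by_cases hzw : z = w
      · have hopen : {z : ℂ | 0 < z.im} ∈ 𝓝 w :=
          (isOpen_lt continuous_const Complex.continuous_im).mem_nhds (by simpa [hw_im] using hy)
        have h1 : DifferentiableOn ℂ (dslope F w) {z : ℂ | 0 < z.im} :=
          (Complex.differentiableOn_dslope hopen).2 fun z hz =>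
            (hF z (le_of_lt hz)).differentiableWithinAt
        rw [hzw]
        exact h1.differentiableAt hopen
      · exact (differentiableAt_dslope_of_ne hzw).2 (hF z hz)
    · have hzw : z ≠ w := by
        rintro rfl
        have := norm_nonneg w
        linarith
      have hz0 : 0 < ‖z‖ := by have := norm_nonneg w; linarith
      have e1 : ‖z‖ / 2 ≤ ‖z - w‖ := by
        have := norm_sub_norm_le z w
        linarith
      have e2 : ‖z‖ / 2 ≤ ‖z - w'‖ := by
        have := norm_sub_norm_le z w'
        linarith
      rw [dslope_of_ne _ hzw, slope_def_field, norm_div, norm_div]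
      have e3 : ‖F z - F w‖ ≤ 2 * C := by
        have := norm_sub_le (F z) (F w)
        linarith [hC z hz, hC w (by rw [hw_im]; exact hy.le)]
      calc ‖F z - F w‖ / ‖z - w‖ / ‖z - w'‖ ≤ 2 * C / (‖z‖ / 2) / (‖z‖ / 2) := by gcongr
        _ = 8 * C * ‖z‖ ^ (-2 : ℝ) := by
          rw [Real.rpow_neg hz0.le, Real.rpow_two]; field_simp; ring
  set P : ℝ → ℝ := fun t => ProbabilityTheory.cauchyPDFReal x y.toNNReal t with hP
  have hy' : y.toNNReal ≠ 0 := by simpa using hy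
  have hPdef : ∀ t, P t = Real.pi⁻¹ * (y / ((x - t) ^ 2 + y ^ 2)) := fun t => by
    simp only [hP, ProbabilityTheory.cauchyPDFReal_def, Real.coe_toNNReal y hy.le]
    rw [show (t - x) ^ 2 = (x - t) ^ 2 by ring]
    ring
  have hPint : Integrable P := ProbabilityTheory.integrable_cauchyPDFReal x
  have hP1 : ∫ t, P t = 1 := ProbabilityTheory.integral_cauchyPDFReal_eq_one x hy'
  have hFc : Continuous fun t : ℝ => F t := by
    refine continuous_iff_continuousAt.2 fun t => ?_
    exact ContinuousAt.comp (f := fun t : ℝ => (t : ℂ)) (hF t (by simp)).continuousAt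
      Complex.continuous_ofReal.continuousAt
  have hPF : Integrable fun t => (P t : ℂ) * F t := by
    refine hPint.ofReal.mul_bdd (c := C) hFc.aestronglyMeasurable ?_
    exact ae_of_all _ fun t => hC t (by simp)
  have heq : ∀ t : ℝ, (P t : ℂ) * F t - P t * F w =
      ((Real.pi⁻¹ * y : ℝ) : ℂ) * (dslope F w t / (t - w')) := fun t => by
    have htw : (t : ℂ) ≠ w := fun h => by
      have := congrArg Complex.im h
      rw [hw_im] at this
      simp at this
      exact hy.ne this
    rw [dslope_of_ne _ htw, slope_def_field, hPdef]
    have h1 : (t : ℂ) - w ≠ 0 := sub_ne_zero.2 htw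
    have h2 := hne t (by simp)
    have h3 : ((x - t : ℂ)) ^ 2 + (y : ℂ) ^ 2 = (t - w) * (t - w') := by
      rw [hw, hw']
      linear_combination (y : ℂ) ^ 2 * Complex.I_sq
    push_cast
    rw [h3]
    field_simp
  have hfin : F w = ∫ t, (P t : ℂ) * F t := by
    have h1 : ∫ t, ((P t : ℂ) * F t - P t * F w) = 0 := by
      simp_rw [heq]
      rw [integral_const_mul, hzero, mul_zero]
    have h2 : Integrable fun t => (P t : ℂ) * F w := hPint.ofReal.mul_const _
    have h3 : ∫ t, (P t : ℂ) = 1 := by rw [integral_complex_ofReal, hP1, Complex.ofReal_one]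
    rw [integral_sub hPF h2, integral_mul_const, h3, one_mul, sub_eq_zero] at h1
    exact h1.symm
  calc ‖F w‖ₑ = ‖∫ t, (P t : ℂ) * F t‖ₑ := by rw [← hfin]
    _ ≤ ∫⁻ t, ‖(P t : ℂ) * F t‖ₑ := enorm_integral_le_lintegral_enorm _
    _ ≤ ∫⁻ t, ENNReal.ofReal (y / ((x - t) ^ 2 + y ^ 2)) * ‖F t‖ₑ := by
        refine lintegral_mono fun t => ?_
        rw [enorm_mul]
        gcongr
        rw [← ofReal_norm, Complex.norm_real, Real.norm_eq_abs]
        refine ENNReal.ofReal_le_ofReal ?_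
        rw [hPdef, abs_of_nonneg (by positivity)]
        refine mul_le_of_le_one_left (by positivity) (inv_le_one_of_one_le₀ ?_)
        linarith [Real.pi_gt_three]
    _ ≤ _ := lintegral_poisson_le_hlMaximal hFc.measurable.enorm x hy

/-- If `p` is not an odd integer, `‖w‖ ^ p` is controlled on the right half-plane by `(re w) ^ p`
and the harmonic function `re (w ^ p)`, because the latter does not vanish on the imaginary axis. -/
lemma exists_norm_rpow_le_re_rpow {p : ℝ} (hp : 0 < p) (hcos : Real.cos (p * (Real.pi / 2)) ≠ 0) :
    ∃ A B : ℝ, 0 ≤ A ∧ ∀ w : ℂ, 0 < w.re →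
      ‖w‖ ^ p ≤ A * w.re ^ p + B * (w ^ (p : ℂ)).re := by
  set B := 2 / Real.cos (p * (Real.pi / 2)) with hB
  have hnear : ∀ᶠ θ in 𝓝 (Real.pi / 2), 1 < B * Real.cos (p * θ) := by
    have hc : ContinuousAt (fun θ => B * Real.cos (p * θ)) (Real.pi / 2) := by fun_prop
    refine hc.eventually (lt_mem_nhds ?_)
    simp only [hB, div_mul_cancel₀ _ hcos]
    norm_num
  obtain ⟨δ, hδ, hnear⟩ := Metric.eventually_nhds_iff.1 hnear
  -- it suffices to treat angles `0 ≤ θ < π / 2`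
  have hδ' : ∃ c : ℝ, 0 < c ∧ ∀ θ : ℝ, 0 ≤ θ → θ ≤ Real.pi / 2 → ¬ (Real.pi / 2 - θ < δ) →
      c ≤ Real.cos θ := by
    by_cases hlarge : δ ≤ Real.pi / 2
    · refine ⟨Real.cos (Real.pi / 2 - δ), Real.cos_pos_of_mem_Ioo ⟨by linarith, by linarith⟩, ?_⟩
      intro θ h0 _ h2
      exact Real.cos_le_cos_of_nonneg_of_le_pi h0 (by linarith [Real.pi_pos]) (by linarith)
    · exact ⟨1, one_pos, fun θ h0 _ h2 => absurd (by linarith) h2⟩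
  obtain ⟨c, hc, hcos'⟩ := hδ'
  set A := (1 + |B|) / c ^ p with hA
  have hA0 : 0 ≤ A := by positivity
  have main : ∀ θ : ℝ, 0 ≤ θ → θ ≤ Real.pi / 2 →
      1 ≤ A * Real.cos θ ^ p + B * Real.cos (p * θ) := by
    intro θ h0 h1
    have hcosnn : 0 ≤ Real.cos θ := Real.cos_nonneg_of_mem_Icc ⟨by linarith [Real.pi_pos], h1⟩
    by_cases h2 : Real.pi / 2 - θ < δ
    · have h3 := @hnear θ (by rw [Real.dist_eq, abs_sub_comm, abs_of_nonneg (by linarith)]; exact h2)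
      have : 0 ≤ A * Real.cos θ ^ p := by positivity
      linarith
    · have h3 : 1 + |B| ≤ A * Real.cos θ ^ p := by
        rw [hA, div_mul_eq_mul_div, le_div_iff₀ (by positivity)]
        gcongr
        exact hcos' θ h0 h1 h2
      have h4 : -|B| ≤ B * Real.cos (p * θ) := by
        have : |B * Real.cos (p * θ)| ≤ |B| := by
          rw [abs_mul]; exact mul_le_of_le_one_right (abs_nonneg _) (Real.abs_cos_le_one _)
        exact (abs_le.1 this).1
      linarith
  refine ⟨A, B, hA0, fun w hw => ?_⟩
  have hre : w.re = ‖w‖ * Real.cos |w.arg| := by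
    rw [Real.cos_abs, Complex.norm_mul_cos_arg]
  have harg : |w.arg| ≤ Real.pi / 2 := Complex.abs_arg_le_pi_div_two_iff.2 hw.le
  have hcp : (w ^ (p : ℂ)).re = ‖w‖ ^ p * Real.cos (p * |w.arg|) := by
    rw [Complex.cpow_ofReal_re, mul_comm w.arg, ← Real.cos_abs (p * w.arg), abs_mul,
      abs_of_pos hp]
  have hcosnn : 0 ≤ Real.cos |w.arg| :=
    Real.cos_nonneg_of_mem_Icc ⟨by linarith [Real.pi_pos, abs_nonneg w.arg], harg⟩
  have := mul_le_mul_of_nonneg_left (main |w.arg| (abs_nonneg _) harg)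
    (Real.rpow_nonneg (norm_nonneg w) p)
  rw [hcp, hre, Real.mul_rpow (norm_nonneg _) hcosnn]
  linarith

/-! ### The maximal Hilbert transform of a bounded function of compact support -/

/-- The Cauchy transform `z ↦ ∫ i g(s) / (z - s) ds`. In the upper half-plane its real part is
`π` times the Poisson integral of `g` and its imaginary part `π` times the conjugate Poisson
integral. -/
noncomputable def cauchyTransform (g : ℝ → ℝ) (z : ℂ) : ℂ :=
  ∫ s : ℝ, Complex.I * g s / (z - s)

lemma integrable_of_bounded_of_support {g : ℝ → ℝ} {b N : ℝ} (hg : Measurable g)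
    (h0 : ∀ s, 0 ≤ g s) (hb : ∀ s, g s ≤ b) (hN : ∀ s, N < |s| → g s = 0) : Integrable g := by
  have h1 : IntegrableOn g (Icc (-N) N) :=
    Measure.integrableOn_of_bounded (M := b) (by simp) hg.aestronglyMeasurable
      (ae_of_all _ fun s => by rw [Real.norm_of_nonneg (h0 s)]; exact hb s)
  refine (integrableOn_iff_integrable_of_support_subset fun s hs => ?_).1 h1
  by_contra hcon
  exact hs (hN s (by rw [mem_Icc, ← abs_le, not_le] at hcon; exact hcon))

lemma im_le_norm_sub_ofReal (z : ℂ) (s : ℝ) : z.im ≤ ‖z - s‖ := by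
  have := (le_abs_self _).trans (Complex.abs_im_le_norm (z - s))
  simpa using this

lemma sub_ofReal_ne_zero {z : ℂ} (hz : 0 < z.im) (s : ℝ) : z - s ≠ 0 := by
  rw [← norm_pos_iff]
  exact hz.trans_le (im_le_norm_sub_ofReal z s)

lemma integrable_cauchyTransform_integrand {g : ℝ → ℝ} (hi : Integrable g)
    {z : ℂ} (hz : 0 < z.im) : Integrable fun s : ℝ => Complex.I * g s / (z - s) := by
  simp_rw [div_eq_mul_inv]
  refine (hi.ofReal.const_mul Complex.I).mul_bdd (c := z.im⁻¹) (by fun_prop) ?_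
  refine ae_of_all _ fun s => ?_
  rw [norm_inv]
  gcongr
  exact im_le_norm_sub_ofReal z s

lemma differentiableAt_cauchyTransform {g : ℝ → ℝ} (hg : Measurable g) (hi : Integrable g)
    {z : ℂ} (hz : 0 < z.im) : DifferentiableAt ℂ (cauchyTransform g) z := by
  have him : ∀ w ∈ Metric.ball z (z.im / 2), z.im / 2 < w.im := fun w hw => by
    have h1 : ‖w - z‖ < z.im / 2 := by rwa [Metric.mem_ball, dist_eq_norm] at hw
    have h2 := (Complex.abs_im_le_norm (w - z)).trans_lt h1
    rw [Complex.sub_im, abs_lt] at h2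
    linarith
  refine (hasDerivAt_integral_of_dominated_loc_of_deriv_le
    (F := fun (w : ℂ) (s : ℝ) => Complex.I * g s / (w - s))
    (F' := fun (w : ℂ) (s : ℝ) => -(Complex.I * g s) / (w - s) ^ 2)
    (bound := fun s => ‖g s‖ * ((z.im / 2) ^ 2)⁻¹)
    (Metric.ball_mem_nhds z (half_pos hz)) (Eventually.of_forall fun w => ?_)
    (integrable_cauchyTransform_integrand hi hz) ?_ ?_ ?_ ?_).2.differentiableAt
  · exact Measurable.aestronglyMeasurable (by fun_prop)
  · exact Measurable.aestronglyMeasurable (by fun_prop)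
  · refine ae_of_all _ fun s w hw => ?_
    have h1 := him w hw
    rw [norm_div, norm_neg, norm_mul, Complex.norm_I, one_mul, Complex.norm_real, norm_pow,
      div_eq_mul_inv]
    gcongr
    exact h1.le.trans (im_le_norm_sub_ofReal w s)
  · exact hi.norm.mul_const _
  · refine ae_of_all _ fun s w hw => ?_
    have hne := sub_ofReal_ne_zero ((half_pos hz).trans (him w hw)) s
    have := (((hasDerivAt_id w).sub_const (s : ℂ)).fun_inv hne).const_mul (Complex.I * g s)
    simp only [id, ← div_eq_mul_inv] at this
    refine this.congr_deriv ?_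
    ring

lemma cauchyTransform_integrand_eq (g : ℝ → ℝ) {z : ℂ} (hz : 0 < z.im) (s : ℝ) :
    Complex.I * g s / (z - s) =
      ((z.im / ((z.re - s) ^ 2 + z.im ^ 2) * g s : ℝ) : ℂ) +
        ((z.re - s) / ((z.re - s) ^ 2 + z.im ^ 2) * g s : ℝ) * Complex.I := by
  have h1 := sub_ofReal_ne_zero hz s
  have h2 : ((z.re - s) ^ 2 + z.im ^ 2 : ℝ) ≠ 0 := by positivity
  have h2' : ((z.re : ℂ) - s) ^ 2 + (z.im : ℂ) ^ 2 ≠ 0 := by exact_mod_cast h2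
  rw [div_eq_iff h1]
  push_cast
  field_simp
  have h3 : z = z.re + z.im * Complex.I := (Complex.re_add_im z).symm
  generalize z.re = a at *
  generalize z.im = c at *
  rw [h3]
  linear_combination (-(g s : ℂ) * c * (a - s)) * Complex.I_sq

lemma cauchyTransform_re {g : ℝ → ℝ} (hi : Integrable g)
    {z : ℂ} (hz : 0 < z.im) :
    (cauchyTransform g z).re = ∫ s, z.im / ((z.re - s) ^ 2 + z.im ^ 2) * g s := by
  have h := Complex.reCLM.integral_comp_comm (integrable_cauchyTransform_integrand hi hz)
  simp only [Complex.reCLM_apply] at h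
  rw [cauchyTransform, ← h]
  refine integral_congr_ae (ae_of_all _ fun s => ?_)
  simp only [cauchyTransform_integrand_eq g hz s]
  simp only [Complex.add_re, Complex.ofReal_re, Complex.re_ofReal_mul, Complex.I_re, mul_zero,
    add_zero]

lemma cauchyTransform_im {g : ℝ → ℝ} (hi : Integrable g)
    {z : ℂ} (hz : 0 < z.im) :
    (cauchyTransform g z).im = ∫ s, (z.re - s) / ((z.re - s) ^ 2 + z.im ^ 2) * g s := by
  have h := Complex.imCLM.integral_comp_comm (integrable_cauchyTransform_integrand hi hz)
  simp only [Complex.imCLM_apply] at h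
  rw [cauchyTransform, ← h]
  refine integral_congr_ae (ae_of_all _ fun s => ?_)
  simp only [cauchyTransform_integrand_eq g hz s]
  simp only [Complex.add_im, Complex.ofReal_im, Complex.im_ofReal_mul, Complex.I_im, mul_one,
    zero_add]

lemma exists_norm_cauchyTransform_le {g : ℝ → ℝ} {b N : ℝ} (hg : Measurable g)
    (h0 : ∀ s, 0 ≤ g s) (hb : ∀ s, g s ≤ b) (hN0 : 0 ≤ N) (hN : ∀ s, N < |s| → g s = 0)
    {ε : ℝ} (hε : 0 < ε) :
    ∃ D : ℝ, 0 ≤ D ∧ ∀ z : ℂ, 0 ≤ z.im →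
      ‖cauchyTransform g (z + ε * Complex.I)‖ ≤ D / (1 + ‖z‖) := by
  have hi := integrable_of_bounded_of_support hg h0 hb hN
  refine ⟨((1 + N + ε) / ε + 1) * ∫ s, g s,
    by have : 0 ≤ ∫ s, g s := integral_nonneg (show 0 ≤ g from h0); positivity,
    fun z hz => ?_⟩
  have hz' : 0 < (z + ε * Complex.I).im := by simp; linarith
  calc ‖cauchyTransform g (z + ε * Complex.I)‖
      ≤ ∫ s, ((1 + N + ε) / ε + 1) / (1 + ‖z‖) * g s := by
        refine norm_integral_le_of_norm_le (hi.const_mul _) (ae_of_all _ fun s => ?_)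
        by_cases hs : N < |s|
        · simp [hN s hs]
        rw [not_lt] at hs
        have h1 : ε ≤ ‖z + ε * Complex.I - s‖ := by
          refine le_trans ?_ (im_le_norm_sub_ofReal _ s)
          simpa using hz
        have h2 : ‖z‖ ≤ ‖z + ε * Complex.I - s‖ + ε + N := by
          calc ‖z‖ = ‖(z + ε * Complex.I - s) - ε * Complex.I + s‖ := by congr 1; ring
            _ ≤ ‖z + ε * Complex.I - s‖ + ‖(ε : ℂ) * Complex.I‖ + ‖(s : ℂ)‖ :=
              (norm_add_le _ _).trans (add_le_add_left (norm_sub_le _ _) _)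
            _ ≤ _ := by
              rw [norm_mul, Complex.norm_I, mul_one, Complex.norm_real, Complex.norm_real,
                Real.norm_of_nonneg hε.le, Real.norm_eq_abs]
              gcongr
        have h3 : 0 < ‖z + ε * Complex.I - s‖ := hε.trans_le h1
        rw [norm_div, norm_mul, Complex.norm_I, one_mul, Complex.norm_real,
          Real.norm_of_nonneg (h0 s), div_mul_eq_mul_div, div_le_div_iff₀ h3 (by positivity)]
        rw [mul_comm (_ + 1 : ℝ) (g s), mul_assoc]
        refine mul_le_mul_of_nonneg_left ?_ (h0 s)
        have h4 : 1 + N + ε ≤ (1 + N + ε) / ε * ‖z + ε * Complex.I - s‖ := by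
          rw [div_mul_eq_mul_div, le_div_iff₀ hε]
          gcongr
        linarith
    _ = _ := by rw [integral_const_mul]; ring

/-- Calderón's proof of M. Riesz's inequality: for nonnegative `g` the Cauchy transform has
positive real part, and its `p`-th power is analytic with vanishing integral over horizontal
lines. -/
lemma exists_lintegral_cauchyTransform_rpow_le {p : ℝ} (hp : 1 < p)
    (hcos : Real.cos (p * (Real.pi / 2)) ≠ 0) :
    ∃ K : ℝ≥0∞, K ≠ ∞ ∧ ∀ (g : ℝ → ℝ) (b N : ℝ), Measurable g → (∀ s, 0 ≤ g s) →
      (∀ s, g s ≤ b) → 0 ≤ N → (∀ s, N < |s| → g s = 0) → ∀ ε : ℝ, 0 < ε →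
      ∫⁻ t : ℝ, ‖cauchyTransform g (t + ε * Complex.I)‖ₑ ^ p ≤ K * ∫⁻ t, ‖g t‖ₑ ^ p := by
  have hp0 : 0 < p := by linarith
  obtain ⟨A, B, hA, hAB⟩ := exists_norm_rpow_le_re_rpow hp0 hcos
  obtain ⟨C, hC, hM⟩ := exists_lintegral_hlMaximal_rpow_le hp
  refine ⟨ENNReal.ofReal A * 16 ^ p * C, by finiteness, ?_⟩
  intro g b N hg h0 hb hN0 hN ε hε
  have hi := integrable_of_bounded_of_support hg h0 hb hN
  have h0' : 0 ≤ g := h0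
  rcases (integral_nonneg h0').eq_or_lt with hI | hI
  · have hae : g =ᵐ[volume] 0 := (integral_eq_zero_iff_of_nonneg h0' hi).1 hI.symm
    have hz : ∀ z, cauchyTransform g z = 0 := fun z => by
      rw [cauchyTransform]
      refine integral_eq_zero_of_ae ?_
      filter_upwards [hae] with s hs
      simp [hs]
    simp [hz, hp0]
  set F : ℂ → ℂ := fun z => cauchyTransform g (z + ε * Complex.I) with hFdef
  have him : ∀ z : ℂ, 0 ≤ z.im → 0 < (z + ε * Complex.I).im := fun z hz => by simp; linarith
  have hFre : ∀ z : ℂ, 0 ≤ z.im → 0 < (F z).re := fun z hz => by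
    have hz' := him z hz
    rw [hFdef, cauchyTransform_re hi hz']
    set w := z + ε * Complex.I
    have hnn : ∀ s, 0 ≤ w.im / ((w.re - s) ^ 2 + w.im ^ 2) * g s := fun s => by
      have := h0 s; positivity
    have hint : Integrable fun s => w.im / ((w.re - s) ^ 2 + w.im ^ 2) * g s := by
      refine hi.bdd_mul (c := w.im⁻¹) (Measurable.aestronglyMeasurable (by fun_prop)) ?_
      refine ae_of_all _ fun s => ?_
      rw [Real.norm_of_nonneg (by positivity), div_le_iff₀ (by positivity)]
      have : w.im⁻¹ * ((w.re - s) ^ 2 + w.im ^ 2) = w.im⁻¹ * (w.re - s) ^ 2 + w.im := by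
        field_simp
      rw [this]
      have : 0 ≤ w.im⁻¹ * (w.re - s) ^ 2 := by positivity
      linarith
    rw [integral_pos_iff_support_of_nonneg hnn hint]
    rw [integral_pos_iff_support_of_nonneg h0' hi] at hI
    convert hI using 2
    ext s
    have : w.im / ((w.re - s) ^ 2 + w.im ^ 2) ≠ 0 := by positivity
    simp only [Function.mem_support, ne_eq, mul_eq_zero, this, false_or]
  obtain ⟨D, hD0, hD⟩ := exists_norm_cauchyTransform_le hg h0 hb hN0 hN hε
  have hFd : ∀ z : ℂ, 0 ≤ z.im → DifferentiableAt ℂ F z := fun z hz =>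
    DifferentiableAt.comp (g := cauchyTransform g) (f := fun z => z + ε * Complex.I) z
      (differentiableAt_cauchyTransform hg hi (him z hz)) (by fun_prop)
  have hGd : ∀ z : ℂ, 0 ≤ z.im → DifferentiableAt ℂ (fun z => F z ^ (p : ℂ)) z := fun z hz =>
    (hFd z hz).cpow_const (Or.inl (hFre z hz))
  have hzero : ∫ t : ℝ, F t ^ (p : ℂ) = 0 := by
    refine integral_eq_zero_of_upperHalfPlane_decay (G := fun z => F z ^ (p : ℂ)) (q := p)
      (C := D ^ p) (R₀ := 1) hp hGd fun z hz hz1 => ?_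
    rw [Complex.norm_cpow_real]
    calc ‖F z‖ ^ p ≤ (D / ‖z‖) ^ p := by
          gcongr
          refine (hD z hz).trans ?_
          gcongr
          linarith
      _ = D ^ p * ‖z‖ ^ (-p) := by
          rw [Real.div_rpow hD0 (norm_nonneg _), Real.rpow_neg (norm_nonneg _)]; rfl
  have hcont : Continuous fun t : ℝ => F t := continuous_iff_continuousAt.2 fun t =>
    ContinuousAt.comp (f := fun t : ℝ => (t : ℂ)) (hFd t (by simp)).continuousAt
      Complex.continuous_ofReal.continuousAt
  have hcontG : Continuous fun t : ℝ => F t ^ (p : ℂ) := continuous_iff_continuousAt.2 fun t =>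
    ContinuousAt.comp (g := fun z => F z ^ (p : ℂ)) (f := fun t : ℝ => (t : ℂ))
      (hGd t (by simp)).continuousAt Complex.continuous_ofReal.continuousAt
  have hdom : Integrable fun t : ℝ => D ^ p * (1 + ‖t‖) ^ (-p) :=
    (integrable_one_add_norm (by simpa using hp)).const_mul _
  have hdomle : ∀ t : ℝ, ‖F t‖ ^ p ≤ D ^ p * (1 + ‖t‖) ^ (-p) := fun t => by
    have h1 := hD t (by simp)
    calc ‖F t‖ ^ p ≤ (D / (1 + ‖(t : ℂ)‖)) ^ p := by gcongr
      _ = _ := by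
        rw [Complex.norm_real, Real.div_rpow hD0 (by positivity),
          Real.rpow_neg (by positivity), div_eq_mul_inv]
  have hint : Integrable fun t : ℝ => ‖F t‖ ^ p :=
    hdom.mono' (hcont.norm.rpow_const fun _ => Or.inr hp0.le).aestronglyMeasurable
      (ae_of_all _ fun t => by rw [Real.norm_of_nonneg (by positivity)]; exact hdomle t)
  have hintG : Integrable fun t : ℝ => F t ^ (p : ℂ) :=
    hdom.mono' hcontG.aestronglyMeasurable
      (ae_of_all _ fun t => by rw [Complex.norm_cpow_real]; exact hdomle t)
  have hintre : Integrable fun t : ℝ => (F t).re ^ p := by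
    refine hint.mono' ((Complex.continuous_re.comp hcont).rpow_const
      fun _ => Or.inr hp0.le).aestronglyMeasurable (ae_of_all _ fun t => ?_)
    have := hFre t (by simp)
    rw [Real.norm_of_nonneg (by positivity)]
    gcongr
    exact Complex.re_le_norm _
  have hGre : ∫ t : ℝ, (F t ^ (p : ℂ)).re = 0 := by
    have h := Complex.reCLM.integral_comp_comm hintG
    simp only [Complex.reCLM_apply] at h
    rw [h, hzero, Complex.zero_re]
  have hmain : ∫ t : ℝ, ‖F t‖ ^ p ≤ A * ∫ t : ℝ, (F t).re ^ p := by
    calc ∫ t : ℝ, ‖F t‖ ^ p ≤ ∫ t : ℝ, (A * (F t).re ^ p + B * (F t ^ (p : ℂ)).re) :=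
          integral_mono hint ((hintre.const_mul A).add (hintG.re.const_mul B))
            fun t => hAB _ (hFre t (by simp))
      _ = _ := by
          have hB : Integrable fun t : ℝ => B * (F t ^ (p : ℂ)).re := hintG.re.const_mul B
          rw [integral_add (hintre.const_mul A) hB, integral_const_mul,
            integral_const_mul, hGre, mul_zero, add_zero]
  have hre : ∀ t : ℝ, ENNReal.ofReal (F t).re ≤ 16 * hlMaximal (fun s => ‖g s‖ₑ) t := fun t => by
    have hz' := him t (by simp)
    rw [hFdef, cauchyTransform_re hi hz']
    refine le_trans ?_ (lintegral_poisson_le_hlMaximal hg.enorm t hε)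
    refine (ENNReal.ofReal_le_ofReal (le_abs_self _)).trans ?_
    rw [← Real.norm_eq_abs, ofReal_norm]
    refine (enorm_integral_le_lintegral_enorm _).trans (le_of_eq (lintegral_congr fun s => ?_))
    simp only [Complex.add_im, Complex.ofReal_im, Complex.mul_im, Complex.ofReal_re, Complex.I_im,
      mul_one, Complex.I_re, mul_zero, add_zero, zero_add, Complex.add_re, Complex.mul_re,
      sub_self]
    rw [enorm_mul, ← ofReal_norm (ε / _), Real.norm_of_nonneg (by positivity)]
  calc ∫⁻ t : ℝ, ‖F t‖ₑ ^ p = ENNReal.ofReal (∫ t : ℝ, ‖F t‖ ^ p) := by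
        rw [ofReal_integral_eq_lintegral_ofReal hint (ae_of_all _ fun t => by positivity)]
        refine lintegral_congr fun t => ?_
        rw [← ofReal_norm, ENNReal.ofReal_rpow_of_nonneg (norm_nonneg _) hp0.le]
    _ ≤ ENNReal.ofReal (A * ∫ t : ℝ, (F t).re ^ p) := ENNReal.ofReal_le_ofReal hmain
    _ = ENNReal.ofReal A * ∫⁻ t : ℝ, ENNReal.ofReal (F t).re ^ p := by
        rw [ENNReal.ofReal_mul hA, ofReal_integral_eq_lintegral_ofReal hintre
          (ae_of_all _ fun t => Real.rpow_nonneg (hFre t (by simp)).le _)]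
        congr 1
        refine lintegral_congr fun t => ?_
        rw [ENNReal.ofReal_rpow_of_nonneg (hFre t (by simp)).le hp0.le]
    _ ≤ ENNReal.ofReal A * ∫⁻ t : ℝ, 16 ^ p * hlMaximal (fun s => ‖g s‖ₑ) t ^ p := by
        gcongr with t
        rw [← ENNReal.mul_rpow_of_nonneg _ _ hp0.le]
        gcongr
        exact hre t
    _ ≤ _ := by
        rw [lintegral_const_mul _ ((measurable_hlMaximal _).pow_const _), mul_assoc, mul_assoc]
        gcongr
        exact hM _ hg.enorm fun _ => enorm_ne_top

/-- The truncated Hilbert transform `∫_{|t| > ε} f(x - t) dt / t` (without the factor `1 / π`). -/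
noncomputable def hilbertTrunc (f : ℝ → ℂ) (ε x : ℝ) : ℂ :=
  truncatedIntegral (fun t => f (x - t) / (t : ℂ)) ε

/-- The maximal truncated Hilbert transform. The supremum runs over rational truncations, which
makes it measurable; `enorm_hilbertTrunc_le_hilbertMax` recovers all of them. -/
noncomputable def hilbertMax (f : ℝ → ℂ) (x : ℝ) : ℝ≥0∞ :=
  ⨆ (q : ℚ) (_ : 0 < q), ‖hilbertTrunc f q x‖ₑ

lemma measurableSet_lt_abs (ε : ℝ) : MeasurableSet {t : ℝ | ε < |t|} :=
  measurableSet_lt measurable_const (by fun_prop)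

lemma measurable_hilbertTrunc {f : ℝ → ℂ} (hf : Measurable f) (ε : ℝ) :
    Measurable (hilbertTrunc f ε) := by
  have : Measurable fun z : ℝ × ℝ => f (z.1 - z.2) / (z.2 : ℂ) := by fun_prop
  exact (this.stronglyMeasurable.integral_prod_right
    (ν := volume.restrict {t : ℝ | ε < |t|})).measurable

lemma measurable_hilbertMax {f : ℝ → ℂ} (hf : Measurable f) : Measurable (hilbertMax f) :=
  Measurable.iSup fun q => Measurable.iSup fun _ => (measurable_hilbertTrunc hf q).enorm

/-- Truncated and conjugate Poisson integrals differ by at most a maximal function. -/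
lemma enorm_hilbertTrunc_le_cauchyTransform {g : ℝ → ℝ} (hg : Measurable g) (hi : Integrable g)
    {η : ℝ} (hη : 0 < η) (x : ℝ) :
    ‖hilbertTrunc (fun s => (g s : ℂ)) η x‖ₑ ≤
      ‖cauchyTransform g (x + η * Complex.I)‖ₑ + 16 * hlMaximal (fun s => ‖g s‖ₑ) x := by
  have hgx : Integrable fun t => g (x - t) := hi.comp_sub_left x
  have him : (cauchyTransform g (x + η * Complex.I)).im =
      ∫ t, t / (t ^ 2 + η ^ 2) * g (x - t) := by
    rw [cauchyTransform_im hi (by simpa using hη),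
      ← integral_sub_left_eq_self (fun t => t / (t ^ 2 + η ^ 2) * g (x - t)) volume x]
    refine integral_congr_ae (ae_of_all _ fun s => ?_)
    simp
  have hre : hilbertTrunc (fun s => (g s : ℂ)) η x =
      ((∫ t, {t : ℝ | η < |t|}.indicator (fun t => t⁻¹) t * g (x - t) : ℝ) : ℂ) := by
    rw [← integral_complex_ofReal, hilbertTrunc, truncatedIntegral,
      ← integral_indicator (measurableSet_lt_abs η)]
    refine integral_congr_ae (ae_of_all _ fun t => ?_)
    by_cases ht : η < |t|
    · simp [indicator, ht]; ring
    · simp [indicator, ht]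
  have hi1 : Integrable fun t => {t : ℝ | η < |t|}.indicator (fun t => t⁻¹) t * g (x - t) := by
    refine hgx.bdd_mul (c := η⁻¹) (Measurable.aestronglyMeasurable
      (Measurable.indicator (by fun_prop) (measurableSet_lt_abs η))) (ae_of_all _ fun t => ?_)
    by_cases ht : η < |t|
    · simp only [indicator, mem_ofPred_eq, ht, if_true, norm_inv, Real.norm_eq_abs]
      gcongr
    · simp [indicator, ht, hη.le]
  have hi2 : Integrable fun t => t / (t ^ 2 + η ^ 2) * g (x - t) := by
    refine hgx.bdd_mul (c := η⁻¹) (Measurable.aestronglyMeasurable (by fun_prop))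
      (ae_of_all _ fun t => ?_)
    rw [Real.norm_eq_abs, abs_div, abs_of_pos (show 0 < t ^ 2 + η ^ 2 by positivity),
      div_le_iff₀ (by positivity), inv_mul_eq_div, le_div_iff₀ hη, ← sq_abs t]
    nlinarith [sq_nonneg (|t| - η), abs_nonneg t]
  have hdiff : ‖(∫ t, {t : ℝ | η < |t|}.indicator (fun t => t⁻¹) t * g (x - t)) -
      (∫ t, t / (t ^ 2 + η ^ 2) * g (x - t))‖ₑ ≤ 16 * hlMaximal (fun s => ‖g s‖ₑ) x := by
    rw [← integral_sub hi1 hi2]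
    refine (enorm_integral_le_lintegral_enorm _).trans ?_
    refine le_trans ?_ (lintegral_poisson_le_hlMaximal hg.enorm x hη)
    rw [← lintegral_sub_left_eq_self (fun s => ENNReal.ofReal (η / ((x - s) ^ 2 + η ^ 2)) *
      ‖g s‖ₑ) x]
    refine lintegral_mono fun t => ?_
    rw [← sub_mul, enorm_mul, sub_sub_cancel]
    gcongr
    rw [← ofReal_norm]
    refine ENNReal.ofReal_le_ofReal ?_
    have hpos : 0 < t ^ 2 + η ^ 2 := by positivity
    by_cases ht : η < |t|
    · have ht0 : t ≠ 0 := by rintro rfl; simp at ht; linarith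
      have ht0' : 0 < |t| := abs_pos.2 ht0
      simp only [indicator, mem_ofPred_eq, ht, if_true]
      have : t⁻¹ - t / (t ^ 2 + η ^ 2) = η ^ 2 / (t * (t ^ 2 + η ^ 2)) := by
        field_simp; ring
      rw [this, Real.norm_eq_abs, abs_div, abs_mul, abs_of_pos hpos, abs_of_pos (by positivity),
        div_le_div_iff₀ (by positivity) hpos]
      have : η ^ 2 ≤ η * |t| := by nlinarith
      nlinarith
    · simp only [indicator, mem_ofPred_eq, ht, if_false, zero_sub, norm_neg]
      rw [Real.norm_eq_abs, abs_div, abs_of_pos hpos]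
      gcongr
      exact not_lt.1 ht
  calc ‖hilbertTrunc (fun s => (g s : ℂ)) η x‖ₑ
      = ‖∫ t, {t : ℝ | η < |t|}.indicator (fun t => t⁻¹) t * g (x - t)‖ₑ := by
        rw [hre, ← ofReal_norm, Complex.norm_real, ofReal_norm]
    _ ≤ ‖∫ t, t / (t ^ 2 + η ^ 2) * g (x - t)‖ₑ +
        ‖(∫ t, {t : ℝ | η < |t|}.indicator (fun t => t⁻¹) t * g (x - t)) -
          (∫ t, t / (t ^ 2 + η ^ 2) * g (x - t))‖ₑ := by
        refine le_trans (le_of_eq ?_) (enorm_add_le _ _)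
        rw [add_sub_cancel]
    _ ≤ _ := by
        gcongr
        rw [← him, ← ofReal_norm, ← ofReal_norm]
        exact ENNReal.ofReal_le_ofReal (Complex.abs_im_le_norm _)

lemma exists_lintegral_hilbertMax_rpow_le_of_bounded {p : ℝ} (hp : 1 < p)
    (hcos : Real.cos (p * (Real.pi / 2)) ≠ 0) :
    ∃ K : ℝ≥0∞, K ≠ ∞ ∧ ∀ (g : ℝ → ℝ) (b N : ℝ), Measurable g → (∀ s, 0 ≤ g s) →
      (∀ s, g s ≤ b) → 0 ≤ N → (∀ s, N < |s| → g s = 0) →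
      ∫⁻ x : ℝ, hilbertMax (fun s => (g s : ℂ)) x ^ p ≤ K * ∫⁻ t, ‖g t‖ₑ ^ p := by
  have hp0 : 0 < p := by linarith
  obtain ⟨K, hK, hKF⟩ := exists_lintegral_cauchyTransform_rpow_le hp hcos
  obtain ⟨C, hC, hM⟩ := exists_lintegral_hlMaximal_rpow_le hp
  refine ⟨2 ^ (p - 1) * (16 ^ p * (C * K) + 16 ^ p * C), by finiteness, ?_⟩
  intro g b N hg h0 hb hN0 hN
  have hi := integrable_of_bounded_of_support hg h0 hb hN
  set δ : ℕ → ℝ := fun n => 1 / ((n : ℝ) + 1) with hδdef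
  have hδ : ∀ n, 0 < δ n := fun n => by positivity
  set F : ℕ → ℂ → ℂ := fun n z => cauchyTransform g (z + δ n * Complex.I) with hFdef
  have him : ∀ n, ∀ z : ℂ, 0 ≤ z.im → 0 < (z + δ n * Complex.I).im := fun n z hz => by
    have := hδ n
    simp; linarith
  have hFd : ∀ n, ∀ z : ℂ, 0 ≤ z.im → DifferentiableAt ℂ (F n) z := fun n z hz =>
    DifferentiableAt.comp (g := cauchyTransform g) (f := fun z => z + δ n * Complex.I) z
      (differentiableAt_cauchyTransform hg hi (him n z hz)) (by fun_prop)
  have hFm : ∀ n, Measurable fun t : ℝ => ‖F n t‖ₑ := fun n => by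
    refine Measurable.enorm (Continuous.measurable ?_)
    exact continuous_iff_continuousAt.2 fun t =>
      ContinuousAt.comp (f := fun t : ℝ => (t : ℂ)) (hFd n t (by simp)).continuousAt
        Complex.continuous_ofReal.continuousAt
  set Φ : ℕ → ℝ → ℝ≥0∞ := fun n x =>
    16 * hlMaximal (fun t : ℝ => ‖F n t‖ₑ) x + 16 * hlMaximal (fun s => ‖g s‖ₑ) x with hΦ
  have hΦm : ∀ n, Measurable (Φ n) := fun n =>
    ((measurable_hlMaximal _).const_mul _).add ((measurable_hlMaximal _).const_mul _)
  -- the truncation at height `η > δ n` is dominated by `Φ n`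
  have hle : ∀ n x, ∀ η : ℝ, δ n < η → ‖hilbertTrunc (fun s => (g s : ℂ)) η x‖ₑ ≤ Φ n x := by
    intro n x η hη
    refine (enorm_hilbertTrunc_le_cauchyTransform hg hi ((hδ n).trans hη) x).trans ?_
    refine add_le_add_left ?_ _
    obtain ⟨D, hD0, hD⟩ := exists_norm_cauchyTransform_le hg h0 hb hN0 hN (hδ n)
    have := enorm_le_hlMaximal_of_bounded_analytic (F := F n) (C := D) (hFd n)
      (fun z hz => (hD z hz).trans (div_le_self hD0 (by linarith [norm_nonneg z]))) x
      (sub_pos.2 hη)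
    have e : F n (x + ((η - δ n : ℝ) : ℂ) * Complex.I) =
        cauchyTransform g (x + η * Complex.I) := by
      simp only [hFdef]
      congr 1
      push_cast
      ring
    rwa [e] at this
  have hmax : ∀ x, hilbertMax (fun s => (g s : ℂ)) x ≤ liminf (fun n => Φ n x) atTop := by
    intro x
    refine iSup₂_le fun q hq => le_liminf_of_le (by isBoundedDefault) ?_
    have hlim : Tendsto δ atTop (𝓝 0) := tendsto_one_div_add_atTop_nhds_zero_nat
    filter_upwards [hlim.eventually (gt_mem_nhds (show (0 : ℝ) < q by exact_mod_cast hq))] with n hn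
    exact hle n x q hn
  calc ∫⁻ x : ℝ, hilbertMax (fun s => (g s : ℂ)) x ^ p
      ≤ ∫⁻ x, liminf (fun n => Φ n x ^ p) atTop := by
        refine lintegral_mono fun x => ?_
        refine (ENNReal.rpow_le_rpow (hmax x) hp0.le).trans (le_of_eq ?_)
        exact (ENNReal.monotone_rpow_of_nonneg hp0.le).map_liminf_of_continuousAt _
          (ENNReal.continuous_rpow_const.continuousAt)
    _ ≤ liminf (fun n => ∫⁻ x, Φ n x ^ p) atTop := lintegral_liminf_le fun n => (hΦm n).pow_const _
    _ ≤ _ := by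
        refine liminf_le_of_le (by isBoundedDefault) fun c hc => ?_
        obtain ⟨n, hn⟩ := hc.exists
        refine hn.trans ?_
        calc ∫⁻ x, Φ n x ^ p ≤ ∫⁻ x, 2 ^ (p - 1) *
              (16 ^ p * hlMaximal (fun t : ℝ => ‖F n t‖ₑ) x ^ p +
                16 ^ p * hlMaximal (fun s => ‖g s‖ₑ) x ^ p) := by
              refine lintegral_mono fun x => ?_
              rw [← ENNReal.mul_rpow_of_nonneg _ _ hp0.le, ← ENNReal.mul_rpow_of_nonneg _ _ hp0.le]
              exact ENNReal.rpow_add_le_mul_rpow_add_rpow _ _ hp.le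
          _ = 2 ^ (p - 1) * (16 ^ p * ∫⁻ x, hlMaximal (fun t : ℝ => ‖F n t‖ₑ) x ^ p) +
              2 ^ (p - 1) * (16 ^ p * ∫⁻ x, hlMaximal (fun s => ‖g s‖ₑ) x ^ p) := by
              have m1 : Measurable fun x => hlMaximal (fun t : ℝ => ‖F n t‖ₑ) x ^ p :=
                (measurable_hlMaximal _).pow_const _
              have m2 : Measurable fun x => hlMaximal (fun s => ‖g s‖ₑ) x ^ p :=
                (measurable_hlMaximal _).pow_const _
              have m3 : Measurable fun x => 16 ^ p * hlMaximal (fun t : ℝ => ‖F n t‖ₑ) x ^ p +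
                16 ^ p * hlMaximal (fun s => ‖g s‖ₑ) x ^ p := (m1.const_mul _).add (m2.const_mul _)
              rw [lintegral_const_mul _ m3, lintegral_add_left (m1.const_mul _), lintegral_const_mul _ m1,
                lintegral_const_mul _ m2, mul_add]
          _ ≤ 2 ^ (p - 1) * (16 ^ p * (C * (K * ∫⁻ t, ‖g t‖ₑ ^ p))) +
              2 ^ (p - 1) * (16 ^ p * (C * ∫⁻ t, ‖g t‖ₑ ^ p)) := by
              gcongr
              · refine (hM _ (hFm n) fun _ => enorm_ne_top).trans ?_
                gcongr
                exact hKF g b N hg h0 hb hN0 hN _ (hδ n)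
              · exact hM _ hg.enorm fun _ => enorm_ne_top
          _ = _ := by ring

/-! ### The maximal Hilbert transform on `L^p` -/

lemma integrable_norm_rpow {f : ℝ → ℂ} (hf : Measurable f) {p : ℝ} (hp : 0 < p)
    (hfp : ∫⁻ t, ‖f t‖ₑ ^ p ≠ ∞) : Integrable fun t => ‖f t‖ ^ p := by
  refine ⟨Measurable.aestronglyMeasurable (by fun_prop), ?_⟩
  rw [hasFiniteIntegral_iff_enorm]
  refine lt_of_le_of_lt (le_of_eq (lintegral_congr fun t => ?_)) hfp.lt_top
  rw [← ofReal_norm, ← ofReal_norm, Real.norm_of_nonneg (by positivity),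
    ENNReal.ofReal_rpow_of_nonneg (norm_nonneg _) hp.le]

/-- By Young's inequality, `f (x - t) / t` is integrable away from `t = 0` for `f ∈ L^p`. -/
lemma integrableOn_div_lt_abs {f : ℝ → ℂ} (hf : Measurable f) {p : ℝ} (hp : 1 < p)
    (hfp : ∫⁻ t, ‖f t‖ₑ ^ p ≠ ∞) (x : ℝ) {ε : ℝ} (hε : 0 < ε) :
    IntegrableOn (fun t => f (x - t) / (t : ℂ)) {t : ℝ | ε < |t|} := by
  have hpq := Real.HolderConjugate.conjExponent hp
  set q := p.conjExponent
  have h1 : Integrable fun t => ‖f (x - t)‖ ^ p / p :=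
    ((integrable_norm_rpow hf (by linarith) hfp).comp_sub_left x).div_const p
  have h2 : Integrable fun t : ℝ => (1 / ε + 1) ^ q * (1 + ‖t‖) ^ (-q) / q :=
    ((integrable_one_add_norm (by simpa using hpq.symm.lt)).const_mul _).div_const q
  refine Integrable.mono' (h1.add h2).integrableOn
    (Measurable.aestronglyMeasurable (by fun_prop)) ?_
  filter_upwards [ae_restrict_mem (measurableSet_lt_abs ε)] with t (ht : ε < |t|)
  have ht0 : 0 < |t| := hε.trans ht
  rw [norm_div, Complex.norm_real, Real.norm_eq_abs, div_eq_mul_inv]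
  refine (Real.young_inequality_of_nonneg (norm_nonneg _) (inv_nonneg.2 ht0.le) hpq).trans ?_
  simp only [Pi.add_apply]
  gcongr
  · exact hpq.symm.nonneg
  · rw [Real.norm_eq_abs, Real.rpow_neg (by positivity), ← Real.inv_rpow (by positivity),
      ← Real.mul_rpow (by positivity) (by positivity)]
    refine Real.rpow_le_rpow (by positivity) ?_ hpq.symm.nonneg
    rw [← div_eq_mul_inv, inv_eq_one_div, div_le_div_iff₀ ht0 (by positivity)]
    have : 1 ≤ 1 / ε * |t| := by rw [one_div_mul_eq_div, le_div_iff₀ hε]; linarith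
    linarith

lemma truncatedIntegral_eq_integral_indicator (F : ℝ → ℂ) (ε : ℝ) :
    truncatedIntegral F ε = ∫ t, {t : ℝ | ε < |t|}.indicator F t :=
  (integral_indicator (measurableSet_lt_abs ε)).symm

lemma enorm_hilbertTrunc_le_hilbertMax {f : ℝ → ℂ} {x : ℝ}
    (hint : ∀ ε : ℝ, 0 < ε → IntegrableOn (fun t => f (x - t) / (t : ℂ)) {t : ℝ | ε < |t|})
    {ε : ℝ} (hε : 0 < ε) : ‖hilbertTrunc f ε x‖ₑ ≤ hilbertMax f x := by
  -- the truncated integrals are right continuous in `ε`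
  have hcont : Tendsto (fun ε' => hilbertTrunc f ε' x) (𝓝[>] ε) (𝓝 (hilbertTrunc f ε x)) := by
    simp only [hilbertTrunc, truncatedIntegral_eq_integral_indicator]
    refine tendsto_integral_filter_of_dominated_convergence
      ({t : ℝ | ε < |t|}.indicator fun t => ‖f (x - t) / (t : ℂ)‖) ?_ ?_ ?_ ?_
    · filter_upwards [self_mem_nhdsWithin] with ε' (h' : ε < ε')
      exact ((hint ε' (hε.trans h')).integrable_indicator
        (measurableSet_lt_abs ε')).aestronglyMeasurable
    · filter_upwards [self_mem_nhdsWithin] with ε' (h' : ε < ε')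
      refine ae_of_all _ fun t => ?_
      rw [norm_indicator_eq_indicator_norm]
      exact indicator_le_indicator_of_subset (fun t (ht : ε' < |t|) => h'.trans ht)
        (fun _ => norm_nonneg _) t
    · exact IntegrableOn.integrable_indicator (hint ε hε).norm (measurableSet_lt_abs ε)
    · refine ae_of_all _ fun t => tendsto_const_nhds.congr' ?_
      by_cases ht : ε < |t|
      · filter_upwards [mem_nhdsWithin_of_mem_nhds (gt_mem_nhds ht)] with ε' h'
        simp only [indicator, mem_ofPred_eq, ht, h', if_true]
      · filter_upwards [self_mem_nhdsWithin] with ε' (h' : ε < ε')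
        have : ¬ ε' < |t| := fun h => ht (h'.trans h)
        simp only [indicator, mem_ofPred_eq, ht, this, if_false]
  by_contra! hcon
  have hev := (hcont.enorm).eventually (lt_mem_nhds hcon)
  obtain ⟨ε', h1, h2⟩ := (mem_nhdsGT_iff_exists_Ioo_subset.1 hev)
  obtain ⟨q, hq1, hq2⟩ := exists_rat_btwn (mem_Ioi.1 h1)
  have hq0 : (0 : ℚ) < q := by exact_mod_cast hε.trans hq1
  have h3 : hilbertMax f x < ‖hilbertTrunc f q x‖ₑ := h2 ⟨hq1, hq2⟩
  exact absurd (le_iSup₂_of_le (f := fun (q : ℚ) (_ : 0 < q) => ‖hilbertTrunc f q x‖ₑ) q hq0 le_rfl)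
    (not_le.2 h3)

lemma hilbertTrunc_add {f g : ℝ → ℂ} {x ε : ℝ}
    (hf : IntegrableOn (fun t => f (x - t) / (t : ℂ)) {t : ℝ | ε < |t|})
    (hg : IntegrableOn (fun t => g (x - t) / (t : ℂ)) {t : ℝ | ε < |t|}) :
    hilbertTrunc (fun s => f s + g s) ε x = hilbertTrunc f ε x + hilbertTrunc g ε x := by
  simp only [hilbertTrunc, truncatedIntegral, add_div]
  exact integral_add hf hg

lemma hilbertTrunc_const_mul (c : ℂ) (f : ℝ → ℂ) (ε x : ℝ) :
    hilbertTrunc (fun s => c * f s) ε x = c * hilbertTrunc f ε x := by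
  simp only [hilbertTrunc, truncatedIntegral, mul_div_assoc]
  exact integral_const_mul _ _

lemma hilbertMax_add_le {f g : ℝ → ℂ} (hf : Measurable f) (hg : Measurable g) {p : ℝ} (hp : 1 < p)
    (hfp : ∫⁻ t, ‖f t‖ₑ ^ p ≠ ∞) (hgp : ∫⁻ t, ‖g t‖ₑ ^ p ≠ ∞) (x : ℝ) :
    hilbertMax (fun s => f s + g s) x ≤ hilbertMax f x + hilbertMax g x := by
  refine iSup₂_le fun q hq => ?_
  have hq' : (0 : ℝ) < q := by exact_mod_cast hq
  rw [hilbertTrunc_add (integrableOn_div_lt_abs hf hp hfp x hq')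
    (integrableOn_div_lt_abs hg hp hgp x hq')]
  refine (enorm_add_le _ _).trans (add_le_add ?_ ?_)
  · exact le_iSup₂_of_le (f := fun (q : ℚ) (_ : 0 < q) => ‖hilbertTrunc f q x‖ₑ) q hq le_rfl
  · exact le_iSup₂_of_le (f := fun (q : ℚ) (_ : 0 < q) => ‖hilbertTrunc g q x‖ₑ) q hq le_rfl

lemma hilbertMax_const_mul (c : ℂ) (f : ℝ → ℂ) (x : ℝ) :
    hilbertMax (fun s => c * f s) x = ‖c‖ₑ * hilbertMax f x := by
  simp only [hilbertMax, hilbertTrunc_const_mul, enorm_mul, ENNReal.mul_iSup]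

lemma exists_lintegral_hilbertMax_rpow_le_of_nonneg {p : ℝ} (hp : 1 < p)
    (hcos : Real.cos (p * (Real.pi / 2)) ≠ 0) :
    ∃ K : ℝ≥0∞, K ≠ ∞ ∧ ∀ g : ℝ → ℝ, Measurable g → (∀ s, 0 ≤ g s) →
      ∫⁻ t, ‖g t‖ₑ ^ p ≠ ∞ →
      ∫⁻ x : ℝ, hilbertMax (fun s => (g s : ℂ)) x ^ p ≤ K * ∫⁻ t, ‖g t‖ₑ ^ p := by
  have hp0 : 0 < p := by linarith
  obtain ⟨K, hK, hKg⟩ := exists_lintegral_hilbertMax_rpow_le_of_bounded hp hcos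
  refine ⟨K, hK, fun g hg h0 hgp => ?_⟩
  have hgc : Measurable fun s => (g s : ℂ) := by fun_prop
  have hgcp : ∫⁻ t, ‖(g t : ℂ)‖ₑ ^ p ≠ ∞ := by
    simpa only [← ofReal_norm, Complex.norm_real] using hgp
  set G : ℕ → ℝ → ℝ := fun n => (Icc (-n : ℝ) n).indicator fun s => min (g s) n with hG
  have hGm : ∀ n, Measurable (G n) := fun n =>
    (hg.min measurable_const).indicator measurableSet_Icc
  have hG0 : ∀ n s, 0 ≤ G n s := fun n s =>
    indicator_nonneg (fun s _ => le_min (h0 s) (Nat.cast_nonneg n)) s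
  have hGg : ∀ n s, G n s ≤ g s := fun n s =>
    indicator_le' (fun s _ => min_le_left _ _) (fun s _ => h0 s) s
  have hGlim : ∀ s, ∀ᶠ n : ℕ in atTop, G n s = g s := fun s => by
    filter_upwards [eventually_ge_atTop ⌈max |s| (g s)⌉₊] with n hn
    have h1 : max |s| (g s) ≤ n := Nat.ceil_le.1 hn
    have h2 : s ∈ Icc (-n : ℝ) n := abs_le.1 ((le_max_left _ _).trans h1)
    simp only [hG, indicator_of_mem h2]
    exact min_eq_left ((le_max_right _ _).trans h1)
  have hbound : ∀ n, ∫⁻ x : ℝ, hilbertMax (fun s => (G n s : ℂ)) x ^ p ≤ K * ∫⁻ t, ‖g t‖ₑ ^ p := by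
    intro n
    refine (hKg (G n) n n (hGm n) (hG0 n) (fun s => ?_) (Nat.cast_nonneg n) (fun s hs => ?_)).trans ?_
    · exact indicator_le' (fun s _ => min_le_right _ _) (fun s _ => Nat.cast_nonneg n) s
    · refine indicator_of_notMem (fun h => ?_) _
      exact not_le.2 hs (abs_le.2 h)
    · gcongr with t
      rw [← ofReal_norm, ← ofReal_norm]
      refine ENNReal.ofReal_le_ofReal ?_
      rw [Real.norm_of_nonneg (hG0 n t), Real.norm_of_nonneg (h0 t)]
      exact hGg n t
  have hmax : ∀ x, hilbertMax (fun s => (g s : ℂ)) x ≤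
      liminf (fun n => hilbertMax (fun s => (G n s : ℂ)) x) atTop := by
    intro x
    refine iSup₂_le fun q hq => ?_
    have hq' : (0 : ℝ) < q := by exact_mod_cast hq
    have hint := integrableOn_div_lt_abs hgc hp hgcp x hq'
    have hlim : Tendsto (fun n => hilbertTrunc (fun s => (G n s : ℂ)) q x) atTop
        (𝓝 (hilbertTrunc (fun s => (g s : ℂ)) q x)) := by
      refine tendsto_integral_of_dominated_convergence
        (fun t => ‖(g (x - t) : ℂ) / (t : ℂ)‖) (fun n => ?_) hint.norm (fun n => ?_) ?_
      · have := hGm n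
        exact Measurable.aestronglyMeasurable (by fun_prop)
      · refine ae_of_all _ fun t => ?_
        rw [norm_div, norm_div]
        gcongr
        rw [Complex.norm_real, Complex.norm_real, Real.norm_of_nonneg (hG0 n _),
          Real.norm_of_nonneg (h0 _)]
        exact hGg n _
      · refine ae_of_all _ fun t => tendsto_const_nhds.congr' ?_
        filter_upwards [hGlim (x - t)] with n hn
        rw [hn]
    rw [← hlim.enorm.liminf_eq]
    refine liminf_le_liminf (Eventually.of_forall fun n => ?_)
    exact le_iSup₂_of_le (f := fun (q : ℚ) (_ : 0 < q) =>
      ‖hilbertTrunc (fun s => (G n s : ℂ)) q x‖ₑ) q hq le_rfl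
  calc ∫⁻ x : ℝ, hilbertMax (fun s => (g s : ℂ)) x ^ p
      ≤ ∫⁻ x, liminf (fun n => hilbertMax (fun s => (G n s : ℂ)) x ^ p) atTop := by
        refine lintegral_mono fun x => ?_
        refine (ENNReal.rpow_le_rpow (hmax x) hp0.le).trans (le_of_eq ?_)
        exact (ENNReal.monotone_rpow_of_nonneg hp0.le).map_liminf_of_continuousAt _
          (ENNReal.continuous_rpow_const.continuousAt)
    _ ≤ liminf (fun n => ∫⁻ x, hilbertMax (fun s => (G n s : ℂ)) x ^ p) atTop :=
        lintegral_liminf_le fun n => (measurable_hilbertMax (by have := hGm n; fun_prop)).pow_const _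
    _ ≤ _ := by
        refine liminf_le_of_le (by isBoundedDefault) fun c hc => ?_
        obtain ⟨n, hn⟩ := hc.exists
        exact hn.trans (hbound n)

lemma exists_lintegral_hilbertMax_rpow_le_of_cos_ne_zero {p : ℝ} (hp : 1 < p)
    (hcos : Real.cos (p * (Real.pi / 2)) ≠ 0) :
    ∃ K : ℝ≥0∞, K ≠ ∞ ∧ ∀ f : ℝ → ℂ, Measurable f →
      ∫⁻ x : ℝ, hilbertMax f x ^ p ≤ K * ∫⁻ t, ‖f t‖ₑ ^ p := by
  have hp0 : 0 < p := by linarith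
  obtain ⟨K, hK, hKg⟩ := exists_lintegral_hilbertMax_rpow_le_of_nonneg hp hcos
  have h2 : (2 : ℝ≥0∞) ^ (p - 1) ≠ ∞ := by finiteness
  -- a real function is a difference of two nonnegative ones
  have hreal : ∀ g : ℝ → ℝ, Measurable g → ∫⁻ t, ‖g t‖ₑ ^ p ≠ ∞ →
      ∫⁻ x : ℝ, hilbertMax (fun s => (g s : ℂ)) x ^ p ≤
        2 ^ (p - 1) * (2 * K) * ∫⁻ t, ‖g t‖ₑ ^ p := by
    intro g hg hgp
    have hle : ∀ h : ℝ → ℝ, (∀ s, |h s| ≤ |g s|) → ∫⁻ t, ‖h t‖ₑ ^ p ≤ ∫⁻ t, ‖g t‖ₑ ^ p := by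
      intro h hh
      gcongr with t
      rw [← ofReal_norm, ← ofReal_norm]
      exact ENNReal.ofReal_le_ofReal (hh t)
    have hle1 := hle (fun s => max (g s) 0) fun s => by
      rcases le_total (g s) 0 with h | h <;> simp [h]
    have hle2 := hle (fun s => max (-g s) 0) fun s => by
      rcases le_total (g s) 0 with h | h <;> simp [h]
    have hfin1 := ne_top_of_le_ne_top hgp hle1
    have hfin2 := ne_top_of_le_ne_top hgp hle2
    have m1 : Measurable fun s => ((max (g s) 0 : ℝ) : ℂ) := by fun_prop
    have m2 : Measurable fun s => ((max (-g s) 0 : ℝ) : ℂ) := by fun_prop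
    have hsplit : ∀ x, hilbertMax (fun s => (g s : ℂ)) x ≤
        hilbertMax (fun s => ((max (g s) 0 : ℝ) : ℂ)) x +
          hilbertMax (fun s => ((max (-g s) 0 : ℝ) : ℂ)) x := by
      intro x
      have e : (fun s => (g s : ℂ)) =
          fun s => ((max (g s) 0 : ℝ) : ℂ) + (-1) * ((max (-g s) 0 : ℝ) : ℂ) := by
        funext s
        rcases le_total (g s) 0 with h | h <;> simp [h]
      rw [e]
      refine (hilbertMax_add_le m1 (m2.const_mul _) hp ?_ ?_ x).trans ?_
      · simpa only [← ofReal_norm, Complex.norm_real] using hfin1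
      · simpa only [← ofReal_norm, norm_mul, norm_neg, norm_one, one_mul, Complex.norm_real]
          using hfin2
      · rw [hilbertMax_const_mul, enorm_neg, enorm_one, one_mul]
    calc _ ≤ ∫⁻ x, 2 ^ (p - 1) * (hilbertMax (fun s => ((max (g s) 0 : ℝ) : ℂ)) x ^ p +
          hilbertMax (fun s => ((max (-g s) 0 : ℝ) : ℂ)) x ^ p) := by
          refine lintegral_mono fun x => (ENNReal.rpow_le_rpow (hsplit x) hp0.le).trans ?_
          exact ENNReal.rpow_add_le_mul_rpow_add_rpow _ _ hp.le
      _ = 2 ^ (p - 1) * ((∫⁻ x, hilbertMax (fun s => ((max (g s) 0 : ℝ) : ℂ)) x ^ p) +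
          ∫⁻ x, hilbertMax (fun s => ((max (-g s) 0 : ℝ) : ℂ)) x ^ p) := by
          rw [lintegral_const_mul' _ _ h2,
            lintegral_add_left ((measurable_hilbertMax m1).pow_const _)]
      _ ≤ 2 ^ (p - 1) * (K * (∫⁻ t, ‖g t‖ₑ ^ p) + K * ∫⁻ t, ‖g t‖ₑ ^ p) := by
          gcongr
          · exact (hKg _ (by fun_prop) (fun s => le_max_right _ _) hfin1).trans
              (mul_le_mul_right hle1 _)
          · exact (hKg _ (by fun_prop) (fun s => le_max_right _ _) hfin2).trans
              (mul_le_mul_right hle2 _)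
      _ = _ := by ring
  refine ⟨2 ^ (p - 1) * (2 * (2 ^ (p - 1) * (2 * K))) + 1, by finiteness, fun f hf => ?_⟩
  rcases eq_or_ne (∫⁻ t, ‖f t‖ₑ ^ p) ∞ with hfp | hfp
  · rw [hfp, ENNReal.mul_top (by simp)]
    exact le_top
  have hle1 : ∫⁻ t, ‖(f t).re‖ₑ ^ p ≤ ∫⁻ t, ‖f t‖ₑ ^ p := by
    gcongr with t
    rw [← ofReal_norm, ← ofReal_norm]
    exact ENNReal.ofReal_le_ofReal (Complex.abs_re_le_norm _)
  have hle2 : ∫⁻ t, ‖(f t).im‖ₑ ^ p ≤ ∫⁻ t, ‖f t‖ₑ ^ p := by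
    gcongr with t
    rw [← ofReal_norm, ← ofReal_norm]
    exact ENNReal.ofReal_le_ofReal (Complex.abs_im_le_norm _)
  have hfin1 := ne_top_of_le_ne_top hfp hle1
  have hfin2 := ne_top_of_le_ne_top hfp hle2
  have m1 : Measurable fun s => (((f s).re : ℝ) : ℂ) := by fun_prop
  have m2 : Measurable fun s => (((f s).im : ℝ) : ℂ) := by fun_prop
  have hsplit : ∀ x, hilbertMax f x ≤
      hilbertMax (fun s => ((f s).re : ℂ)) x + hilbertMax (fun s => ((f s).im : ℂ)) x := by
    intro x
    have e : f = fun s => ((f s).re : ℂ) + Complex.I * ((f s).im : ℂ) := by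
      funext s
      rw [mul_comm, Complex.re_add_im]
    conv_lhs => rw [e]
    refine (hilbertMax_add_le m1 (m2.const_mul _) hp ?_ ?_ x).trans ?_
    · simpa only [← ofReal_norm, Complex.norm_real] using hfin1
    · simpa only [← ofReal_norm, norm_mul, Complex.norm_I, one_mul, Complex.norm_real]
        using hfin2
    · rw [hilbertMax_const_mul, ← ofReal_norm, Complex.norm_I, ENNReal.ofReal_one, one_mul]
  calc _ ≤ ∫⁻ x, 2 ^ (p - 1) * (hilbertMax (fun s => ((f s).re : ℂ)) x ^ p +
        hilbertMax (fun s => ((f s).im : ℂ)) x ^ p) := by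
        refine lintegral_mono fun x => (ENNReal.rpow_le_rpow (hsplit x) hp0.le).trans ?_
        exact ENNReal.rpow_add_le_mul_rpow_add_rpow _ _ hp.le
    _ = 2 ^ (p - 1) * ((∫⁻ x, hilbertMax (fun s => ((f s).re : ℂ)) x ^ p) +
        ∫⁻ x, hilbertMax (fun s => ((f s).im : ℂ)) x ^ p) := by
        rw [lintegral_const_mul' _ _ h2,
          lintegral_add_left ((measurable_hilbertMax m1).pow_const _)]
    _ ≤ 2 ^ (p - 1) * (2 ^ (p - 1) * (2 * K) * (∫⁻ t, ‖f t‖ₑ ^ p) +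
        2 ^ (p - 1) * (2 * K) * ∫⁻ t, ‖f t‖ₑ ^ p) := by
        gcongr
        · exact (hreal _ (by fun_prop) hfin1).trans (mul_le_mul_right hle1 _)
        · exact (hreal _ (by fun_prop) hfin2).trans (mul_le_mul_right hle2 _)
    _ = 2 ^ (p - 1) * (2 * (2 ^ (p - 1) * (2 * K))) * ∫⁻ t, ‖f t‖ₑ ^ p := by ring
    _ ≤ _ := by gcongr; exact le_self_add

/-- Chebyshev's inequality in the form fed to `lintegral_rpow_le_of_distribution`. -/
lemma volume_lt_le_of_lintegral_rpow_le {F : ℝ → ℝ≥0∞} (hF : Measurable F) {q l : ℝ} (hq : 0 < q)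
    (hl : 0 < l) {I : ℝ≥0∞} (h : ∫⁻ x, F x ^ q ≤ I) :
    volume {x | ENNReal.ofReal l < F x} ≤ ENNReal.ofReal (l ^ (-q)) * I := by
  have h1 := mul_meas_ge_le_lintegral (μ := volume) (hF.pow_const q) (ENNReal.ofReal l ^ q)
  have h3 : ENNReal.ofReal (l ^ (-q)) * ENNReal.ofReal l ^ q = 1 := by
    rw [ENNReal.ofReal_rpow_of_pos hl, ← ENNReal.ofReal_mul (by positivity), ← Real.rpow_add hl]
    simp
  calc volume {x | ENNReal.ofReal l < F x}
      ≤ volume {x | ENNReal.ofReal l ^ q ≤ F x ^ q} :=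
        measure_mono fun x (hx : _ < _) => ENNReal.rpow_le_rpow hx.le hq.le
    _ = ENNReal.ofReal (l ^ (-q)) * (ENNReal.ofReal l ^ q *
          volume {x | ENNReal.ofReal l ^ q ≤ F x ^ q}) := by rw [← mul_assoc, h3, one_mul]
    _ ≤ _ := by gcongr; exact h1.trans h

lemma lintegral_enorm_indicator_rpow {f : ℝ → ℂ} {S : Set ℝ} (hS : MeasurableSet S) {q : ℝ}
    (hq : 0 < q) : ∫⁻ t, ‖S.indicator f t‖ₑ ^ q = ∫⁻ t in S, ‖f t‖ₑ ^ q := by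
  rw [← lintegral_indicator hS]
  refine lintegral_congr fun t => ?_
  by_cases ht : t ∈ S <;> simp [ht, hq]

/-- Real interpolation for an operator `T` that is subadditive along decompositions
`f = f 1_S + f 1_{Sᶜ}`, of strong type `(q₀, q₀)` and `(q₁, q₁)`, with a free parameter `A`
balancing the constants. -/
lemma lintegral_rpow_le_of_interpolation {T : (ℝ → ℂ) → ℝ → ℝ≥0∞} {q₀ p q₁ A : ℝ} (hq₀ : 0 < q₀)
    (h₀ : q₀ < p) (h₁ : p < q₁) (hA : 0 < A) {N₀ N₁ : ℝ≥0∞}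
    (hTm : ∀ f, Measurable f → Measurable (T f))
    (hT₀ : ∀ f, Measurable f → ∫⁻ x, T f x ^ q₀ ≤ N₀ * ∫⁻ t, ‖f t‖ₑ ^ q₀)
    (hT₁ : ∀ f, Measurable f → ∫⁻ x, T f x ^ q₁ ≤ N₁ * ∫⁻ t, ‖f t‖ₑ ^ q₁)
    {f : ℝ → ℂ} (hf : Measurable f)
    (hadd : ∀ S : Set ℝ, MeasurableSet S → ∀ x,
      T f x ≤ T (S.indicator f) x + T (Sᶜ.indicator f) x) :
    ∫⁻ x, T f x ^ p ≤ ENNReal.ofReal (p * 2 ^ p) *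
      (N₀ * ENNReal.ofReal (A ^ (q₀ - p) / (p - q₀)) +
        N₁ * ENNReal.ofReal (A ^ (q₁ - p) / (q₁ - p))) * ∫⁻ t, ‖f t‖ₑ ^ p := by
  refine lintegral_rpow_le_of_distribution hf.enorm (hTm f hf) (fun _ => enorm_ne_top) hq₀ h₀ h₁ hA
    fun l hl => ?_
  set S := {x | ENNReal.ofReal (A * l) < ‖f x‖ₑ} with hSdef
  have hS : MeasurableSet S := measurableSet_lt measurable_const hf.enorm
  have hSc : {x | ‖f x‖ₑ ≤ ENNReal.ofReal (A * l)} = Sᶜ := by ext x; simp [S]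
  have hsub : {x | ENNReal.ofReal (2 * l) < T f x} ⊆
      {x | ENNReal.ofReal l < T (S.indicator f) x} ∪
        {x | ENNReal.ofReal l < T (Sᶜ.indicator f) x} := by
    intro x hx
    by_contra hcon
    simp only [mem_union, mem_ofPred_eq, not_or, not_lt] at hcon hx
    have := hx.trans_le ((hadd S hS x).trans (add_le_add hcon.1 hcon.2))
    rw [← ENNReal.ofReal_add hl.le hl.le, ← two_mul] at this
    exact lt_irrefl _ this
  refine (measure_mono hsub).trans ((measure_union_le _ _).trans ?_)
  rw [hSc]
  have hq₁ : 0 < q₁ := hq₀.trans (h₀.trans h₁)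
  refine add_le_add ?_ ?_
  · have h := volume_lt_le_of_lintegral_rpow_le (hTm _ (hf.indicator hS)) hq₀ hl
      (hT₀ _ (hf.indicator hS))
    rw [lintegral_enorm_indicator_rpow hS hq₀] at h
    exact h.trans (le_of_eq (by ring))
  · have h := volume_lt_le_of_lintegral_rpow_le (hTm _ (hf.indicator hS.compl)) hq₁ hl
      (hT₁ _ (hf.indicator hS.compl))
    rw [lintegral_enorm_indicator_rpow hS.compl hq₁] at h
    exact h.trans (le_of_eq (by ring))

lemma lintegral_enorm_indicator_rpow_ne_top {f : ℝ → ℂ} {S : Set ℝ} (hS : MeasurableSet S) {q : ℝ}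
    (hq : 0 < q) (hf : ∫⁻ t, ‖f t‖ₑ ^ q ≠ ∞) : ∫⁻ t, ‖S.indicator f t‖ₑ ^ q ≠ ∞ := by
  rw [lintegral_enorm_indicator_rpow hS hq]
  exact ne_top_of_le_ne_top hf (setLIntegral_le_lintegral _ _)

/-- The maximal Hilbert transform is bounded on `L^p`, `1 < p < ∞`. The odd integers `p`, which
Calderón's argument does not reach, are obtained by interpolation. -/
theorem exists_lintegral_hilbertMax_rpow_le {p : ℝ} (hp : 1 < p) :
    ∃ K : ℝ≥0∞, K ≠ ∞ ∧ ∀ f : ℝ → ℂ, Measurable f →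
      ∫⁻ x : ℝ, hilbertMax f x ^ p ≤ K * ∫⁻ t, ‖f t‖ₑ ^ p := by
  have hp0 : 0 < p := by linarith
  obtain ⟨q₀, h1q₀, hq₀p, hq₀2⟩ : ∃ q₀ : ℝ, 1 < q₀ ∧ q₀ < p ∧ q₀ < 2 := by
    obtain ⟨q, h1, h2⟩ := exists_between (lt_min hp one_lt_two)
    exact ⟨q, h1, h2.trans_le (min_le_left _ _), h2.trans_le (min_le_right _ _)⟩
  have hcos₀ : Real.cos (q₀ * (Real.pi / 2)) ≠ 0 := by
    refine (Real.cos_neg_of_pi_div_two_lt_of_lt ?_ ?_).ne <;> nlinarith [Real.pi_pos]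
  obtain ⟨m, hm⟩ := exists_nat_gt p
  have hcos₁ : Real.cos ((2 * m : ℝ) * (Real.pi / 2)) ≠ 0 := by
    rw [show (2 * m : ℝ) * (Real.pi / 2) = m * Real.pi by ring, Real.cos_nat_mul_pi]
    exact pow_ne_zero _ (by norm_num)
  obtain ⟨K₀, hK₀, H₀⟩ := exists_lintegral_hilbertMax_rpow_le_of_cos_ne_zero h1q₀ hcos₀
  obtain ⟨K₁, hK₁, H₁⟩ := exists_lintegral_hilbertMax_rpow_le_of_cos_ne_zero
    (show (1 : ℝ) < 2 * m by linarith) hcos₁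
  refine ⟨ENNReal.ofReal (p * 2 ^ p) * (K₀ * ENNReal.ofReal (1 ^ (q₀ - p) / (p - q₀)) +
    K₁ * ENNReal.ofReal (1 ^ (2 * m - p) / (2 * m - p))) + 1, by finiteness, fun f hf => ?_⟩
  rcases eq_or_ne (∫⁻ t, ‖f t‖ₑ ^ p) ∞ with hfp | hfp
  · rw [hfp, ENNReal.mul_top (by simp)]
    exact le_top
  refine (lintegral_rpow_le_of_interpolation (q₁ := 2 * m) (A := 1) (by linarith) hq₀p
    (by linarith) one_pos (fun f hf => measurable_hilbertMax hf) H₀ H₁ hf fun S hS x => ?_).trans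
    (by gcongr; exact le_self_add)
  have h := hilbertMax_add_le (hf.indicator hS) (hf.indicator hS.compl) hp
    (lintegral_enorm_indicator_rpow_ne_top hS hp0 hfp)
    (lintegral_enorm_indicator_rpow_ne_top hS.compl hp0 hfp) x
  convert h using 2
  funext s
  exact (congrFun (indicator_self_add_compl S f) s).symm

/-! ### Existence of principal values -/

lemma tendsto_truncatedIntegral_of_integrable {H : ℝ → ℂ} (hH : Integrable H) :
    Tendsto (truncatedIntegral H) (𝓝[>] 0) (𝓝 (∫ t, H t)) := by
  simp only [funext (truncatedIntegral_eq_integral_indicator H)]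
  refine tendsto_integral_filter_of_dominated_convergence (fun t => ‖H t‖)
    (Eventually.of_forall fun ε => (hH.indicator (measurableSet_lt_abs ε)).aestronglyMeasurable)
    (Eventually.of_forall fun ε => ae_of_all _ fun t => norm_indicator_le_norm_self _ _) hH.norm ?_
  filter_upwards [compl_mem_ae_iff.2 (measure_singleton (0 : ℝ))] with t ht
  refine tendsto_const_nhds.congr' ?_
  filter_upwards [mem_nhdsWithin_of_mem_nhds (gt_mem_nhds (abs_pos.2 ht))] with ε hε
  exact (indicator_of_mem (s := {t : ℝ | ε < |t|}) hε H).symm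

/-- The principal value of `G t / t` exists if `G` is Lipschitz at the origin: the odd kernel
`1 / t` allows one to subtract `G 0` near the origin. -/
lemma exists_tendsto_truncatedIntegral_div {G : ℝ → ℂ} (hG : Measurable G) {M : ℝ}
    (hM : ∀ t : ℝ, |t| ≤ 1 → ‖G t - G 0‖ ≤ M * |t|)
    (hint : ∀ ε : ℝ, 0 < ε → IntegrableOn (fun t => G t / (t : ℂ)) {t : ℝ | ε < |t|}) :
    ∃ L, Tendsto (truncatedIntegral fun t => G t / (t : ℂ)) (𝓝[>] 0) (𝓝 L) := by
  set J : Set ℝ := {t : ℝ | |t| ≤ 1} with hJ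
  have hJm : MeasurableSet J := measurableSet_le (by fun_prop) measurable_const
  have hJc : Jᶜ = {t : ℝ | 1 < |t|} := by ext t; simp [J]
  have hJIcc : J = Icc (-1) 1 := by ext t; simp [J, abs_le]
  set k : ℝ → ℂ := J.indicator fun t => G 0 / (t : ℂ) with hk
  set H : ℝ → ℂ := fun t => G t / (t : ℂ) - k t with hHdef
  have hM0 : 0 ≤ M := by simpa using (norm_nonneg _).trans (hM 1 (by simp))
  have hHJ : IntegrableOn H J := by
    refine Measure.integrableOn_of_bounded (M := M) (by rw [hJIcc]; simp)
      (Measurable.aestronglyMeasurable ((by fun_prop : Measurable fun t : ℝ => G t / (t : ℂ)).sub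
        (Measurable.indicator (by fun_prop) hJm))) ?_
    filter_upwards [ae_restrict_mem hJm] with t ht
    rw [hHdef]
    simp only [hk, indicator_of_mem ht]
    rw [← sub_div, norm_div, Complex.norm_real, Real.norm_eq_abs]
    rcases eq_or_ne t 0 with rfl | h0
    · simpa using hM0
    · rw [div_le_iff₀ (abs_pos.2 h0)]
      exact hM t ht
  have hHJc : IntegrableOn H Jᶜ := by
    refine IntegrableOn.congr_fun (f := fun t => G t / (t : ℂ)) ?_ (fun t ht => ?_) hJm.compl
    · rw [hJc]; exact hint 1 one_pos
    · simp [hHdef, hk, indicator_of_notMem ht]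
  have hH : Integrable H := by
    rw [← integrableOn_univ, ← union_compl_self J]
    exact hHJ.union hHJc
  refine ⟨_, (tendsto_truncatedIntegral_of_integrable hH).congr' ?_⟩
  filter_upwards [self_mem_nhdsWithin] with ε (hε : 0 < ε)
  -- the contribution of the odd function `k` vanishes
  have hodd : truncatedIntegral k ε = 0 := by
    rw [truncatedIntegral_eq_integral_indicator]
    have h := integral_neg_eq_self (fun t => {t : ℝ | ε < |t|}.indicator k t) volume
    have h2 : (fun t => {t : ℝ | ε < |t|}.indicator k (-t)) =
        fun t => -{t : ℝ | ε < |t|}.indicator k t := by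
      funext t
      simp only [hk, indicator, hJ, mem_ofPred_eq, abs_neg]
      split_ifs <;> simp [div_neg]
    rw [h2, integral_neg, neg_eq_iff_add_eq_zero, add_self_eq_zero] at h
    exact h
  have hHε : IntegrableOn H {t : ℝ | ε < |t|} := hH.integrableOn
  have hkε : IntegrableOn k {t : ℝ | ε < |t|} := by
    have := (hint ε hε).sub hHε
    refine this.congr_fun (fun t _ => ?_) (measurableSet_lt_abs ε)
    simp [hHdef]
  have hsplit : truncatedIntegral (fun t => G t / (t : ℂ)) ε =
      truncatedIntegral H ε + truncatedIntegral k ε := by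
    simp only [truncatedIntegral]
    rw [← integral_add hHε hkε]
    simp [hHdef]
  rw [hsplit, hodd, add_zero]

lemma exists_tendsto_hilbertTrunc_of_contDiff {f : ℝ → ℂ} (hf : ContDiff ℝ 1 f) (x : ℝ)
    (hint : ∀ ε : ℝ, 0 < ε → IntegrableOn (fun t => f (x - t) / (t : ℂ)) {t : ℝ | ε < |t|}) :
    ∃ L, Tendsto (fun ε => hilbertTrunc f ε x) (𝓝[>] 0) (𝓝 L) := by
  have hd : ContDiff ℝ 1 fun t => f (x - t) := hf.comp (contDiff_const.sub contDiff_id)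
  obtain ⟨M, hM⟩ := (isCompact_Icc (a := (-1 : ℝ)) (b := 1)).exists_bound_of_continuousOn
    (hd.continuous_deriv le_rfl).continuousOn
  refine exists_tendsto_truncatedIntegral_div (M := M) (by have := hf.continuous; fun_prop)
    (fun t ht => ?_) hint
  have := (convex_Icc (-1 : ℝ) 1).norm_image_sub_le_of_norm_deriv_le
    (f := fun t => f (x - t)) (fun s _ => (hd.differentiable one_ne_zero).differentiableAt) hM
    (x := 0) (y := t) (by simp) (abs_le.1 ht)
  simpa using this

lemma lintegral_rpow_ne_top_of_memLp {f : ℝ → ℂ} {p : ℝ≥0∞} (hp1 : 1 < p) (hp2 : p < ∞)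
    (hf : MemLp f p) : ∫⁻ t, ‖f t‖ₑ ^ p.toReal ≠ ∞ :=
  (lintegral_rpow_enorm_lt_top_of_eLpNorm_lt_top (zero_lt_one.trans hp1).ne' hp2.ne
    hf.eLpNorm_lt_top).ne

lemma one_lt_toReal {p : ℝ≥0∞} (hp1 : 1 < p) (hp2 : p < ∞) : 1 < p.toReal := by
  rw [← ENNReal.toReal_one]
  exact (ENNReal.toReal_lt_toReal ENNReal.one_ne_top hp2.ne).2 hp1

/-- The principal value defining the Hilbert transform of an `L^p` function exists almost
everywhere: it does for smooth functions, and the maximal function controls the oscillation. -/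
theorem ae_exists_tendsto_hilbertTrunc {p : ℝ≥0∞} (hp1 : 1 < p) (hp2 : p < ∞) {f : ℝ → ℂ}
    (hf : Measurable f) (hfp : MemLp f p) :
    ∀ᵐ x, ∃ L, Tendsto (fun ε => hilbertTrunc f ε x) (𝓝[>] 0) (𝓝 L) := by
  have hr := one_lt_toReal hp1 hp2
  set r := p.toReal with hrdef
  have hr0 : 0 < r := by linarith
  obtain ⟨K, hK, hKf⟩ := exists_lintegral_hilbertMax_rpow_le hr
  -- the set where the oscillation at `0` exceeds `3 c` is null for every `c > 0`
  have hnull : ∀ c : ℝ, 0 < c → volume {x | ¬ ∀ᶠ z in (𝓝[>] (0 : ℝ)) ×ˢ (𝓝[>] (0 : ℝ)),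
      dist (hilbertTrunc f z.1 x) (hilbertTrunc f z.2 x) < 3 * c} = 0 := by
    intro c hc
    set B := {x | ¬ ∀ᶠ z in (𝓝[>] (0 : ℝ)) ×ˢ (𝓝[>] (0 : ℝ)),
      dist (hilbertTrunc f z.1 x) (hilbertTrunc f z.2 x) < 3 * c}
    have hB : ∀ δ : ℝ, 0 < δ →
        ENNReal.ofReal c ^ r * volume B ≤ K * ENNReal.ofReal δ ^ r := by
      intro δ hδ
      obtain ⟨g, hgc, hgs, hg⟩ := hfp.exist_eLpNorm_sub_le hp2.ne hp1.le hδ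
      have hgm : Measurable g := hgs.continuous.measurable
      have hgp : MemLp g p := hgs.continuous.memLp_of_hasCompactSupport hgc
      have hsub : B ⊆ {x | ENNReal.ofReal c ≤ hilbertMax (fun s => f s - g s) x} := by
        intro x hx
        by_contra hcon
        rw [mem_ofPred_eq, not_le] at hcon
        refine hx ?_
        have hif : ∀ ε : ℝ, 0 < ε → IntegrableOn (fun t => f (x - t) / (t : ℂ)) {t : ℝ | ε < |t|} :=
          fun ε hε => integrableOn_div_lt_abs hf hr (lintegral_rpow_ne_top_of_memLp hp1 hp2 hfp) x hε
        have hig : ∀ ε : ℝ, 0 < ε → IntegrableOn (fun t => g (x - t) / (t : ℂ)) {t : ℝ | ε < |t|} :=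
          fun ε hε => integrableOn_div_lt_abs hgm hr
            (lintegral_rpow_ne_top_of_memLp hp1 hp2 hgp) x hε
        have hid : ∀ ε : ℝ, 0 < ε →
            IntegrableOn (fun t => (f (x - t) - g (x - t)) / (t : ℂ)) {t : ℝ | ε < |t|} :=
          fun ε hε => by
            simp only [sub_div]
            exact (hif ε hε).sub (hig ε hε)
        have hdiff : ∀ ε : ℝ, 0 < ε → ‖hilbertTrunc f ε x - hilbertTrunc g ε x‖ < c := by
          intro ε hε
          have h1 := (enorm_hilbertTrunc_le_hilbertMax (f := fun s => f s - g s) hid hε).trans_lt hcon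
          have h2 : hilbertTrunc (fun s => f s - g s) ε x =
              hilbertTrunc f ε x - hilbertTrunc g ε x := by
            simp only [hilbertTrunc, truncatedIntegral, sub_div]
            exact integral_sub (hif ε hε) (hig ε hε)
          rw [h2, ← ofReal_norm] at h1
          exact (ENNReal.ofReal_lt_ofReal_iff hc).1 h1
        obtain ⟨L, hL⟩ := exists_tendsto_hilbertTrunc_of_contDiff (hgs.of_le (by simp)) x hig
        have hcau : ∀ᶠ z in (𝓝[>] (0 : ℝ)) ×ˢ (𝓝[>] (0 : ℝ)),
            dist (hilbertTrunc g z.1 x) (hilbertTrunc g z.2 x) < c := by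
          have h1 := tendsto_uniformity_iff_dist_tendsto_zero.1 (cauchy_map_iff'.1 hL.cauchy_map)
          exact h1.eventually (gt_mem_nhds hc)
        have hpos : ∀ᶠ z in (𝓝[>] (0 : ℝ)) ×ˢ (𝓝[>] (0 : ℝ)), 0 < z.1 ∧ 0 < z.2 :=
          Filter.prod_mem_prod self_mem_nhdsWithin self_mem_nhdsWithin
        filter_upwards [hcau, hpos] with z hz hz0
        have h1 := hdiff z.1 hz0.1
        have h2 := hdiff z.2 hz0.2
        rw [dist_eq_norm] at hz ⊢
        calc _ = ‖(hilbertTrunc f z.1 x - hilbertTrunc g z.1 x) +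
              (hilbertTrunc g z.1 x - hilbertTrunc g z.2 x) -
              (hilbertTrunc f z.2 x - hilbertTrunc g z.2 x)‖ := by congr 1; ring
          _ ≤ _ := (norm_sub_le _ _).trans (add_le_add_left (norm_add_le _ _) _)
          _ < 3 * c := by linarith
      calc ENNReal.ofReal c ^ r * volume B
          ≤ ENNReal.ofReal c ^ r *
            volume {x | ENNReal.ofReal c ^ r ≤ hilbertMax (fun s => f s - g s) x ^ r} := by
            gcongr
            exact hsub.trans fun x (hx : _ ≤ _) => ENNReal.rpow_le_rpow hx hr0.le
        _ ≤ ∫⁻ x, hilbertMax (fun s => f s - g s) x ^ r :=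
            mul_meas_ge_le_lintegral ((measurable_hilbertMax (hf.sub hgm)).pow_const r) _
        _ ≤ K * ∫⁻ t, ‖f t - g t‖ₑ ^ r := hKf _ (hf.sub hgm)
        _ ≤ K * ENNReal.ofReal δ ^ r := by
            gcongr
            have h1 := eLpNorm_eq_lintegral_rpow_enorm_toReal (f := f - g) (μ := volume)
              (zero_lt_one.trans hp1).ne' hp2.ne
            rw [h1, ← hrdef, one_div] at hg
            exact (ENNReal.rpow_inv_le_iff hr0).1 hg
    have hlim : Tendsto (fun δ : ℝ => K * ENNReal.ofReal δ ^ r) (𝓝[>] 0) (𝓝 0) := by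
      have h1 : Tendsto (fun δ : ℝ => ENNReal.ofReal δ ^ r) (𝓝[>] 0) (𝓝 0) := by
        have h2 : Continuous fun δ : ℝ => ENNReal.ofReal δ ^ r :=
          ENNReal.continuous_rpow_const.comp ENNReal.continuous_ofReal
        have h3 := h2.tendsto 0
        simp only [ENNReal.ofReal_zero, ENNReal.zero_rpow_of_pos hr0] at h3
        exact h3.mono_left nhdsWithin_le_nhds
      simpa using ENNReal.Tendsto.const_mul h1 (Or.inr hK)
    have hle : ENNReal.ofReal c ^ r * volume B ≤ 0 :=
      ge_of_tendsto hlim (by filter_upwards [self_mem_nhdsWithin] with δ hδ using hB δ hδ)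
    have hc0 : ENNReal.ofReal c ^ r ≠ 0 := by
      rw [ENNReal.ofReal_rpow_of_pos hc]
      simpa using Real.rpow_pos_of_pos hc r
    exact (mul_eq_zero.1 (le_zero_iff.1 hle)).resolve_left hc0
  have hall : ∀ᵐ x, ∀ n : ℕ, ∀ᶠ z in (𝓝[>] (0 : ℝ)) ×ˢ (𝓝[>] (0 : ℝ)),
      dist (hilbertTrunc f z.1 x) (hilbertTrunc f z.2 x) < 3 * (1 / ((n : ℝ) + 1)) :=
    ae_all_iff.2 fun n => ae_iff.2 (hnull _ (by positivity))
  filter_upwards [hall] with x hx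
  refine cauchy_map_iff_exists_tendsto.1 ?_
  rw [cauchy_map_iff', tendsto_uniformity_iff_dist_tendsto_zero, Metric.tendsto_nhds]
  intro c hc
  obtain ⟨n, hn⟩ := exists_nat_one_div_lt (show 0 < c / 3 by positivity)
  filter_upwards [hx n] with z hz
  rw [Real.dist_0_eq_abs, abs_of_nonneg dist_nonneg]
  linarith

/-! ### Van der Corput's lemma -/

/-- An upward closed property of the points of `[a, b]` holds exactly to the right of some `c`. -/
lemma exists_split_of_upward {P : ℝ → Prop} {a b : ℝ} (hab : a ≤ b)
    (hP : ∀ s t, a ≤ s → s ≤ t → t ≤ b → P s → P t) :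
    ∃ c ∈ Icc a b, (∀ t ∈ Ico a c, ¬ P t) ∧ ∀ t ∈ Ioc c b, P t := by
  set A : Set ℝ := insert b {t | t ∈ Icc a b ∧ P t}
  have hbdd : BddBelow A := ⟨a, by rintro t (rfl | ht); exacts [hab, ht.1.1]⟩
  have hne : A.Nonempty := ⟨b, mem_insert _ _⟩
  refine ⟨sInf A, ⟨le_csInf hne ?_, csInf_le hbdd (mem_insert _ _)⟩, fun t ht hPt => ?_,
    fun t ht => ?_⟩
  · rintro t (rfl | ht)
    exacts [hab, ht.1.1]
  · have htb : t ≤ b := ht.2.le.trans (csInf_le hbdd (mem_insert _ _))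
    exact absurd (csInf_le hbdd (Or.inr ⟨⟨ht.1, htb⟩, hPt⟩)) (not_le.2 ht.2)
  · obtain ⟨s, hs, hst⟩ := exists_lt_of_csInf_lt hne ht.1
    rcases hs with rfl | hs
    · exact absurd ht.2 (not_le.2 hst)
    · exact hP s t hs.1.1 hst.le ht.2 hs.2

lemma forall_Icc_le_of_forall_Ioo {f g : ℝ → ℝ} {a b : ℝ} (hab : a < b)
    (hf : ContinuousOn f (Icc a b)) (hg : ContinuousOn g (Icc a b))
    (h : ∀ t ∈ Ioo a b, f t ≤ g t) : ∀ t ∈ Icc a b, f t ≤ g t := by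
  rw [← closure_Ioo hab.ne] at *
  exact fun t ht => le_on_closure h hf hg ht

/-- The first derivative test: `φ = Φ'` is monotone (its derivative `ψ` times the sign `σ` is
nonnegative) and bounded away from zero. -/
lemma norm_integral_exp_le_of_le_deriv {Φ φ ψ : ℝ → ℝ} {a b m σ : ℝ} (hab : a ≤ b) (hm : 0 < m)
    (hΦ : ∀ t ∈ Icc a b, HasDerivAt Φ (φ t) t) (hφ : ∀ t ∈ Icc a b, HasDerivAt φ (ψ t) t)
    (hψ : ContinuousOn ψ (Icc a b)) (hσ : |σ| = 1) (hsign : ∀ t ∈ Icc a b, 0 ≤ σ * ψ t)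
    (hlow : ∀ t ∈ Icc a b, m ≤ |φ t|) :
    ‖∫ t in a..b, Complex.exp (Complex.I * Φ t)‖ ≤ 4 / m := by
  have hIcc : uIcc a b = Icc a b := uIcc_of_le hab
  have hne : ∀ t ∈ Icc a b, φ t ≠ 0 := fun t ht h => by
    have := hlow t ht
    rw [h, abs_zero] at this
    linarith
  have hφc : ContinuousOn φ (Icc a b) := fun t ht => (hφ t ht).continuousAt.continuousWithinAt
  have hΦc : ContinuousOn Φ (Icc a b) := fun t ht => (hΦ t ht).continuousAt.continuousWithinAt
  have hu : ∀ t ∈ uIcc a b, HasDerivAt (fun t => (((φ t)⁻¹ : ℝ) : ℂ))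
      ((-ψ t / φ t ^ 2 : ℝ) : ℂ) t := fun t ht => by
    rw [hIcc] at ht
    exact ((hφ t ht).fun_inv (hne t ht)).ofReal_comp
  have hv : ∀ t ∈ uIcc a b, HasDerivAt (fun t => -Complex.I * Complex.exp (Complex.I * Φ t))
      (φ t * Complex.exp (Complex.I * Φ t)) t := fun t ht => by
    rw [hIcc] at ht
    have h1 := (((hΦ t ht).ofReal_comp.const_mul Complex.I).cexp).const_mul (-Complex.I)
    refine h1.congr_deriv ?_
    linear_combination (-(φ t : ℂ) * Complex.exp (Complex.I * Φ t)) * Complex.I_sq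
  have hu'c : ContinuousOn (fun t => -ψ t / φ t ^ 2) (Icc a b) :=
    hψ.neg.div (hφc.pow 2) fun t ht => pow_ne_zero 2 (hne t ht)
  have hu' : IntervalIntegrable (fun t => ((-ψ t / φ t ^ 2 : ℝ) : ℂ)) volume a b :=
    ContinuousOn.intervalIntegrable (by
      rw [hIcc]; exact Complex.continuous_ofReal.comp_continuousOn hu'c)
  have hv' : IntervalIntegrable (fun t => (φ t : ℂ) * Complex.exp (Complex.I * Φ t)) volume a b :=
    ContinuousOn.intervalIntegrable (by rw [hIcc]; fun_prop)
  have hparts := intervalIntegral.integral_mul_deriv_eq_deriv_mul hu hv hu' hv'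
  have hlhs : ∫ t in a..b, (((φ t)⁻¹ : ℝ) : ℂ) * (φ t * Complex.exp (Complex.I * Φ t)) =
      ∫ t in a..b, Complex.exp (Complex.I * Φ t) := by
    refine intervalIntegral.integral_congr fun t ht => ?_
    rw [hIcc] at ht
    have := hne t ht
    rw [← mul_assoc, ← Complex.ofReal_mul, inv_mul_cancel₀ this, Complex.ofReal_one, one_mul]
  have hexp : ∀ t, ‖-Complex.I * Complex.exp (Complex.I * Φ t)‖ = 1 := fun t => by
    rw [norm_mul, norm_neg, Complex.norm_I, one_mul, mul_comm, Complex.norm_exp_ofReal_mul_I]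
  have hend : ∀ t ∈ Icc a b,
      ‖(((φ t)⁻¹ : ℝ) : ℂ) * (-Complex.I * Complex.exp (Complex.I * Φ t))‖ ≤ 1 / m := fun t ht => by
    rw [norm_mul, hexp, mul_one, Complex.norm_real, norm_inv, Real.norm_eq_abs, one_div]
    exact inv_anti₀ hm (hlow t ht)
  have hrest : ‖∫ t in a..b, ((-ψ t / φ t ^ 2 : ℝ) : ℂ) *
      (-Complex.I * Complex.exp (Complex.I * Φ t))‖ ≤ 2 / m := by
    have hFTC : ∫ t in a..b, -ψ t / φ t ^ 2 = (φ b)⁻¹ - (φ a)⁻¹ :=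
      intervalIntegral.integral_eq_sub_of_hasDerivAt
        (fun t ht => (hφ t (hIcc ▸ ht)).fun_inv (hne t (hIcc ▸ ht)))
        (ContinuousOn.intervalIntegrable (by rw [hIcc]; exact hu'c))
    calc _ ≤ ∫ t in a..b, -σ * (-ψ t / φ t ^ 2) := by
          refine intervalIntegral.norm_integral_le_of_norm_le hab (ae_of_all _ fun t ht => ?_)
            ((ContinuousOn.intervalIntegrable (by rw [hIcc]; exact hu'c)).const_mul _)
          have ht' : t ∈ Icc a b := Ioc_subset_Icc_self ht
          rw [norm_mul, hexp, mul_one, Complex.norm_real, Real.norm_eq_abs, abs_div, abs_neg,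
            abs_of_nonneg (sq_nonneg (φ t)), ← one_mul |ψ t|, ← hσ, ← abs_mul,
            abs_of_nonneg (hsign t ht')]
          exact le_of_eq (by ring)
      _ = -σ * ((φ b)⁻¹ - (φ a)⁻¹) := by rw [intervalIntegral.integral_const_mul, hFTC]
      _ ≤ |-σ * ((φ b)⁻¹ - (φ a)⁻¹)| := le_abs_self _
      _ = |(φ b)⁻¹ - (φ a)⁻¹| := by rw [abs_mul, abs_neg, hσ, one_mul]
      _ ≤ |(φ b)⁻¹| + |(φ a)⁻¹| := abs_sub _ _
      _ ≤ m⁻¹ + m⁻¹ := by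
          rw [abs_inv, abs_inv]
          exact add_le_add (inv_anti₀ hm (hlow b (right_mem_Icc.2 hab)))
            (inv_anti₀ hm (hlow a (left_mem_Icc.2 hab)))
      _ = 2 / m := by ring
  rw [← hlhs, hparts]
  refine (norm_sub_le _ _).trans ?_
  have h1 := (norm_sub_le ((((φ b)⁻¹ : ℝ) : ℂ) * (-Complex.I * Complex.exp (Complex.I * Φ b)))
    ((((φ a)⁻¹ : ℝ) : ℂ) * (-Complex.I * Complex.exp (Complex.I * Φ a)))).trans
    (add_le_add (hend b (right_mem_Icc.2 hab)) (hend a (left_mem_Icc.2 hab)))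
  calc _ ≤ (1 / m + 1 / m) + 2 / m := add_le_add h1 hrest
    _ = 4 / m := by ring

lemma norm_exp_I_mul_ofReal (r : ℝ) : ‖Complex.exp (Complex.I * r)‖ = 1 := by
  rw [mul_comm, Complex.norm_exp_ofReal_mul_I]

lemma norm_integral_exp_le_length (Φ : ℝ → ℝ) {a b : ℝ} (hab : a ≤ b) :
    ‖∫ t in a..b, Complex.exp (Complex.I * Φ t)‖ ≤ b - a := by
  have := intervalIntegral.norm_integral_le_of_norm_le_const (a := a) (b := b) (C := 1)
    (f := fun t => Complex.exp (Complex.I * Φ t)) fun t _ => (norm_exp_I_mul_ofReal _).le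
  rwa [one_mul, abs_of_nonneg (sub_nonneg.2 hab)] at this

lemma norm_integral_exp_neg (Φ : ℝ → ℝ) (a b : ℝ) :
    ‖∫ t in a..b, Complex.exp (Complex.I * ((-Φ t : ℝ) : ℂ))‖ =
      ‖∫ t in a..b, Complex.exp (Complex.I * Φ t)‖ := by
  have : ∀ t, Complex.exp (Complex.I * ((-Φ t : ℝ) : ℂ)) =
      (starRingEnd ℂ) (Complex.exp (Complex.I * Φ t)) := fun t => by
    rw [← Complex.exp_conj]
    simp
  simp_rw [this]
  rw [intervalIntegral.intervalIntegral_eq_integral_uIoc,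
    intervalIntegral.intervalIntegral_eq_integral_uIoc, integral_conj, norm_smul, norm_smul,
    RCLike.norm_conj]

/-- Van der Corput's lemma mixing the first two derivatives, for a convex phase. -/
lemma norm_integral_exp_le_of_convex {Φ φ ψ : ℝ → ℝ} {a b m : ℝ} (hab : a ≤ b) (hm : 0 < m)
    (hΦ : ∀ t ∈ Icc a b, HasDerivAt Φ (φ t) t) (hφ : ∀ t ∈ Icc a b, HasDerivAt φ (ψ t) t)
    (hψ : ContinuousOn ψ (Icc a b)) (hsign : ∀ t ∈ Icc a b, 0 ≤ ψ t)
    (hlow : ∀ t ∈ Icc a b, m ≤ |φ t| ∨ m ^ 2 ≤ |ψ t|) :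
    ‖∫ t in a..b, Complex.exp (Complex.I * Φ t)‖ ≤ 10 / m := by
  have hφc : ContinuousOn φ (Icc a b) := fun t ht => (hφ t ht).continuousAt.continuousWithinAt
  have hΦc : ContinuousOn Φ (Icc a b) := fun t ht => (hΦ t ht).continuousAt.continuousWithinAt
  have hmono : MonotoneOn φ (Icc a b) := by
    refine monotoneOn_of_hasDerivWithinAt_nonneg (convex_Icc a b) hφc
      (fun t ht => (hφ t (interior_subset ht)).hasDerivWithinAt)
      fun t ht => hsign t (interior_subset ht)
  -- `φ ≤ -m` on `[a, c)`, `|φ| < m` on `(c, d)`, `φ ≥ m` on `(d, b]`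
  obtain ⟨c, hc, hc1, hc2⟩ := exists_split_of_upward (P := fun t => -m < φ t) hab
    fun s t hs hst htb h => h.trans_le (hmono ⟨hs, hst.trans htb⟩ ⟨hs.trans hst, htb⟩ hst)
  obtain ⟨d, hd, hd1, hd2⟩ := exists_split_of_upward (P := fun t => m ≤ φ t) hc.2
    fun s t hs hst htb h => h.trans (hmono ⟨hc.1.trans hs, hst.trans htb⟩
      ⟨hc.1.trans (hs.trans hst), htb⟩ hst)
  have sub1 : Icc a c ⊆ Icc a b := Icc_subset_Icc_right hc.2
  have sub2 : Icc c d ⊆ Icc a b := Icc_subset_Icc hc.1 hd.2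
  have sub3 : Icc d b ⊆ Icc a b := Icc_subset_Icc_left (hc.1.trans hd.1)
  have hint : ∀ x y, x ≤ y → Icc x y ⊆ Icc a b →
      IntervalIntegrable (fun t => Complex.exp (Complex.I * Φ t)) volume x y := fun x y hxy h =>
    ContinuousOn.intervalIntegrable (by
      rw [uIcc_of_le hxy]
      have := hΦc.mono h
      fun_prop)
  have i1 : ‖∫ t in a..c, Complex.exp (Complex.I * Φ t)‖ ≤ 4 / m := by
    rcases hc.1.eq_or_lt with rfl | hac
    · simp only [intervalIntegral.integral_same, norm_zero]; positivity
    · refine norm_integral_exp_le_of_le_deriv hc.1 hm (fun t ht => hΦ t (sub1 ht))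
        (fun t ht => hφ t (sub1 ht)) (hψ.mono sub1) (σ := 1) (by simp)
        (fun t ht => by simpa using hsign t (sub1 ht)) ?_
      refine forall_Icc_le_of_forall_Ioo hac continuousOn_const (hφc.mono sub1).abs fun t ht => ?_
      have := not_lt.1 (hc1 t ⟨ht.1.le, ht.2⟩)
      rw [abs_of_nonpos (by linarith)]
      linarith
  have i3 : ‖∫ t in d..b, Complex.exp (Complex.I * Φ t)‖ ≤ 4 / m := by
    rcases hd.2.eq_or_lt with rfl | hdb
    · simp only [intervalIntegral.integral_same, norm_zero]; positivity
    · refine norm_integral_exp_le_of_le_deriv hd.2 hm (fun t ht => hΦ t (sub3 ht))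
        (fun t ht => hφ t (sub3 ht)) (hψ.mono sub3) (σ := 1) (by simp)
        (fun t ht => by simpa using hsign t (sub3 ht)) ?_
      refine forall_Icc_le_of_forall_Ioo hdb continuousOn_const (hφc.mono sub3).abs fun t ht => ?_
      exact (hd2 t ⟨ht.1, ht.2.le⟩).trans (le_abs_self _)
  have i2 : ‖∫ t in c..d, Complex.exp (Complex.I * Φ t)‖ ≤ 2 / m := by
    refine (norm_integral_exp_le_length Φ hd.1).trans ?_
    rcases hd.1.eq_or_lt with rfl | hcd
    · rw [sub_self]; positivity
    have habs : ∀ t ∈ Ioo c d, |φ t| < m := fun t ht => by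
      rw [abs_lt]
      exact ⟨hc2 t ⟨ht.1, ht.2.le.trans hd.2⟩, not_le.1 (hd1 t ⟨ht.1.le, ht.2⟩)⟩
    have hψlow : ∀ t ∈ Ioo c d, m ^ 2 ≤ ψ t := fun t ht => by
      have ht' := sub2 (Ioo_subset_Icc_self ht)
      have := (hlow t ht').resolve_left (not_le.2 (habs t ht))
      rwa [abs_of_nonneg (hsign t ht')] at this
    have hclosed := forall_Icc_le_of_forall_Ioo hcd (hφc.mono sub2).abs
      (continuousOn_const (c := m)) fun t ht => (habs t ht).le
    have hmvt := (convex_Icc c d).mul_sub_le_image_sub_of_le_deriv (hφc.mono sub2)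
      (fun t ht => (hφ t (sub2 (interior_subset ht))).differentiableAt.differentiableWithinAt)
      (C := m ^ 2) (fun t ht => by
        rw [(hφ t (sub2 (interior_subset ht))).deriv]
        rw [interior_Icc] at ht
        exact hψlow t ht) c (left_mem_Icc.2 hd.1) d (right_mem_Icc.2 hd.1) hd.1
    have h1 := (abs_le.1 (hclosed d (right_mem_Icc.2 hd.1))).2
    have h2 := (abs_le.1 (hclosed c (left_mem_Icc.2 hd.1))).1
    rw [le_div_iff₀ hm]
    have : m * ((d - c) * m) ≤ m * 2 := by nlinarith
    exact le_of_mul_le_mul_left this hm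
  rw [← intervalIntegral.integral_add_adjacent_intervals (hint a c hc.1 sub1)
    ((hint c d hd.1 sub2).trans (hint d b hd.2 sub3)),
    ← intervalIntegral.integral_add_adjacent_intervals (hint c d hd.1 sub2) (hint d b hd.2 sub3)]
  calc _ ≤ 4 / m + (2 / m + 4 / m) :=
        (norm_add_le _ _).trans (add_le_add i1 ((norm_add_le _ _).trans (add_le_add i2 i3)))
    _ = 10 / m := by ring

lemma norm_integral_exp_le_of_concave {Φ φ ψ : ℝ → ℝ} {a b m : ℝ} (hab : a ≤ b) (hm : 0 < m)
    (hΦ : ∀ t ∈ Icc a b, HasDerivAt Φ (φ t) t) (hφ : ∀ t ∈ Icc a b, HasDerivAt φ (ψ t) t)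
    (hψ : ContinuousOn ψ (Icc a b)) (hsign : ∀ t ∈ Icc a b, ψ t ≤ 0)
    (hlow : ∀ t ∈ Icc a b, m ≤ |φ t| ∨ m ^ 2 ≤ |ψ t|) :
    ‖∫ t in a..b, Complex.exp (Complex.I * Φ t)‖ ≤ 10 / m := by
  rw [← norm_integral_exp_neg]
  exact norm_integral_exp_le_of_convex (Φ := fun t => -Φ t) (φ := fun t => -φ t)
    (ψ := fun t => -ψ t) hab hm (fun t ht => (hΦ t ht).fun_neg) (fun t ht => (hφ t ht).fun_neg)
    hψ.neg (fun t ht => neg_nonneg.2 (hsign t ht)) (by simpa only [abs_neg] using hlow)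

/-- Van der Corput's lemma for a phase whose second derivative `ψ` changes sign at most once and
such that the first two derivatives are never small simultaneously. -/
lemma norm_integral_exp_le_of_one_sign_change {Φ φ ψ : ℝ → ℝ} {a b m : ℝ} (hab : a ≤ b)
    (hm : 0 < m) (hΦ : ∀ t ∈ Icc a b, HasDerivAt Φ (φ t) t)
    (hφ : ∀ t ∈ Icc a b, HasDerivAt φ (ψ t) t) (hψ : ContinuousOn ψ (Icc a b))
    (hsign : (∀ s t, a ≤ s → s ≤ t → t ≤ b → 0 ≤ ψ s → 0 ≤ ψ t) ∨
      ∀ s t, a ≤ s → s ≤ t → t ≤ b → ψ s ≤ 0 → ψ t ≤ 0)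
    (hlow : ∀ t ∈ Icc a b, m ≤ |φ t| ∨ m ^ 2 ≤ |ψ t|) :
    ‖∫ t in a..b, Complex.exp (Complex.I * Φ t)‖ ≤ 20 / m := by
  have hΦc : ContinuousOn Φ (Icc a b) := fun t ht => (hΦ t ht).continuousAt.continuousWithinAt
  have hint : ∀ x y, x ≤ y → Icc x y ⊆ Icc a b →
      IntervalIntegrable (fun t => Complex.exp (Complex.I * Φ t)) volume x y := fun x y hxy h =>
    ContinuousOn.intervalIntegrable (by
      rw [uIcc_of_le hxy]
      have := hΦc.mono h
      fun_prop)
  have hpos : ∀ x y, x ≤ y → Icc x y ⊆ Icc a b → (∀ t ∈ Ioo x y, 0 ≤ ψ t) →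
      ‖∫ t in x..y, Complex.exp (Complex.I * Φ t)‖ ≤ 10 / m := fun x y hxy h hs => by
    rcases hxy.eq_or_lt with rfl | hlt
    · simp only [intervalIntegral.integral_same, norm_zero]; positivity
    · exact norm_integral_exp_le_of_convex hxy hm (fun t ht => hΦ t (h ht))
        (fun t ht => hφ t (h ht)) (hψ.mono h)
        (forall_Icc_le_of_forall_Ioo hlt continuousOn_const (hψ.mono h) hs)
        (fun t ht => hlow t (h ht))
  have hneg : ∀ x y, x ≤ y → Icc x y ⊆ Icc a b → (∀ t ∈ Ioo x y, ψ t ≤ 0) →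
      ‖∫ t in x..y, Complex.exp (Complex.I * Φ t)‖ ≤ 10 / m := fun x y hxy h hs => by
    rcases hxy.eq_or_lt with rfl | hlt
    · simp only [intervalIntegral.integral_same, norm_zero]; positivity
    · exact norm_integral_exp_le_of_concave hxy hm (fun t ht => hΦ t (h ht))
        (fun t ht => hφ t (h ht)) (hψ.mono h)
        (forall_Icc_le_of_forall_Ioo hlt (hψ.mono h) continuousOn_const hs)
        (fun t ht => hlow t (h ht))
  have hfin : ∀ c ∈ Icc a b, ‖∫ t in a..c, Complex.exp (Complex.I * Φ t)‖ ≤ 10 / m →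
      ‖∫ t in c..b, Complex.exp (Complex.I * Φ t)‖ ≤ 10 / m →
      ‖∫ t in a..b, Complex.exp (Complex.I * Φ t)‖ ≤ 20 / m := fun c hc h1 h2 => by
    rw [← intervalIntegral.integral_add_adjacent_intervals
      (hint a c hc.1 (Icc_subset_Icc_right hc.2)) (hint c b hc.2 (Icc_subset_Icc_left hc.1))]
    calc _ ≤ 10 / m + 10 / m := (norm_add_le _ _).trans (add_le_add h1 h2)
      _ = 20 / m := by ring
  rcases hsign with h | h
  · obtain ⟨c, hc, hc1, hc2⟩ := exists_split_of_upward (P := fun t => 0 ≤ ψ t) hab h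
    exact hfin c hc
      (hneg a c hc.1 (Icc_subset_Icc_right hc.2) fun t ht => (not_le.1 (hc1 t ⟨ht.1.le, ht.2⟩)).le)
      (hpos c b hc.2 (Icc_subset_Icc_left hc.1) fun t ht => hc2 t ⟨ht.1, ht.2.le⟩)
  · obtain ⟨c, hc, hc1, hc2⟩ := exists_split_of_upward (P := fun t => ψ t ≤ 0) hab h
    exact hfin c hc
      (hpos a c hc.1 (Icc_subset_Icc_right hc.2) fun t ht => (not_le.1 (hc1 t ⟨ht.1.le, ht.2⟩)).le)
      (hneg c b hc.2 (Icc_subset_Icc_left hc.1) fun t ht => hc2 t ⟨ht.1, ht.2.le⟩)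

/-- Integration by parts against a decreasing amplitude `w ≥ 0`. -/
lemma norm_integral_mul_le_of_antitone {E : ℝ → ℂ} {w w' : ℝ → ℝ} {a b B : ℝ} (hab : a ≤ b)
    (hE : ContinuousOn E (Icc a b)) (hw : ∀ t ∈ Icc a b, HasDerivAt w (w' t) t)
    (hw'c : ContinuousOn w' (Icc a b)) (hw' : ∀ t ∈ Icc a b, w' t ≤ 0) (hwb : 0 ≤ w b)
    (hB : ∀ x ∈ Icc a b, ‖∫ t in a..x, E t‖ ≤ B) :
    ‖∫ t in a..b, E t * w t‖ ≤ B * w a := by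
  have hIcc : uIcc a b = Icc a b := uIcc_of_le hab
  set P : ℝ → ℂ := fun x => ∫ t in a..x, E t with hP
  have hEi : IntervalIntegrable E volume a b := ContinuousOn.intervalIntegrable (by rwa [hIcc])
  have hw'i : IntervalIntegrable w' volume a b := ContinuousOn.intervalIntegrable (by rwa [hIcc])
  have hPc : ContinuousOn P (uIcc a b) := intervalIntegral.continuousOn_primitive_interval' hEi
    left_mem_uIcc
  have hwc : ContinuousOn (fun t => (w t : ℂ)) (uIcc a b) := fun t ht => by
    rw [hIcc] at ht
    exact (hw t ht).ofReal_comp.continuousAt.continuousWithinAt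
  have hPd : ∀ t ∈ Ioo (min a b) (max a b), HasDerivAt P (E t) t := fun t ht => by
    rw [min_eq_left hab, max_eq_right hab] at ht
    have hnhds : Icc a b ∈ 𝓝 t := Icc_mem_nhds ht.1 ht.2
    exact intervalIntegral.integral_hasDerivAt_right
      (hEi.mono_set (by
        rw [hIcc, uIcc_of_le ht.1.le]; exact Icc_subset_Icc_right ht.2.le))
      (hE.stronglyMeasurableAtFilter_nhdsWithin measurableSet_Icc t |>.filter_mono (by
        rw [nhdsWithin_eq_nhds.2 hnhds]))
      (hE.continuousAt hnhds)
  have hparts := intervalIntegral.integral_mul_deriv_eq_deriv_mul_of_hasDeriv_right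
    (u := fun t => (w t : ℂ)) (u' := fun t => (w' t : ℂ)) (v := P) (v' := E) hwc hPc
    (fun t ht => by
      rw [min_eq_left hab, max_eq_right hab] at ht
      exact (hw t (Ioo_subset_Icc_self ht)).ofReal_comp.hasDerivWithinAt)
    (fun t ht => (hPd t ht).hasDerivWithinAt) ⟨hw'i.1.ofReal, hw'i.2.ofReal⟩ hEi
  have hPa : P a = 0 := by simp [hP]
  have hrest : ‖∫ t in a..b, (w' t : ℂ) * P t‖ ≤ B * (w a - w b) := by
    have hFTC : ∫ t in a..b, w' t = w b - w a :=
      intervalIntegral.integral_eq_sub_of_hasDerivAt (fun t ht => hw t (hIcc ▸ ht)) hw'i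
    calc _ ≤ ∫ t in a..b, -B * w' t := by
          refine intervalIntegral.norm_integral_le_of_norm_le hab (ae_of_all _ fun t ht => ?_)
            (hw'i.const_mul _)
          have ht' : t ∈ Icc a b := Ioc_subset_Icc_self ht
          rw [norm_mul, Complex.norm_real, Real.norm_of_nonpos (hw' t ht')]
          have := mul_le_mul_of_nonneg_left (hB t ht') (neg_nonneg.2 (hw' t ht'))
          linarith
      _ = _ := by rw [intervalIntegral.integral_const_mul, hFTC]; ring
  have : ∫ t in a..b, E t * w t = ∫ t in a..b, (w t : ℂ) * E t := by
    simp_rw [mul_comm]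
  rw [this, hparts, hPa, mul_zero, sub_zero]
  calc _ ≤ w b * B + B * (w a - w b) := by
        refine (norm_sub_le _ _).trans (add_le_add ?_ hrest)
        rw [norm_mul, Complex.norm_real, Real.norm_of_nonneg hwb]
        exact mul_le_mul_of_nonneg_left (hB b (right_mem_Icc.2 hab)) hwb
    _ = B * w a := by ring

/-! ### Oscillatory integrals along the curve -/

/-- The properties of the curve `γ` on `(0, ∞)` used for the oscillatory estimates; `g₁` and `g₂`
are its first two derivatives. The quantity `h = g₂ / g₁` satisfies `t h(t) ≤ C₂` and decreases at
least as fast as `C₃ / t`; `ratio` is what makes the second derivative of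
`t ↦ a γ(t + s) - b γ(t)` change sign at most once. -/
structure IsNondegeneratePhase (γ g₁ g₂ : ℝ → ℝ) (C₂ C₃ : ℝ) : Prop where
  C₂_pos : 0 < C₂
  C₃_pos : 0 < C₃
  hasDerivAt : ∀ t, 0 < t → HasDerivAt γ (g₁ t) t
  hasDerivAt_deriv : ∀ t, 0 < t → HasDerivAt g₁ (g₂ t) t
  continuousOn_second : ContinuousOn g₂ (Ioi 0)
  pos : ∀ t, 0 < t → 0 < γ t
  deriv_pos : ∀ t, 0 < t → 0 < g₁ t
  second_pos : ∀ t, 0 < t → 0 < g₂ t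
  mul_le_comp_mul : ∀ c t, 1 ≤ c → 0 < t → c * γ t ≤ γ (c * t)
  le_mul_deriv : ∀ t, 0 < t → γ t ≤ t * g₁ t
  mul_second_le : ∀ t, 0 < t → t * g₂ t ≤ C₂ * g₁ t
  gap : ∀ s t, 0 < s → s < t → C₃ * (1 / s - 1 / t) ≤ g₂ s / g₁ s - g₂ t / g₁ t
  ratio : ∀ s, MonotoneOn (fun t => g₂ (t + s) / g₂ t) (Ioi (max 0 (-s))) ∨
    AntitoneOn (fun t => g₂ (t + s) / g₂ t) (Ioi (max 0 (-s)))

namespace IsNondegeneratePhase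

variable {γ g₁ g₂ : ℝ → ℝ} {C₂ C₃ : ℝ}

lemma le_of_le (h : IsNondegeneratePhase γ g₁ g₂ C₂ C₃) {s t : ℝ} (hs : 0 < s) (hst : s ≤ t) :
    γ s ≤ γ t := by
  have h1 := h.mul_le_comp_mul (t / s) s ((one_le_div hs).2 hst) hs
  rw [div_mul_cancel₀ _ hs.ne'] at h1
  have h2 : 1 * γ s ≤ t / s * γ s := by
    have := (h.pos s hs).le
    gcongr
    exact (one_le_div hs).2 hst
  linarith

lemma gap_abs (h : IsNondegeneratePhase γ g₁ g₂ C₂ C₃) {t s : ℝ} (ht : 0 < t) (hts : 0 < t + s) :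
    C₃ * |s| / (t * (t + s)) ≤ |g₂ t / g₁ t - g₂ (t + s) / g₁ (t + s)| := by
  rcases lt_trichotomy s 0 with hs | rfl | hs
  · have h1 := h.gap (t + s) t hts (by linarith)
    rw [abs_of_neg hs, abs_sub_comm]
    refine le_trans (le_of_eq ?_) (h1.trans (le_abs_self _))
    field_simp
    ring
  · simp
  · have h1 := h.gap t (t + s) ht (by linarith)
    rw [abs_of_pos hs]
    refine le_trans (le_of_eq ?_) (h1.trans (le_abs_self _))
    field_simp
    ring

/-- The first two derivatives of `t ↦ u γ(t + s) - v γ(t)` are not small simultaneously: they are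
linear combinations of `u g₁(t + s)` and `v g₁(t)` whose determinant is a difference of values of
`g₂ / g₁`. -/
lemma phase_derivs_not_small (h : IsNondegeneratePhase γ g₁ g₂ C₂ C₃) {u v R S s t L η : ℝ}
    (hS : 0 < S) (hSR : S ≤ R) (hL : 0 ≤ L) (hv : L ≤ |v| * γ S) (hη : 0 ≤ η) (hs : η * R ≤ |s|)
    (ht1 : S ≤ t) (ht2 : t ≤ 2 * S) (hts1 : R ≤ t + s) (hts2 : t + s ≤ 2 * R) :
    C₃ * L * η / (16 * max 1 C₂) / S ≤ |u * g₁ (t + s) - v * g₁ t| ∨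
      C₃ * L * η / (16 * max 1 C₂) / S ^ 2 ≤ |u * g₂ (t + s) - v * g₂ t| := by
  have hC₂ := h.C₂_pos
  have hC₃ := h.C₃_pos
  have ht : 0 < t := hS.trans_le ht1
  have hR : 0 < R := hS.trans_le hSR
  have hts : 0 < t + s := hR.trans_le hts1
  set D := max 1 C₂ with hD
  have hD1 : 1 ≤ D := le_max_left _ _
  have hD2 : C₂ ≤ D := le_max_right _ _
  set X := C₃ * L * η / (16 * D) with hX
  set φ := u * g₁ (t + s) - v * g₁ t with hφ
  set ψ := u * g₂ (t + s) - v * g₂ t with hψ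
  by_contra! hcon
  have hg := h.deriv_pos t ht
  have hg' := h.deriv_pos (t + s) hts
  have hident : v * g₁ t * (g₂ t / g₁ t - g₂ (t + s) / g₁ (t + s)) =
      φ * (g₂ (t + s) / g₁ (t + s)) - ψ := by
    rw [hφ, hψ]
    field_simp
    ring
  have hh : g₂ (t + s) / g₁ (t + s) ≤ C₂ / S := by
    rw [div_le_div_iff₀ hg' hS]
    calc g₂ (t + s) * S ≤ g₂ (t + s) * (t + s) := by
          have := (h.second_pos (t + s) hts).le
          gcongr
          linarith
      _ ≤ C₂ * g₁ (t + s) := by rw [mul_comm]; exact h.mul_second_le _ hts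
  have hh0 : 0 ≤ g₂ (t + s) / g₁ (t + s) := div_nonneg (h.second_pos _ hts).le hg'.le
  have hup : |v * g₁ t| * |g₂ t / g₁ t - g₂ (t + s) / g₁ (t + s)| ≤ |φ| * (C₂ / S) + |ψ| := by
    rw [← abs_mul, hident]
    refine (abs_sub _ _).trans ?_
    rw [abs_mul, abs_of_nonneg hh0]
    gcongr
  have hb : L / t ≤ |v * g₁ t| := by
    rw [div_le_iff₀ ht, abs_mul, abs_of_pos hg]
    calc L ≤ |v| * γ S := hv
      _ ≤ |v| * (t * g₁ t) := by
          gcongr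
          exact (h.le_of_le hS ht1).trans (h.le_mul_deriv t ht)
      _ = |v| * g₁ t * t := by ring
  have hlow : 2 * D * X / S ^ 2 ≤ L / t * (C₃ * |s| / (t * (t + s))) := by
    have e1 : 2 * D * X / S ^ 2 = L / (2 * S) * (C₃ * (η * R) / ((2 * S) * (2 * R))) := by
      rw [hX]
      field_simp
      ring
    rw [e1]
    gcongr
  have hlow2 : L / t * (C₃ * |s| / (t * (t + s))) ≤
      |v * g₁ t| * |g₂ t / g₁ t - g₂ (t + s) / g₁ (t + s)| := by
    gcongr
    exact h.gap_abs ht hts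
  have hX0 : 0 ≤ X := by positivity
  have hlt : |φ| * (C₂ / S) + |ψ| < 2 * D * X / S ^ 2 := by
    have e2 : |φ| * (C₂ / S) ≤ X / S * (D / S) := by
      gcongr
      exact hcon.1.le
    have e3 : X / S * (D / S) = D * X / S ^ 2 := by field_simp
    have e4 : X / S ^ 2 ≤ D * X / S ^ 2 := by
      gcongr
      exact le_mul_of_one_le_left hX0 hD1
    have e5 : 2 * D * X / S ^ 2 = D * X / S ^ 2 + D * X / S ^ 2 := by ring
    linarith [hcon.2]
  linarith

lemma second_phase_sign (h : IsNondegeneratePhase γ g₁ g₂ C₂ C₃) (u v s : ℝ) {a b : ℝ}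
    (ha : 0 < a) (has : 0 < a + s) :
    (∀ t t', a ≤ t → t ≤ t' → t' ≤ b → 0 ≤ u * g₂ (t + s) - v * g₂ t →
        0 ≤ u * g₂ (t' + s) - v * g₂ t') ∨
      ∀ t t', a ≤ t → t ≤ t' → t' ≤ b → u * g₂ (t + s) - v * g₂ t ≤ 0 →
        u * g₂ (t' + s) - v * g₂ t' ≤ 0 := by
  have hmem : ∀ t, a ≤ t → t ∈ Ioi (max 0 (-s)) := fun t ht =>
    max_lt (ha.trans_le ht) (by linarith)
  have hfac : ∀ t, a ≤ t → u * g₂ (t + s) - v * g₂ t = g₂ t * (u * (g₂ (t + s) / g₂ t) - v) :=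
    fun t ht => by
      have := (h.second_pos t (ha.trans_le ht)).ne'
      field_simp
  have hnn : ∀ t, a ≤ t → (0 ≤ u * g₂ (t + s) - v * g₂ t ↔ v ≤ u * (g₂ (t + s) / g₂ t)) :=
    fun t ht => by
      rw [hfac t ht, mul_nonneg_iff_of_pos_left (h.second_pos t (ha.trans_le ht)), sub_nonneg]
  have hnp : ∀ t, a ≤ t → (u * g₂ (t + s) - v * g₂ t ≤ 0 ↔ u * (g₂ (t + s) / g₂ t) ≤ v) :=
    fun t ht => by
      rw [hfac t ht, ← neg_nonneg, ← mul_neg,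
        mul_nonneg_iff_of_pos_left (h.second_pos t (ha.trans_le ht)), neg_nonneg, sub_nonpos]
  rcases h.ratio s with hm | hm
  · rcases le_total 0 u with hu | hu
    · left
      intro t t' ht htt' _ h0
      rw [hnn t ht] at h0
      rw [hnn t' (ht.trans htt')]
      exact h0.trans (mul_le_mul_of_nonneg_left (hm (hmem t ht) (hmem t' (ht.trans htt')) htt') hu)
    · right
      intro t t' ht htt' _ h0
      rw [hnp t ht] at h0
      rw [hnp t' (ht.trans htt')]
      exact (mul_le_mul_of_nonpos_left
        (hm (hmem t ht) (hmem t' (ht.trans htt')) htt') hu).trans h0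
  · rcases le_total 0 u with hu | hu
    · right
      intro t t' ht htt' _ h0
      rw [hnp t ht] at h0
      rw [hnp t' (ht.trans htt')]
      exact (mul_le_mul_of_nonneg_left (hm (hmem t ht) (hmem t' (ht.trans htt')) htt') hu).trans h0
    · left
      intro t t' ht htt' _ h0
      rw [hnn t ht] at h0
      rw [hnn t' (ht.trans htt')]
      exact h0.trans (mul_le_mul_of_nonpos_left
        (hm (hmem t ht) (hmem t' (ht.trans htt')) htt') hu)

lemma norm_integral_exp_phase_le (h : IsNondegeneratePhase γ g₁ g₂ C₂ C₃) {u v R S s a b L η : ℝ}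
    (hS : 0 < S) (hSR : S ≤ R) (hL : 0 < L) (hv : L ≤ |v| * γ S) (hη : 0 < η) (hs : η * R ≤ |s|)
    (hab : a ≤ b) (ha : S ≤ a) (hb : b ≤ 2 * S) (has : R ≤ a + s) (hbs : b + s ≤ 2 * R) :
    ‖∫ t in a..b, Complex.exp (Complex.I * ((u * γ (t + s) - v * γ t : ℝ) : ℂ))‖ ≤
      20 * S / √(C₃ * L * η / (16 * max 1 C₂)) := by
  have hC₂ := h.C₂_pos
  have hC₃ := h.C₃_pos
  have hR : 0 < R := hS.trans_le hSR
  set X := C₃ * L * η / (16 * max 1 C₂) with hX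
  have hX0 : 0 < X := by positivity
  have hsq : 0 < √X := Real.sqrt_pos.2 hX0
  rcases lt_or_ge X 1 with hX1 | hX1
  · refine (norm_integral_exp_le_length _ hab).trans ?_
    rw [le_div_iff₀ hsq]
    have h1 : √X ≤ 1 := Real.sqrt_le_one.2 hX1.le
    have h2 : b - a ≤ S := by linarith
    nlinarith
  have hpos : ∀ t ∈ Icc a b, 0 < t ∧ 0 < t + s := fun t ht => by
    constructor <;> linarith [ht.1]
  have hshift : ∀ (F F' : ℝ → ℝ), (∀ t, 0 < t → HasDerivAt F (F' t) t) →
      ∀ t ∈ Icc a b, HasDerivAt (fun t => u * F (t + s) - v * F t)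
        (u * F' (t + s) - v * F' t) t := fun F F' hF t ht => by
    have h1 := (hF (t + s) (hpos t ht).2).comp_add_const t s
    exact (h1.const_mul u).sub ((hF t (hpos t ht).1).const_mul v)
  have := norm_integral_exp_le_of_one_sign_change (m := √X / S)
    (Φ := fun t => u * γ (t + s) - v * γ t) (φ := fun t => u * g₁ (t + s) - v * g₁ t)
    (ψ := fun t => u * g₂ (t + s) - v * g₂ t) hab (by positivity)
    (hshift γ g₁ h.hasDerivAt) (hshift g₁ g₂ h.hasDerivAt_deriv) ?_
    (h.second_phase_sign u v s (hS.trans_le ha) (by linarith)) ?_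
  · refine this.trans (le_of_eq ?_)
    field_simp
  · have c1 : ContinuousOn (fun t => g₂ (t + s)) (Icc a b) :=
      h.continuousOn_second.comp (by fun_prop) fun t ht => (hpos t ht).2
    have c2 : ContinuousOn g₂ (Icc a b) :=
      h.continuousOn_second.mono fun t ht => (hpos t ht).1
    exact (c1.const_mul u).sub (c2.const_mul v)
  · intro t ht
    rcases h.phase_derivs_not_small (u := u) hS hSR hL.le hv hη.le hs (ha.trans ht.1)
      (ht.2.trans hb) (by linarith [ht.1]) (by linarith [ht.2]) with h1 | h1
    · left
      refine le_trans ?_ h1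
      gcongr
      exact Real.sqrt_le_iff.2 ⟨hX0.le, by nlinarith⟩
    · right
      rwa [div_pow, Real.sq_sqrt hX0.le]

/-- The kernel of `T T*` for a single pair of points, `s` being their difference. The amplitude
is decreasing. -/
lemma norm_integral_kernel_le (h : IsNondegeneratePhase γ g₁ g₂ C₂ C₃) {u v R S s L η : ℝ}
    (hS : 0 < S) (hSR : S ≤ R) (hL : 0 < L) (hv : L ≤ |v| * γ S) (hη : 0 < η)
    (hs : η * R ≤ |s|) :
    ‖∫ t in Ioc S (2 * S) ∩ Ioc (R - s) (2 * R - s),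
      Complex.exp (Complex.I * ((u * γ (t + s) - v * γ t : ℝ) : ℂ)) *
        ((1 / ((t + s) * t) : ℝ) : ℂ)‖ ≤ 20 / √(C₃ * L * η / (16 * max 1 C₂)) / R := by
  have hC₂ := h.C₂_pos
  have hC₃ := h.C₃_pos
  have hR : 0 < R := hS.trans_le hSR
  rw [Ioc_inter_Ioc]
  set a := max S (R - s)
  set b := min (2 * S) (2 * R - s)
  rcases lt_or_ge b a with hab | hab
  · rw [Ioc_eq_empty (not_lt.2 hab.le), setIntegral_empty, norm_zero]
    positivity
  have ha1 : S ≤ a := le_max_left _ _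
  have ha2 : R ≤ a + s := by have := le_max_right S (R - s); linarith
  have hb1 : b ≤ 2 * S := min_le_left _ _
  have hb2 : b + s ≤ 2 * R := by have := min_le_right (2 * S) (2 * R - s); linarith
  have hpos : ∀ t ∈ Icc a b, 0 < t ∧ 0 < t + s := fun t ht => by
    constructor <;> linarith [ht.1]
  have hγc : ∀ t ∈ Icc a b, ContinuousWithinAt γ (Icc a b) t := fun t ht =>
    (h.hasDerivAt t (hpos t ht).1).continuousAt.continuousWithinAt
  have hγc' : ∀ t ∈ Icc a b, ContinuousWithinAt (fun t => γ (t + s)) (Icc a b) t := fun t ht =>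
    ((h.hasDerivAt (t + s) (hpos t ht).2).comp_add_const t s).continuousAt.continuousWithinAt
  have c1 : ContinuousOn γ (Icc a b) := hγc
  have c2 : ContinuousOn (fun t => γ (t + s)) (Icc a b) := hγc'
  have hEc : ContinuousOn (fun t => Complex.exp (Complex.I *
      ((u * γ (t + s) - v * γ t : ℝ) : ℂ))) (Icc a b) :=
    ((Complex.continuous_ofReal.comp_continuousOn ((c2.const_mul u).sub (c1.const_mul v))).const_mul
      Complex.I).cexp
  rw [← intervalIntegral.integral_of_le hab]
  have := norm_integral_mul_le_of_antitone (a := a) (b := b)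
    (E := fun t => Complex.exp (Complex.I * ((u * γ (t + s) - v * γ t : ℝ) : ℂ)))
    (w := fun t => 1 / ((t + s) * t)) (w' := fun t => -(1 * t + (t + s) * 1) / ((t + s) * t) ^ 2)
    (B := 20 * S / √(C₃ * L * η / (16 * max 1 C₂))) hab hEc (fun t ht => ?_) ?_
    (fun t ht => ?_) ?_ (fun x hx => ?_)
  · refine this.trans ?_
    calc _ ≤ 20 * S / √(C₃ * L * η / (16 * max 1 C₂)) * (1 / (R * S)) := by
          have : 0 ≤ a + s := hR.le.trans ha2
          gcongr
      _ = _ := by field_simp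
  · have h1 : (t + s) * t ≠ 0 := mul_ne_zero (hpos t ht).2.ne' (hpos t ht).1.ne'
    have h2 : HasDerivAt (fun t => (t + s) * t) (1 * t + (t + s) * 1) t :=
      ((hasDerivAt_id t).add_const s).mul (hasDerivAt_id t)
    simp only [one_div]
    exact h2.fun_inv h1
  · refine ContinuousOn.div (by fun_prop) (by fun_prop) fun t ht => ?_
    exact pow_ne_zero 2 (mul_ne_zero (hpos t ht).2.ne' (hpos t ht).1.ne')
  · have := (hpos t ht).1
    have := (hpos t ht).2
    rw [neg_div, neg_nonpos]
    positivity
  · have := (hpos b (right_mem_Icc.2 hab)).1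
    have := (hpos b (right_mem_Icc.2 hab)).2
    positivity
  · exact h.norm_integral_exp_phase_le hS hSR hL hv hη hs hx.1 ha1 (hx.2.trans hb1) ha2
      (by linarith [hx.2])

end IsNondegeneratePhase

/-! ### The `L²` estimate by the `T T*` method -/

/-- The `T T*` method for an integral operator with kernel `a`, tested on a pair `f`, `g`. -/
lemma enorm_integral_mul_sq_le_of_tt_star {a : ℝ → ℝ → ℂ} (ha : Measurable (Function.uncurry a))
    {f g : ℝ → ℂ} (hf : Measurable f) (hg : Measurable g) {D : ℝ≥0∞}
    (h₁ : ∫⁻ x, ‖g x‖ₑ * ∫⁻ z, ‖a x z‖ₑ * ‖f z‖ₑ ≠ ∞)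
    (h₂ : ∫⁻ x, ∫⁻ y, ‖g x‖ₑ * ‖g y‖ₑ * ∫⁻ z, ‖a x z‖ₑ * ‖a y z‖ₑ ≠ ∞)
    (h₃ : ∫⁻ x, ∫⁻ y, ‖g x‖ₑ * ‖g y‖ₑ * ‖∫ z, a x z * (starRingEnd ℂ) (a y z)‖ₑ ≤ D) :
    ‖∫ x, (∫ z, a x z * f z) * g x‖ₑ ^ (2 : ℝ) ≤ D * ∫⁻ z, ‖f z‖ₑ ^ (2 : ℝ) := by
  have ha' : ∀ {α : Type} [MeasurableSpace α] {i j : α → ℝ}, Measurable i → Measurable j →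
      Measurable fun s => a (i s) (j s) := fun hi hj => ha.comp (hi.prodMk hj)
  have hconj : Measurable (starRingEnd ℂ : ℂ → ℂ) := Complex.continuous_conj.measurable
  set w : ℝ → ℂ := fun z => ∫ x, a x z * g x with hw
  have hwm : Measurable w := by
    have : Measurable fun s : ℝ × ℝ => a s.2 s.1 * g s.2 :=
      (ha' measurable_snd measurable_fst).mul (hg.comp measurable_snd)
    exact this.stronglyMeasurable.integral_prod_right.measurable
  -- `⟨T f, conj g⟩ = ⟨f, w⟩`
  have hswap : ∫ x, (∫ z, a x z * f z) * g x = ∫ z, f z * w z := by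
    have hm : Measurable fun s : ℝ × ℝ => a s.1 s.2 * f s.2 * g s.1 :=
      ((ha' measurable_fst measurable_snd).mul (hf.comp measurable_snd)).mul
        (hg.comp measurable_fst)
    have hint : Integrable (fun s : ℝ × ℝ => a s.1 s.2 * f s.2 * g s.1)
        ((volume : Measure ℝ).prod volume) := by
      refine ⟨hm.aestronglyMeasurable, ?_⟩
      rw [hasFiniteIntegral_iff_enorm, lintegral_prod _ hm.enorm.aemeasurable]
      refine lt_of_le_of_lt (le_of_eq (lintegral_congr fun x => ?_)) h₁.lt_top
      have : Measurable fun z => ‖a x z‖ₑ * ‖f z‖ₑ :=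
        ((ha' measurable_const measurable_id).enorm).mul hf.enorm
      rw [← lintegral_const_mul _ this]
      refine lintegral_congr fun z => ?_
      rw [enorm_mul, enorm_mul, mul_comm]
    calc _ = ∫ x, ∫ z, a x z * f z * g x :=
          integral_congr_ae (ae_of_all _ fun x => (integral_mul_const _ _).symm)
      _ = ∫ z, ∫ x, a x z * f z * g x := integral_integral_swap hint
      _ = _ := by
          refine integral_congr_ae (ae_of_all _ fun z => ?_)
          simp only [hw]
          rw [← integral_const_mul]
          refine integral_congr_ae (ae_of_all _ fun x => ?_)
          simp only
          ring
  have hww : ∫⁻ z, ‖w z‖ₑ ^ (2 : ℝ) ≤ D := by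
    set H : ℝ → ℝ × ℝ → ℂ := fun z s => (a s.1 z * g s.1) * (starRingEnd ℂ) (a s.2 z * g s.2)
      with hH
    have hHm : Measurable (Function.uncurry H) := by
      refine Measurable.mul ?_ (hconj.comp ?_)
      · exact (ha' (measurable_fst.comp measurable_snd) measurable_fst).mul
          (hg.comp (measurable_fst.comp measurable_snd))
      · exact (ha' (measurable_snd.comp measurable_snd) measurable_fst).mul
          (hg.comp (measurable_snd.comp measurable_snd))
    have hHint : Integrable (Function.uncurry H)
        ((volume : Measure ℝ).prod ((volume : Measure ℝ).prod volume)) := by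
      refine ⟨hHm.aestronglyMeasurable, ?_⟩
      rw [hasFiniteIntegral_iff_enorm, lintegral_prod_symm _ hHm.enorm.aemeasurable,
        lintegral_prod _ (Measurable.aemeasurable ?_)]
      · refine lt_of_le_of_lt (le_of_eq (lintegral_congr fun x => lintegral_congr fun y => ?_))
          h₂.lt_top
        have : Measurable fun z => ‖a x z‖ₑ * ‖a y z‖ₑ :=
          ((ha' measurable_const measurable_id).enorm).mul
            (ha' measurable_const measurable_id).enorm
        rw [← lintegral_const_mul _ this]
        refine lintegral_congr fun z => ?_
        simp only [Function.uncurry, hH, ← ofReal_norm, RCLike.norm_conj, norm_mul]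
        rw [← ENNReal.ofReal_mul (by positivity), ← ENNReal.ofReal_mul (by positivity),
          ← ENNReal.ofReal_mul (by positivity)]
        congr 1
        ring
      · exact (hHm.enorm.comp measurable_swap).lintegral_prod_right'
    have hin : ∀ z, w z * (starRingEnd ℂ) (w z) = ∫ s, H z s ∂((volume : Measure ℝ).prod volume) :=
      fun z => by
        simp only [hH, map_mul]
        rw [integral_prod_mul (fun x => a x z * g x)
          (fun y => (starRingEnd ℂ) (a y z) * (starRingEnd ℂ) (g y))]
        simp only [← map_mul]
        rw [integral_conj]
    have hnorm : ∀ z, w z * (starRingEnd ℂ) (w z) = ((‖w z‖ ^ 2 : ℝ) : ℂ) := fun z => by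
      rw [Complex.mul_conj, Complex.normSq_eq_norm_sq]
    have hwint : Integrable fun z => ‖w z‖ ^ 2 := by
      have h1 : Integrable fun z => w z * (starRingEnd ℂ) (w z) := by
        simp only [hin]
        exact hHint.integral_prod_left
      simp only [hnorm] at h1
      simpa using h1.norm
    have heq : ∫⁻ z, ‖w z‖ₑ ^ (2 : ℝ) = ‖∫ z, w z * (starRingEnd ℂ) (w z)‖ₑ := by
      simp only [hnorm]
      rw [integral_complex_ofReal, ← ofReal_norm, Complex.norm_real,
        Real.norm_of_nonneg (integral_nonneg fun z => by positivity),
        ofReal_integral_eq_lintegral_ofReal hwint (ae_of_all _ fun z => by positivity)]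
      refine lintegral_congr fun z => ?_
      rw [← ofReal_norm, ENNReal.ofReal_rpow_of_nonneg (norm_nonneg _) (by norm_num),
        Real.rpow_two]
    rw [heq]
    simp only [hin]
    rw [integral_integral_swap hHint]
    refine (enorm_integral_le_lintegral_enorm _).trans ?_
    have hKm : Measurable fun s : ℝ × ℝ => ∫ z, H z s := by
      have : Measurable fun q : (ℝ × ℝ) × ℝ => H q.2 q.1 := hHm.comp measurable_swap
      exact this.stronglyMeasurable.integral_prod_right'.measurable
    rw [lintegral_prod _ hKm.enorm.aemeasurable]
    refine le_trans (le_of_eq (lintegral_congr fun x => lintegral_congr fun y => ?_)) h₃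
    have : ∫ z, H z (x, y) = g x * (starRingEnd ℂ) (g y) *
        ∫ z, a x z * (starRingEnd ℂ) (a y z) := by
      rw [← integral_const_mul]
      refine integral_congr_ae (ae_of_all _ fun z => ?_)
      simp only [hH, map_mul]
      ring
    rw [this, enorm_mul, enorm_mul]
    congr 2
    rw [← ofReal_norm, RCLike.norm_conj, ofReal_norm]
  rw [hswap]
  have hH := ENNReal.lintegral_mul_le_Lp_mul_Lq volume Real.HolderConjugate.two_two
    hf.enorm.aemeasurable hwm.enorm.aemeasurable
  calc ‖∫ z, f z * w z‖ₑ ^ (2 : ℝ)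
      ≤ (∫⁻ z, ‖f z‖ₑ * ‖w z‖ₑ) ^ (2 : ℝ) := by
        gcongr
        refine (enorm_integral_le_lintegral_enorm _).trans (le_of_eq ?_)
        simp only [enorm_mul]
    _ ≤ ((∫⁻ z, ‖f z‖ₑ ^ (2 : ℝ)) ^ (1 / (2 : ℝ)) *
          (∫⁻ z, ‖w z‖ₑ ^ (2 : ℝ)) ^ (1 / (2 : ℝ))) ^ (2 : ℝ) := by
        gcongr
        exact hH
    _ = (∫⁻ z, ‖f z‖ₑ ^ (2 : ℝ)) * ∫⁻ z, ‖w z‖ₑ ^ (2 : ℝ) := by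
        rw [ENNReal.mul_rpow_of_nonneg _ _ (by norm_num), ← ENNReal.rpow_mul, ← ENNReal.rpow_mul]
        norm_num
    _ ≤ _ := by
        rw [mul_comm]
        gcongr

/-- The kernel of the piece of the operator where `R x < x - z ≤ 2 R x`. -/
noncomputable def curveKernel (γ u R : ℝ → ℝ) (x z : ℝ) : ℂ :=
  (Ioc (R x) (2 * R x)).indicator
    (fun t => Complex.exp (Complex.I * ((u x * γ t : ℝ) : ℂ)) * ((1 / t : ℝ) : ℂ)) (x - z)

/-- The piece of the operator at the scale `R x`, which may depend on the point `x`. -/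
noncomputable def curvePiece (γ u R : ℝ → ℝ) (f : ℝ → ℂ) (x : ℝ) : ℂ :=
  ∫ z, curveKernel γ u R x z * f z

lemma measurable_curveKernel {γ u R : ℝ → ℝ} (hγ : Measurable γ) (hu : Measurable u)
    (hR : Measurable R) : Measurable (Function.uncurry (curveKernel γ u R)) := by
  have hset : MeasurableSet {s : ℝ × ℝ | s.1 - s.2 ∈ Ioc (R s.1) (2 * R s.1)} :=
    (measurableSet_lt (f := fun s : ℝ × ℝ => R s.1) (g := fun s => s.1 - s.2)
      (by fun_prop) (by fun_prop)).inter
      (measurableSet_le (f := fun s : ℝ × ℝ => s.1 - s.2) (g := fun s => 2 * R s.1)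
        (by fun_prop) (by fun_prop))
  have : Function.uncurry (curveKernel γ u R) =
      {s : ℝ × ℝ | s.1 - s.2 ∈ Ioc (R s.1) (2 * R s.1)}.indicator fun s =>
        Complex.exp (Complex.I * ((u s.1 * γ (s.1 - s.2) : ℝ) : ℂ)) *
          ((1 / (s.1 - s.2) : ℝ) : ℂ) := by
    funext s
    simp only [Function.uncurry, curveKernel, indicator, mem_ofPred_eq]
  rw [this]
  exact Measurable.indicator (by fun_prop) hset

lemma measurable_curvePiece {γ u R : ℝ → ℝ} (hγ : Measurable γ) (hu : Measurable u)
    (hR : Measurable R) {f : ℝ → ℂ} (hf : Measurable f) : Measurable (curvePiece γ u R f) := by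
  have : Measurable fun s : ℝ × ℝ => curveKernel γ u R s.1 s.2 * f s.2 :=
    (measurable_curveKernel hγ hu hR).mul (hf.comp measurable_snd)
  exact this.stronglyMeasurable.integral_prod_right.measurable

lemma enorm_curveKernel_le (γ u : ℝ → ℝ) {R : ℝ → ℝ} (hR : ∀ x, 0 < R x) (x z : ℝ) :
    ‖curveKernel γ u R x z‖ₑ ≤
      (Ioc (R x) (2 * R x)).indicator (fun _ => ENNReal.ofReal (1 / R x)) (x - z) := by
  by_cases h : x - z ∈ Ioc (R x) (2 * R x)
  · have hR' := hR x
    rw [curveKernel, indicator_of_mem h, indicator_of_mem h, ← ofReal_norm, norm_mul,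
      norm_exp_I_mul_ofReal, one_mul, Complex.norm_real,
      Real.norm_of_nonneg (one_div_nonneg.2 (hR'.trans h.1).le)]
    refine ENNReal.ofReal_le_ofReal ?_
    gcongr
    exact h.1.le
  · rw [curveKernel, indicator_of_notMem h, indicator_of_notMem h, enorm_zero]

lemma lintegral_curveKernel_mul_le (γ u : ℝ → ℝ) {R : ℝ → ℝ} (hR : ∀ x, 0 < R x) (F : ℝ → ℝ≥0∞)
    (x : ℝ) : ∫⁻ z, ‖curveKernel γ u R x z‖ₑ * F z ≤ 6 * hlMaximal F x := by
  have hR' := hR x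
  calc ∫⁻ z, ‖curveKernel γ u R x z‖ₑ * F z
      ≤ ∫⁻ z, ENNReal.ofReal (1 / R x) * (Metric.ball x (3 * R x)).indicator F z := by
        refine lintegral_mono fun z => ?_
        refine (mul_le_mul_left (enorm_curveKernel_le γ u hR x z) _).trans ?_
        by_cases h : x - z ∈ Ioc (R x) (2 * R x)
        · have hz : z ∈ Metric.ball x (3 * R x) := by
            rw [Metric.mem_ball, dist_comm, Real.dist_eq, abs_of_pos (hR'.trans h.1)]
            linarith [h.2]
          rw [indicator_of_mem h, indicator_of_mem hz]
        · rw [indicator_of_notMem h, zero_mul]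
          exact zero_le
    _ = ENNReal.ofReal (1 / R x) * ∫⁻ z in Metric.ball x (3 * R x), F z := by
        rw [lintegral_const_mul' _ _ ENNReal.ofReal_ne_top,
          lintegral_indicator Metric.isOpen_ball.measurableSet]
    _ ≤ ENNReal.ofReal (1 / R x) * (ENNReal.ofReal (2 * (3 * R x)) * hlMaximal F x) := by
        gcongr
        exact lintegral_ball_le_hlMaximal F x (by positivity)
    _ = 6 * hlMaximal F x := by
        rw [← mul_assoc, ← ENNReal.ofReal_mul (by positivity)]
        congr 1
        rw [show 1 / R x * (2 * (3 * R x)) = 6 by field_simp; norm_num]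
        norm_num

lemma enorm_curvePiece_le (γ u : ℝ → ℝ) {R : ℝ → ℝ} (hR : ∀ x, 0 < R x) (f : ℝ → ℂ) (x : ℝ) :
    ‖curvePiece γ u R f x‖ₑ ≤ 6 * hlMaximal (fun z => ‖f z‖ₑ) x := by
  refine le_trans ?_ (lintegral_curveKernel_mul_le γ u hR _ x)
  refine (enorm_integral_le_lintegral_enorm _).trans (le_of_eq ?_)
  simp only [enorm_mul]

lemma lintegral_curveKernel_mul_curveKernel_le (γ u : ℝ → ℝ) {R : ℝ → ℝ} (hR : ∀ x, 0 < R x)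
    {x y : ℝ} (hxy : R y ≤ R x) :
    ∫⁻ z, ‖curveKernel γ u R x z‖ₑ * ‖curveKernel γ u R y z‖ₑ ≤
      (Metric.ball x (2 * R x)).indicator (fun _ => ENNReal.ofReal (1 / R x)) y := by
  have hR' := hR x
  have hRy := hR y
  have hm : Measurable fun z => (Ioc (R y) (2 * R y)).indicator
      (fun _ => ENNReal.ofReal (1 / R y)) (y - z) :=
    (measurable_const.indicator measurableSet_Ioc).comp (by fun_prop)
  calc _ ≤ ∫⁻ z, (Metric.ball x (2 * R x)).indicator (fun _ => ENNReal.ofReal (1 / R x)) y *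
        (Ioc (R y) (2 * R y)).indicator (fun _ => ENNReal.ofReal (1 / R y)) (y - z) := by
        refine lintegral_mono fun z => ?_
        by_cases h : y - z ∈ Ioc (R y) (2 * R y)
        · by_cases h' : x - z ∈ Ioc (R x) (2 * R x)
          · have hz : y ∈ Metric.ball x (2 * R x) := by
              rw [Metric.mem_ball, Real.dist_eq, abs_lt]
              constructor <;> linarith [h.1, h.2, h'.1, h'.2]
            refine mul_le_mul' ?_ (enorm_curveKernel_le γ u hR y z)
            refine (enorm_curveKernel_le γ u hR x z).trans ?_
            rw [indicator_of_mem h', indicator_of_mem hz]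
          · rw [curveKernel, indicator_of_notMem h', enorm_zero, zero_mul]
            exact zero_le
        · rw [curveKernel, curveKernel, indicator_of_notMem h, enorm_zero, mul_zero]
          exact zero_le
    _ = (Metric.ball x (2 * R x)).indicator (fun _ => ENNReal.ofReal (1 / R x)) y *
          (ENNReal.ofReal (1 / R y) * ENNReal.ofReal (R y)) := by
        rw [lintegral_const_mul _ hm,
          lintegral_sub_left_eq_self (fun z => (Ioc (R y) (2 * R y)).indicator
            (fun _ => ENNReal.ofReal (1 / R y)) z) y,
          lintegral_indicator measurableSet_Ioc, setLIntegral_const, Real.volume_Ioc]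
        congr 3
        ring
    _ = _ := by
        rw [← ENNReal.ofReal_mul (by positivity), one_div_mul_cancel hRy.ne', ENNReal.ofReal_one,
          mul_one]

lemma integral_curveKernel_mul_conj (γ u R : ℝ → ℝ) (x y : ℝ) :
    ∫ z, curveKernel γ u R x z * (starRingEnd ℂ) (curveKernel γ u R y z) =
      ∫ t in Ioc (R y) (2 * R y) ∩ Ioc (R x - (x - y)) (2 * R x - (x - y)),
        Complex.exp (Complex.I * ((u x * γ (t + (x - y)) - u y * γ t : ℝ) : ℂ)) *
          ((1 / ((t + (x - y)) * t) : ℝ) : ℂ) := by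
  rw [← integral_sub_left_eq_self _ volume y,
    ← integral_indicator (measurableSet_Ioc.inter measurableSet_Ioc)]
  refine integral_congr_ae (ae_of_all _ fun t => ?_)
  simp only [curveKernel, sub_sub_cancel, show x - (y - t) = t + (x - y) by ring]
  by_cases h1 : t ∈ Ioc (R y) (2 * R y)
  · by_cases h2 : t + (x - y) ∈ Ioc (R x) (2 * R x)
    · have h3 : t ∈ Ioc (R x - (x - y)) (2 * R x - (x - y)) := by
        constructor <;> linarith [h2.1, h2.2]
      rw [indicator_of_mem h1, indicator_of_mem h2,
        indicator_of_mem (show t ∈ Ioc (R y) (2 * R y) ∩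
          Ioc (R x - (x - y)) (2 * R x - (x - y)) from ⟨h1, h3⟩), map_mul,
        ← Complex.exp_conj, map_mul, Complex.conj_I, Complex.conj_ofReal, Complex.conj_ofReal]
      have e : Complex.exp (Complex.I * ((u x * γ (t + (x - y)) - u y * γ t : ℝ) : ℂ)) =
          Complex.exp (Complex.I * ((u x * γ (t + (x - y)) : ℝ) : ℂ)) *
            Complex.exp (-Complex.I * ((u y * γ t : ℝ) : ℂ)) := by
        rw [← Complex.exp_add]
        congr 1
        push_cast
        ring
      have e2 : 1 / ((t + (x - y)) * t) = 1 / (t + (x - y)) * (1 / t) := by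
        rw [one_div_mul_one_div]
      rw [e, e2, Complex.ofReal_mul (1 / _)]
      ring
    · have h3 : t ∉ Ioc (R x - (x - y)) (2 * R x - (x - y)) := fun h3 =>
        h2 (by constructor <;> linarith [h3.1, h3.2])
      rw [indicator_of_notMem h2, indicator_of_notMem (show t ∉ Ioc (R y) (2 * R y) ∩
          Ioc (R x - (x - y)) (2 * R x - (x - y)) from
        fun h => h3 h.2), zero_mul]
  · rw [indicator_of_notMem h1, indicator_of_notMem (show t ∉ Ioc (R y) (2 * R y) ∩
          Ioc (R x - (x - y)) (2 * R x - (x - y)) from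
      fun h => h1 h.1), map_zero, mul_zero]

/-- The majorant of the kernel of `T T*`: small away from the diagonal by oscillation, and of small
support near the diagonal. -/
noncomputable def ttMajorant (B η : ℝ) (R : ℝ → ℝ) (x y : ℝ) : ℝ≥0∞ :=
  ENNReal.ofReal (B * η / R x) * (Metric.ball x (2 * R x)).indicator 1 y +
    ENNReal.ofReal (1 / R x) * (Metric.ball x (η * R x)).indicator 1 y

lemma measurable_indicator_ball {R : ℝ → ℝ} (hR : Measurable R) (c : ℝ) :
    Measurable fun s : ℝ × ℝ => (Metric.ball s.1 (c * R s.1)).indicator (1 : ℝ → ℝ≥0∞) s.2 := by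
  have hset : MeasurableSet {s : ℝ × ℝ | dist s.2 s.1 < c * R s.1} :=
    measurableSet_lt (by fun_prop) (by fun_prop)
  exact (measurable_one.indicator hset : Measurable
    ({s : ℝ × ℝ | dist s.2 s.1 < c * R s.1}.indicator (1 : ℝ × ℝ → ℝ≥0∞)))

lemma measurable_ttMajorant (B η : ℝ) {R : ℝ → ℝ} (hR : Measurable R) :
    Measurable fun s : ℝ × ℝ => ttMajorant B η R s.1 s.2 := by
  refine Measurable.add (Measurable.mul (by fun_prop) (measurable_indicator_ball hR 2))
    (Measurable.mul (by fun_prop) (measurable_indicator_ball hR η))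

lemma lintegral_ttMajorant_mul_le {B η : ℝ} (hB : 0 ≤ B) (hη : 0 < η) {R : ℝ → ℝ}
    (hR : ∀ x, 0 < R x) {F : ℝ → ℝ≥0∞} (hF : Measurable F) (x : ℝ) :
    ∫⁻ y, ttMajorant B η R x y * F y ≤ ENNReal.ofReal ((4 * B + 2) * η) * hlMaximal F x := by
  have hR' := hR x
  have hpiece : ∀ c r : ℝ, 0 ≤ c → 0 < r →
      ∫⁻ y, ENNReal.ofReal c * (Metric.ball x r).indicator 1 y * F y ≤
        ENNReal.ofReal (c * (2 * r)) * hlMaximal F x := by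
    intro c r hc hr
    calc _ = ENNReal.ofReal c * ∫⁻ y in Metric.ball x r, F y := by
          rw [← lintegral_indicator Metric.isOpen_ball.measurableSet,
            ← lintegral_const_mul' _ _ ENNReal.ofReal_ne_top]
          refine lintegral_congr fun y => ?_
          by_cases h : y ∈ Metric.ball x r <;> simp [indicator, h]
      _ ≤ ENNReal.ofReal c * (ENNReal.ofReal (2 * r) * hlMaximal F x) := by
          gcongr
          exact lintegral_ball_le_hlMaximal F x hr
      _ = _ := by rw [← mul_assoc, ← ENNReal.ofReal_mul hc]
  have hm : Measurable fun y => ENNReal.ofReal (B * η / R x) *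
      (Metric.ball x (2 * R x)).indicator 1 y * F y :=
    (((measurable_one.indicator Metric.isOpen_ball.measurableSet).const_mul _).mul hF)
  simp only [ttMajorant, add_mul]
  rw [lintegral_add_left hm]
  refine (add_le_add (hpiece _ _ (by positivity) (by positivity))
    (hpiece _ _ (by positivity) (by positivity))).trans (le_of_eq ?_)
  rw [← add_mul, ← ENNReal.ofReal_add (by positivity) (by positivity)]
  congr 2
  field_simp
  ring

namespace IsNondegeneratePhase

variable {γ g₁ g₂ : ℝ → ℝ} {C₂ C₃ : ℝ}

lemma enorm_integral_curveKernel_le (h : IsNondegeneratePhase γ g₁ g₂ C₂ C₃) {u R : ℝ → ℝ} {L : ℝ}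
    (hL : 1 ≤ L) (hR : ∀ x, 0 < R x) (huR : ∀ x, L ≤ |u x| * γ (R x)) {x y : ℝ}
    (hxy : R y ≤ R x) :
    ‖∫ z, curveKernel γ u R x z * (starRingEnd ℂ) (curveKernel γ u R y z)‖ₑ ≤
      ttMajorant (20 / √(C₃ / (16 * max 1 C₂))) (L ^ (-(1 / 3) : ℝ)) R x y := by
  have hC₂ := h.C₂_pos
  have hC₃ := h.C₃_pos
  have hL0 : 0 < L := by linarith
  have hR' := hR x
  set η := L ^ (-(1 / 3) : ℝ) with hη
  have hη0 : 0 < η := Real.rpow_pos_of_pos hL0 _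
  have htriv : ‖∫ z, curveKernel γ u R x z * (starRingEnd ℂ) (curveKernel γ u R y z)‖ₑ ≤
      (Metric.ball x (2 * R x)).indicator (fun _ => ENNReal.ofReal (1 / R x)) y := by
    refine (enorm_integral_le_lintegral_enorm _).trans ?_
    refine le_trans (le_of_eq ?_) (lintegral_curveKernel_mul_curveKernel_le γ u hR hxy)
    refine lintegral_congr fun z => ?_
    rw [enorm_mul]
    congr 1
    rw [← ofReal_norm, RCLike.norm_conj, ofReal_norm]
  by_cases hy2 : y ∈ Metric.ball x (2 * R x)
  swap
  · rw [indicator_of_notMem hy2] at htriv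
    exact htriv.trans zero_le
  rw [indicator_of_mem hy2] at htriv
  by_cases hyη : y ∈ Metric.ball x (η * R x)
  · refine htriv.trans ?_
    rw [ttMajorant, indicator_of_mem hyη]
    simp
  · have hs : η * R x ≤ |x - y| := by
      rw [Metric.mem_ball, not_lt, dist_comm, Real.dist_eq] at hyη
      exact hyη
    have hk := h.norm_integral_kernel_le (u := u x) (hR y) hxy hL0 (huR y) hη0 hs
    rw [integral_curveKernel_mul_conj, ttMajorant, indicator_of_mem hy2, ← ofReal_norm]
    refine le_trans (ENNReal.ofReal_le_ofReal (hk.trans (le_of_eq ?_)))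
      (le_add_right (le_of_eq (mul_one _).symm))
    -- with `η = L ^ (-1/3)` one has `L η = η⁻²`
    have hLη : L * η = η⁻¹ ^ 2 := by
      have e1 : η⁻¹ = L ^ (1 / 3 : ℝ) := by rw [hη, Real.rpow_neg hL0.le, inv_inv]
      rw [e1, hη, ← Real.rpow_natCast, ← Real.rpow_mul hL0.le]
      nth_rewrite 1 [← Real.rpow_one L]
      rw [← Real.rpow_add hL0]
      norm_num
    have e3 : C₃ * L * η / (16 * max 1 C₂) = C₃ / (16 * max 1 C₂) * η⁻¹ ^ 2 := by
      rw [← hLη]; ring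
    rw [e3, Real.sqrt_mul (by positivity), Real.sqrt_sq (by positivity)]
    field_simp

/-- The `L²` bound with decay in the size `L` of the phase. -/
lemma exists_lintegral_curvePiece_sq_le (h : IsNondegeneratePhase γ g₁ g₂ C₂ C₃)
    (hγ : Measurable γ) :
    ∃ K : ℝ≥0∞, K ≠ ∞ ∧ ∀ (L : ℝ) (u R : ℝ → ℝ), 1 ≤ L → Measurable u → Measurable R →
      (∀ x, 0 < R x) → (∀ x, L ≤ |u x| * γ (R x)) → ∀ f : ℝ → ℂ, Measurable f →
      ∫⁻ x, ‖curvePiece γ u R f x‖ₑ ^ (2 : ℝ) ≤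
        K * ENNReal.ofReal (L ^ (-(1 / 3) : ℝ)) * ∫⁻ z, ‖f z‖ₑ ^ (2 : ℝ) := by
  obtain ⟨C, hC, hM⟩ := exists_lintegral_hlMaximal_rpow_le (p := 2) one_lt_two
  set B := 20 / √(C₃ / (16 * max 1 C₂)) with hB
  have hB0 : 0 ≤ B := by positivity
  refine ⟨2 * ENNReal.ofReal (4 * B + 2) * (1 + C) + 1, by finiteness, ?_⟩
  intro L u R hL hu hR hR0 huR f hf
  set η := L ^ (-(1 / 3) : ℝ) with hη
  have hη0 : 0 < η := Real.rpow_pos_of_pos (by linarith) _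
  rcases eq_or_ne (∫⁻ z, ‖f z‖ₑ ^ (2 : ℝ)) ∞ with hfin | hfin
  · rw [hfin, ENNReal.mul_top]
    · exact le_top
    · have : ENNReal.ofReal η ≠ 0 := by simpa using hη0
      exact mul_ne_zero (by simp) this
  set T := curvePiece γ u R f with hT
  have hTm : Measurable T := measurable_curvePiece hγ hu hR hf
  have ha := measurable_curveKernel hγ hu hR
  have ha' : ∀ {α : Type} [MeasurableSpace α] {i j : α → ℝ}, Measurable i → Measurable j →
      Measurable fun s => curveKernel γ u R (i s) (j s) := fun hi hj => ha.comp (hi.prodMk hj)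
  set F : ℝ → ℝ≥0∞ := fun z => ‖f z‖ₑ with hF
  set G : ℝ → ℝ≥0∞ := fun z => ‖T z‖ₑ with hG
  set I := ∫⁻ x, ‖T x‖ₑ ^ (2 : ℝ) with hI
  have hMF := hM F hf.enorm fun _ => enorm_ne_top
  have hMG := hM G hTm.enorm fun _ => enorm_ne_top
  have hsq : ∀ a b : ℝ≥0∞, a * b ≤ a ^ (2 : ℝ) + b ^ (2 : ℝ) := fun a b => by
    rw [ENNReal.rpow_two, ENNReal.rpow_two]
    rcases le_total a b with hab | hab
    · exact (mul_le_mul_left hab b).trans (by rw [sq b]; exact le_add_self)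
    · exact (mul_le_mul_right hab a).trans (by rw [sq a]; exact le_self_add)
  have hIfin : I ≠ ∞ := by
    refine ne_top_of_le_ne_top (b := 6 ^ (2 : ℝ) * (C * ∫⁻ z, ‖f z‖ₑ ^ (2 : ℝ))) (by finiteness) ?_
    calc I ≤ ∫⁻ x, 6 ^ (2 : ℝ) * hlMaximal F x ^ (2 : ℝ) := by
          refine lintegral_mono fun x => ?_
          rw [← ENNReal.mul_rpow_of_nonneg _ _ (by norm_num)]
          gcongr
          exact enorm_curvePiece_le γ u hR0 f x
      _ ≤ _ := by
          rw [lintegral_const_mul _ ((measurable_hlMaximal _).pow_const _)]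
          gcongr
  have hGM : ∫⁻ x, G x * hlMaximal G x ≤ (1 + C) * I := by
    calc _ ≤ ∫⁻ x, (G x ^ (2 : ℝ) + hlMaximal G x ^ (2 : ℝ)) :=
          lintegral_mono fun x => hsq _ _
      _ ≤ (1 + C) * I := by
          rw [lintegral_add_left (hTm.enorm.pow_const _), add_mul, one_mul]
          gcongr
  -- a symmetric double integral against a kernel dominated by `ttMajorant`
  have hsymm : ∀ (B' η' : ℝ), 0 ≤ B' → 0 < η' → ∀ k : ℝ → ℝ → ℝ≥0∞,
      (∀ x y, k x y ≤ ttMajorant B' η' R x y + ttMajorant B' η' R y x) →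
      ∫⁻ x, ∫⁻ y, G x * G y * k x y ≤
        2 * ENNReal.ofReal ((4 * B' + 2) * η') * ((1 + C) * I) := by
    intro B' η' hB' hη' k hk
    have hmaj := measurable_ttMajorant B' η' hR
    have m1 : Measurable fun s : ℝ × ℝ => G s.1 * G s.2 * ttMajorant B' η' R s.1 s.2 :=
      ((hTm.enorm.comp measurable_fst).mul (hTm.enorm.comp measurable_snd)).mul hmaj
    have m2 : Measurable fun s : ℝ × ℝ => G s.1 * G s.2 * ttMajorant B' η' R s.2 s.1 :=
      ((hTm.enorm.comp measurable_fst).mul (hTm.enorm.comp measurable_snd)).mul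
        (hmaj.comp measurable_swap)
    have i1 : ∫⁻ x, ∫⁻ y, G x * G y * ttMajorant B' η' R x y ≤
        ENNReal.ofReal ((4 * B' + 2) * η') * ((1 + C) * I) := by
      calc _ ≤ ∫⁻ x, ENNReal.ofReal ((4 * B' + 2) * η') * (G x * hlMaximal G x) := by
            refine lintegral_mono fun x => ?_
            have m3 : Measurable fun y => ttMajorant B' η' R x y * G y :=
              (hmaj.comp (measurable_const.prodMk measurable_id)).mul hTm.enorm
            calc ∫⁻ y, G x * G y * ttMajorant B' η' R x y
                = ∫⁻ y, G x * (ttMajorant B' η' R x y * G y) :=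
                  lintegral_congr fun y => by ring
              _ = G x * ∫⁻ y, ttMajorant B' η' R x y * G y := lintegral_const_mul _ m3
              _ ≤ G x * (ENNReal.ofReal ((4 * B' + 2) * η') * hlMaximal G x) := by
                  gcongr
                  exact lintegral_ttMajorant_mul_le hB' hη' hR0 hTm.enorm x
              _ = _ := by ring
        _ ≤ _ := by
            rw [lintegral_const_mul' _ _ ENNReal.ofReal_ne_top]
            gcongr
    have i2 : ∫⁻ x, ∫⁻ y, G x * G y * ttMajorant B' η' R y x =
        ∫⁻ x, ∫⁻ y, G x * G y * ttMajorant B' η' R x y := by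
      rw [lintegral_lintegral_swap m2.aemeasurable]
      refine lintegral_congr fun x => lintegral_congr fun y => ?_
      ring
    calc ∫⁻ x, ∫⁻ y, G x * G y * k x y
        ≤ ∫⁻ x, ∫⁻ y, (G x * G y * ttMajorant B' η' R x y +
            G x * G y * ttMajorant B' η' R y x) := by
          refine lintegral_mono fun x => lintegral_mono fun y => ?_
          rw [← mul_add]
          exact mul_le_mul_right (hk x y) _
      _ = (∫⁻ x, ∫⁻ y, G x * G y * ttMajorant B' η' R x y) +
            ∫⁻ x, ∫⁻ y, G x * G y * ttMajorant B' η' R y x := by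
          rw [← lintegral_add_left m1.lintegral_prod_right']
          refine lintegral_congr fun x => ?_
          exact lintegral_add_left (m1.comp (measurable_const.prodMk measurable_id)) _
      _ ≤ _ := by
          rw [i2, ← two_mul, mul_assoc]
          gcongr
  set g : ℝ → ℂ := fun x => (starRingEnd ℂ) (T x) with hg
  have hgm : Measurable g := Complex.continuous_conj.measurable.comp hTm
  have hgG : ∀ x, ‖g x‖ₑ = G x := fun x => by
    rw [hg, hG]
    simp only
    rw [← ofReal_norm, RCLike.norm_conj, ofReal_norm]
  have key := enorm_integral_mul_sq_le_of_tt_star ha hf hgm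
    (D := 2 * ENNReal.ofReal ((4 * B + 2) * η) * ((1 + C) * I)) ?_ ?_ ?_
  · have hTg : ∫ x, (∫ z, curveKernel γ u R x z * f z) * g x = ((∫ x, ‖T x‖ ^ 2 : ℝ) : ℂ) := by
      rw [← integral_complex_ofReal]
      refine integral_congr_ae (ae_of_all _ fun x => ?_)
      have : T x * (starRingEnd ℂ) (T x) = ((‖T x‖ ^ 2 : ℝ) : ℂ) := by
        rw [Complex.mul_conj, Complex.normSq_eq_norm_sq]
      exact this
    have hTint : Integrable fun x => ‖T x‖ ^ 2 := by
      simpa using integrable_norm_rpow hTm (p := 2) (by norm_num) hIfin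
    have hTI : ‖∫ x, (∫ z, curveKernel γ u R x z * f z) * g x‖ₑ = I := by
      rw [hTg, ← ofReal_norm, Complex.norm_real,
        Real.norm_of_nonneg (integral_nonneg fun z => by positivity),
        ofReal_integral_eq_lintegral_ofReal hTint (ae_of_all _ fun z => by positivity)]
      refine lintegral_congr fun z => ?_
      rw [← ofReal_norm, ENNReal.ofReal_rpow_of_nonneg (norm_nonneg _) (by norm_num),
        Real.rpow_two]
    rw [hTI, ENNReal.rpow_two, sq] at key
    rcases eq_or_ne I 0 with hI0 | hI0
    · rw [hI0]; exact zero_le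
    have key2 : I * I ≤ I * (2 * ENNReal.ofReal (4 * B + 2) * (1 + C) * ENNReal.ofReal η *
        ∫⁻ z, ‖f z‖ₑ ^ (2 : ℝ)) := by
      refine key.trans (le_of_eq ?_)
      rw [ENNReal.ofReal_mul (by positivity)]
      ring
    refine ((ENNReal.mul_le_mul_iff_right hI0 hIfin).1 key2).trans ?_
    gcongr
    exact le_self_add
  · refine ne_top_of_le_ne_top (b := 6 * (I + C * ∫⁻ z, ‖f z‖ₑ ^ (2 : ℝ))) (by finiteness) ?_
    calc _ ≤ ∫⁻ x, 6 * (G x ^ (2 : ℝ) + hlMaximal F x ^ (2 : ℝ)) := by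
          refine lintegral_mono fun x => ?_
          rw [hgG]
          calc _ ≤ G x * (6 * hlMaximal F x) := by
                gcongr
                exact lintegral_curveKernel_mul_le γ u hR0 F x
            _ = 6 * (G x * hlMaximal F x) := by ring
            _ ≤ _ := by gcongr; exact hsq _ _
      _ ≤ _ := by
          rw [lintegral_const_mul' _ _ (by norm_num), lintegral_add_left (hTm.enorm.pow_const _)]
          gcongr
  · simp only [hgG]
    refine ne_top_of_le_ne_top ?_ (hsymm 1 1 zero_le_one one_pos _ fun x y => ?_)
    · finiteness
    · have hind : ∀ x y : ℝ, (Metric.ball x (2 * R x)).indicator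
          (fun _ => ENNReal.ofReal (1 / R x)) y ≤ ttMajorant 1 1 R x y := fun x y => by
        by_cases hy : y ∈ Metric.ball x (2 * R x)
        · rw [indicator_of_mem hy, ttMajorant, indicator_of_mem hy]
          simp
        · rw [indicator_of_notMem hy]
          exact zero_le
      rcases le_total (R y) (R x) with hxy | hxy
      · exact ((lintegral_curveKernel_mul_curveKernel_le γ u hR0 hxy).trans (hind x y)).trans
          le_self_add
      · simp only [mul_comm ‖curveKernel γ u R x _‖ₑ]
        exact ((lintegral_curveKernel_mul_curveKernel_le γ u hR0 hxy).trans (hind y x)).trans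
          le_add_self
  · simp only [hgG]
    refine hsymm B η hB0 hη0 _ fun x y => ?_
    rcases le_total (R y) (R x) with hxy | hxy
    · exact (h.enorm_integral_curveKernel_le hL hR0 huR hxy).trans le_self_add
    · refine le_trans (le_of_eq ?_)
        ((h.enorm_integral_curveKernel_le hL hR0 huR hxy).trans le_add_self)
      rw [← ofReal_norm, ← RCLike.norm_conj, ← integral_conj, ofReal_norm]
      simp only [map_mul, Complex.conj_conj, mul_comm]

end IsNondegeneratePhase

/-! ### The part of the operator far from the origin -/

lemma measurable_carlesonIntegrand {γ : ℝ → ℝ} (hγ : Measurable γ) (u : ℝ → ℝ) {f : ℝ → ℂ}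
    (hf : Measurable f) (x : ℝ) : Measurable (carlesonIntegrand u γ f x) := by
  unfold carlesonIntegrand
  fun_prop

lemma norm_carlesonIntegrand (u γ : ℝ → ℝ) (f : ℝ → ℂ) (x t : ℝ) :
    ‖carlesonIntegrand u γ f x t‖ = ‖f (x - t) / (t : ℂ)‖ := by
  rw [carlesonIntegrand, mul_div_assoc, norm_mul, norm_exp_I_mul_ofReal, one_mul]

lemma integrableOn_carlesonIntegrand {γ : ℝ → ℝ} (hγ : Measurable γ) (u : ℝ → ℝ) {f : ℝ → ℂ}
    (hf : Measurable f) {x : ℝ} {S : Set ℝ} (hint : IntegrableOn (fun t => f (x - t) / (t : ℂ)) S) :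
    IntegrableOn (carlesonIntegrand u γ f x) S :=
  Integrable.mono hint (measurable_carlesonIntegrand hγ u hf x).aestronglyMeasurable
    (ae_of_all _ fun t => (norm_carlesonIntegrand u γ f x t).le)

lemma integrableOn_carlesonIntegrand_Ioi {γ : ℝ → ℝ} (hγ : Measurable γ) (u : ℝ → ℝ) {f : ℝ → ℂ}
    (hf : Measurable f) {p : ℝ} (hp : 1 < p) (hfp : ∫⁻ t, ‖f t‖ₑ ^ p ≠ ∞) (x : ℝ) {ε : ℝ}
    (hε : 0 < ε) : IntegrableOn (carlesonIntegrand u γ f x) (Ioi ε) :=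
  integrableOn_carlesonIntegrand hγ u hf
    ((integrableOn_div_lt_abs hf hp hfp x hε).mono_set
      fun t (ht : ε < t) => ht.trans_le (le_abs_self t))

lemma curvePiece_eq_setIntegral (γ u R : ℝ → ℝ) (f : ℝ → ℂ) (x : ℝ) :
    curvePiece γ u R f x = ∫ t in Ioc (R x) (2 * R x), carlesonIntegrand u γ f x t := by
  rw [curvePiece, ← integral_sub_left_eq_self _ volume x, ← integral_indicator measurableSet_Ioc]
  refine integral_congr_ae (ae_of_all _ fun t => ?_)
  simp only [curveKernel, sub_sub_cancel, indicator]
  split_ifs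
  · rw [carlesonIntegrand]
    push_cast
    ring
  · rw [zero_mul]

lemma curvePiece_add {γ u R : ℝ → ℝ} (hγ : Measurable γ) (hR : ∀ x, 0 < R x) {f g : ℝ → ℂ}
    (hf : Measurable f) (hg : Measurable g) {p : ℝ} (hp : 1 < p) (hfp : ∫⁻ t, ‖f t‖ₑ ^ p ≠ ∞)
    (hgp : ∫⁻ t, ‖g t‖ₑ ^ p ≠ ∞) (x : ℝ) :
    curvePiece γ u R (f + g) x = curvePiece γ u R f x + curvePiece γ u R g x := by
  simp only [curvePiece_eq_setIntegral]
  rw [← integral_add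
    ((integrableOn_carlesonIntegrand_Ioi hγ u hf hp hfp x (hR x)).mono_set Ioc_subset_Ioi_self)
    ((integrableOn_carlesonIntegrand_Ioi hγ u hg hp hgp x (hR x)).mono_set Ioc_subset_Ioi_self)]
  refine integral_congr_ae (ae_of_all _ fun t => ?_)
  simp only [carlesonIntegrand, Pi.add_apply]
  ring

lemma exists_lintegral_curvePiece_rpow_le_of_hlMaximal {q : ℝ} (hq : 1 < q) :
    ∃ K : ℝ≥0∞, K ≠ ∞ ∧ ∀ (γ u R : ℝ → ℝ), (∀ x, 0 < R x) → ∀ f : ℝ → ℂ, Measurable f →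
      ∫⁻ x, ‖curvePiece γ u R f x‖ₑ ^ q ≤ K * ∫⁻ z, ‖f z‖ₑ ^ q := by
  obtain ⟨C, hC, hM⟩ := exists_lintegral_hlMaximal_rpow_le hq
  refine ⟨6 ^ q * C, by finiteness, fun γ u R hR f hf => ?_⟩
  calc ∫⁻ x, ‖curvePiece γ u R f x‖ₑ ^ q
      ≤ ∫⁻ x, 6 ^ q * hlMaximal (fun z => ‖f z‖ₑ) x ^ q := by
        refine lintegral_mono fun x => ?_
        rw [← ENNReal.mul_rpow_of_nonneg _ _ (by linarith)]
        gcongr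
        exact enorm_curvePiece_le γ u hR f x
    _ ≤ _ := by
        rw [lintegral_const_mul _ ((measurable_hlMaximal _).pow_const _), mul_assoc]
        gcongr
        exact hM _ hf.enorm fun _ => enorm_ne_top

/-- Interpolation of strong type bounds which are powers of a parameter `L`: the Marcinkiewicz
splitting level is taken to be the power `L ^ α`. -/
lemma lintegral_rpow_le_of_power_interpolation {T : (ℝ → ℂ) → ℝ → ℝ≥0∞} {q₀ p q₁ : ℝ}
    (hq₀ : 0 < q₀) (h₀ : q₀ < p) (h₁ : p < q₁) {K₀ K₁ : ℝ≥0∞} {L α e₀ e₁ σ : ℝ} (hL : 1 ≤ L)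
    (hσ₀ : e₀ + α * (q₀ - p) ≤ -σ) (hσ₁ : e₁ + α * (q₁ - p) ≤ -σ)
    (hTm : ∀ f, Measurable f → Measurable (T f))
    (hT₀ : ∀ f, Measurable f →
      ∫⁻ x, T f x ^ q₀ ≤ K₀ * ENNReal.ofReal (L ^ e₀) * ∫⁻ t, ‖f t‖ₑ ^ q₀)
    (hT₁ : ∀ f, Measurable f →
      ∫⁻ x, T f x ^ q₁ ≤ K₁ * ENNReal.ofReal (L ^ e₁) * ∫⁻ t, ‖f t‖ₑ ^ q₁)
    {f : ℝ → ℂ} (hf : Measurable f)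
    (hadd : ∀ S : Set ℝ, MeasurableSet S → ∀ x,
      T f x ≤ T (S.indicator f) x + T (Sᶜ.indicator f) x) :
    ∫⁻ x, T f x ^ p ≤ ENNReal.ofReal (p * 2 ^ p) *
      (K₀ * ENNReal.ofReal (1 / (p - q₀)) + K₁ * ENNReal.ofReal (1 / (q₁ - p))) *
        ENNReal.ofReal (L ^ (-σ)) * ∫⁻ t, ‖f t‖ₑ ^ p := by
  have hL0 : 0 < L := by linarith
  refine (lintegral_rpow_le_of_interpolation hq₀ h₀ h₁ (Real.rpow_pos_of_pos hL0 α) hTm hT₀ hT₁ hf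
    hadd).trans ?_
  have key : ∀ e q d : ℝ, 0 < d → e + α * (q - p) ≤ -σ →
      ENNReal.ofReal (L ^ e) * ENNReal.ofReal ((L ^ α) ^ (q - p) / d) ≤
        ENNReal.ofReal (1 / d) * ENNReal.ofReal (L ^ (-σ)) := by
    intro e q d hd h
    rw [← ENNReal.ofReal_mul (by positivity), ← ENNReal.ofReal_mul (by positivity)]
    refine ENNReal.ofReal_le_ofReal ?_
    rw [← Real.rpow_mul hL0.le, mul_div_assoc', ← Real.rpow_add hL0, one_div_mul_eq_div]
    gcongr
  calc _ ≤ ENNReal.ofReal (p * 2 ^ p) *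
      (K₀ * (ENNReal.ofReal (1 / (p - q₀)) * ENNReal.ofReal (L ^ (-σ))) +
        K₁ * (ENNReal.ofReal (1 / (q₁ - p)) * ENNReal.ofReal (L ^ (-σ)))) * ∫⁻ t, ‖f t‖ₑ ^ p := by
        rw [mul_assoc K₀, mul_assoc K₁]
        have k₀ := key e₀ q₀ (p - q₀) (by linarith) hσ₀
        have k₁ := key e₁ q₁ (q₁ - p) (by linarith) hσ₁
        exact mul_le_mul_left (mul_le_mul_right
          (add_le_add (mul_le_mul_right k₀ _) (mul_le_mul_right k₁ _)) _) _
    _ = _ := by ring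

namespace IsNondegeneratePhase

variable {γ g₁ g₂ : ℝ → ℝ} {C₂ C₃ : ℝ}

/-- The `Lᵖ` bound with power decay in the size `L` of the phase, by interpolation of the decay on
`L²` with the bounds without decay. -/
lemma exists_lintegral_curvePiece_rpow_le (h : IsNondegeneratePhase γ g₁ g₂ C₂ C₃)
    (hγ : Measurable γ) {p : ℝ} (hp : 1 < p) :
    ∃ σ : ℝ, 0 < σ ∧ ∃ K : ℝ≥0∞, K ≠ ∞ ∧ ∀ (L : ℝ) (u R : ℝ → ℝ), 1 ≤ L → Measurable u →
      Measurable R → (∀ x, 0 < R x) → (∀ x, L ≤ |u x| * γ (R x)) → ∀ f : ℝ → ℂ, Measurable f →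
      ∫⁻ t, ‖f t‖ₑ ^ p ≠ ∞ → ∫⁻ x, ‖curvePiece γ u R f x‖ₑ ^ p ≤
        K * ENNReal.ofReal (L ^ (-σ)) * ∫⁻ z, ‖f z‖ₑ ^ p := by
  obtain ⟨K, hK, hT⟩ := h.exists_lintegral_curvePiece_sq_le hγ
  have hadd : ∀ (u R : ℝ → ℝ), (∀ x, 0 < R x) → ∀ f : ℝ → ℂ, Measurable f →
      ∫⁻ t, ‖f t‖ₑ ^ p ≠ ∞ → ∀ S : Set ℝ, MeasurableSet S → ∀ x,
      ‖curvePiece γ u R f x‖ₑ ≤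
        ‖curvePiece γ u R (S.indicator f) x‖ₑ + ‖curvePiece γ u R (Sᶜ.indicator f) x‖ₑ := by
    intro u R hR f hf hfp S hS x
    have := curvePiece_add (u := u) hγ hR (hf.indicator hS) (hf.indicator hS.compl) hp
      (lintegral_enorm_indicator_rpow_ne_top hS (by linarith) hfp)
      (lintegral_enorm_indicator_rpow_ne_top hS.compl (by linarith) hfp) x
    rw [indicator_self_add_compl] at this
    rw [this]
    exact enorm_add_le _ _
  -- the other endpoint lies on the far side of `p`; the level exponents `1 / 3` and `-1 / (6 p)`
  -- leave a negative power of `L` in both terms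
  rcases lt_trichotomy p 2 with h2 | rfl | h2
  · obtain ⟨K', hK', hT'⟩ := exists_lintegral_curvePiece_rpow_le_of_hlMaximal (q := (1 + p) / 2)
      (by linarith)
    refine ⟨(p - 1) / 6, by linarith, _, ?_, fun L u R hL hu hR hR0 huR f hf hfp =>
      lintegral_rpow_le_of_power_interpolation (q₀ := (1 + p) / 2) (q₁ := 2) (K₀ := K')
      (K₁ := K) (α := 1 / 3) (e₀ := 0) (e₁ := -(1 / 3))
      (T := fun f x => ‖curvePiece γ u R f x‖ₑ) (by linarith) (by linarith) h2 hL
      (by linarith) (by linarith) (fun f hf => (measurable_curvePiece hγ hu hR hf).enorm)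
      (fun f hf => ?_) (fun f hf => hT L u R hL hu hR hR0 huR f hf) hf (hadd u R hR0 f hf hfp)⟩
    · finiteness
    · simpa using hT' γ u R hR0 f hf
  · exact ⟨1 / 3, by norm_num, K, hK, fun L u R hL hu hR hR0 huR f hf _ =>
      hT L u R hL hu hR hR0 huR f hf⟩
  · obtain ⟨K', hK', hT'⟩ := exists_lintegral_curvePiece_rpow_le_of_hlMaximal (q := p + 1)
      (by linarith)
    have e : (1 / (6 * p)) * (p - 2) = 1 / 6 - 2 * (1 / (6 * p)) := by
      field_simp
    have e' : 0 < 1 / (6 * p) := by positivity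
    have e'' : 1 / (6 * p) ≤ 1 / 6 := by
      apply one_div_le_one_div_of_le <;> linarith
    refine ⟨1 / (6 * p), e', _, ?_, fun L u R hL hu hR hR0 huR f hf hfp =>
      lintegral_rpow_le_of_power_interpolation (q₀ := 2) (q₁ := p + 1) (K₀ := K)
      (K₁ := K') (α := -(1 / (6 * p))) (e₀ := -(1 / 3)) (e₁ := 0)
      (T := fun f x => ‖curvePiece γ u R f x‖ₑ) (by linarith) h2 (by linarith) hL
      (by linarith) (by linarith) (fun f hf => (measurable_curvePiece hγ hu hR hf).enorm)
      (fun f hf => hT L u R hL hu hR hR0 huR f hf) (fun f hf => ?_) hf (hadd u R hR0 f hf hfp)⟩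
    · finiteness
    · simpa using hT' γ u R hR0 f hf

/-- The part `t > t₀(x)` of the operator is bounded when the phase is at least one at `t₀(x)`: the
bounds for the dyadic pieces `2ᵏ t₀(x) < t ≤ 2ᵏ⁺¹ t₀(x)`, where the phase is at least `2ᵏ`, form a
geometric series. -/
lemma exists_lintegral_tail_rpow_le (h : IsNondegeneratePhase γ g₁ g₂ C₂ C₃)
    (hγ : Measurable γ) {p : ℝ} (hp : 1 < p) :
    ∃ K : ℝ≥0∞, K ≠ ∞ ∧ ∀ u t₀ : ℝ → ℝ, Measurable u → Measurable t₀ → (∀ x, 0 < t₀ x) →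
      (∀ x, 1 ≤ |u x| * γ (t₀ x)) → ∀ f : ℝ → ℂ, Measurable f → ∫⁻ t, ‖f t‖ₑ ^ p ≠ ∞ →
      ∫⁻ x, ‖∫ t in Ioi (t₀ x), carlesonIntegrand u γ f x t‖ₑ ^ p ≤ K * ∫⁻ z, ‖f z‖ₑ ^ p := by
  obtain ⟨σ, hσ, K, hK, hT⟩ := h.exists_lintegral_curvePiece_rpow_le hγ hp
  have hp0 : 0 < p := by linarith
  set r : ℝ := 2 ^ (-σ / p) with hr
  have hr0 : 0 < r := by positivity
  have hr1 : r < 1 :=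
    Real.rpow_lt_one_of_one_lt_of_neg one_lt_two (div_neg_of_neg_of_pos (by linarith) hp0)
  have hgeom : ∑' k : ℕ, ENNReal.ofReal r ^ k ≠ ∞ := by
    rw [ENNReal.tsum_geometric]
    refine ENNReal.inv_ne_top.2 (tsub_pos_of_lt ?_).ne'
    rwa [ENNReal.ofReal_lt_one]
  refine ⟨(K ^ (1 / p) * ∑' k : ℕ, ENNReal.ofReal r ^ k) ^ p, by finiteness, ?_⟩
  intro u t₀ hu ht₀ ht₀0 hut f hf hfp
  set P : ℕ → ℝ → ℂ := fun k => curvePiece γ u (fun x => 2 ^ k * t₀ x) f with hP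
  have hPm : ∀ k, Measurable (P k) := fun k =>
    measurable_curvePiece hγ hu (by fun_prop) hf
  have hR0 : ∀ (k : ℕ) x, 0 < 2 ^ k * t₀ x := fun k x => mul_pos (by positivity) (ht₀0 x)
  have hPk : ∀ k, eLpNorm' (P k) p volume ≤
      K ^ (1 / p) * ENNReal.ofReal r ^ k * eLpNorm' f p volume := by
    intro k
    have := hT (2 ^ k) u (fun x => 2 ^ k * t₀ x) (one_le_pow₀ one_le_two) hu (by fun_prop) (hR0 k)
      (fun x => ?_) f hf hfp
    · rw [eLpNorm'_eq_lintegral_enorm, eLpNorm'_eq_lintegral_enorm]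
      refine (ENNReal.rpow_le_rpow this (by positivity)).trans (le_of_eq ?_)
      rw [ENNReal.mul_rpow_of_nonneg _ _ (by positivity),
        ENNReal.mul_rpow_of_nonneg _ _ (by positivity)]
      congr 2
      rw [ENNReal.ofReal_rpow_of_nonneg (by positivity) (by positivity),
        ← ENNReal.ofReal_pow hr0.le, hr, ← Real.rpow_mul (by positivity), ← Real.rpow_natCast,
        ← Real.rpow_natCast, ← Real.rpow_mul (by positivity), ← Real.rpow_mul (by positivity)]
      congr 2
      ring
    · have h1 := h.mul_le_comp_mul (2 ^ k) (t₀ x) (one_le_pow₀ one_le_two) (ht₀0 x)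
      calc (2 : ℝ) ^ k ≤ 2 ^ k * (|u x| * γ (t₀ x)) := le_mul_of_one_le_right (by positivity) (hut x)
        _ = |u x| * (2 ^ k * γ (t₀ x)) := by ring
        _ ≤ _ := by gcongr
  have hsum : ∀ x n, ∑ k ∈ Finset.range n, P k x =
      ∫ t in Ioc (t₀ x) (2 ^ n * t₀ x), carlesonIntegrand u γ f x t := by
    intro x n
    have hI := integrableOn_carlesonIntegrand_Ioi hγ u hf hp hfp x (ht₀0 x)
    induction n with
    | zero => simp
    | succ n ih =>
      have h1 : t₀ x ≤ 2 ^ n * t₀ x :=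
        le_mul_of_one_le_left (ht₀0 x).le (one_le_pow₀ one_le_two)
      have h2 : 2 ^ n * t₀ x ≤ 2 * (2 ^ n * t₀ x) := by linarith [hR0 n x]
      rw [Finset.sum_range_succ, ih, hP]
      simp only
      rw [curvePiece_eq_setIntegral, ← setIntegral_union (Ioc_disjoint_Ioc_of_le le_rfl)
        measurableSet_Ioc (hI.mono_set Ioc_subset_Ioi_self)
        (hI.mono_set fun t ht => h1.trans_lt ht.1), Ioc_union_Ioc_eq_Ioc h1 h2]
      congr 3
      ring
  have hlim : ∀ x, Tendsto (fun n => ∑ k ∈ Finset.range n, P k x) atTop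
      (𝓝 (∫ t in Ioi (t₀ x), carlesonIntegrand u γ f x t)) := by
    intro x
    have hI := integrableOn_carlesonIntegrand_Ioi hγ u hf hp hfp x (ht₀0 x)
    have htop : Tendsto (fun n : ℕ => (2 : ℝ) ^ n * t₀ x) atTop atTop :=
      (tendsto_pow_atTop_atTop_of_one_lt one_lt_two).atTop_mul_const (ht₀0 x)
    simp only [hsum]
    refine (intervalIntegral_tendsto_integral_Ioi _ hI htop).congr fun n => ?_
    rw [intervalIntegral.integral_of_le]
    exact le_mul_of_one_le_left (ht₀0 x).le (one_le_pow₀ one_le_two)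
  have hmain : eLpNorm' (fun x => ∫ t in Ioi (t₀ x), carlesonIntegrand u γ f x t) p volume ≤
      K ^ (1 / p) * (∑' k : ℕ, ENNReal.ofReal r ^ k) * eLpNorm' f p volume := by
    refine (Lp.eLpNorm'_lim_le_liminf_eLpNorm' (f := fun n x => ∑ k ∈ Finset.range n, P k x) hp0
      (fun n => (Finset.measurable_fun_sum _ fun k _ => hPm k).aestronglyMeasurable)
      (ae_of_all _ hlim)).trans ?_
    refine liminf_le_of_le (by isBoundedDefault) fun b hb => ?_
    obtain ⟨n, hn⟩ := hb.exists
    refine hn.trans ?_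
    have h1 := eLpNorm'_sum_le (μ := (volume : Measure ℝ)) (f := P) (s := Finset.range n)
      (fun k _ => (hPm k).aestronglyMeasurable) hp.le
    have h2 : (∑ k ∈ Finset.range n, P k) = fun x => ∑ k ∈ Finset.range n, P k x := by
      ext x
      simp
    rw [h2] at h1
    refine h1.trans ((Finset.sum_le_sum fun k _ => hPk k).trans ?_)
    rw [← Finset.sum_mul, ← Finset.mul_sum]
    gcongr
    exact ENNReal.sum_le_tsum _
  rw [eLpNorm'_eq_lintegral_enorm, eLpNorm'_eq_lintegral_enorm] at hmain
  have := ENNReal.rpow_le_rpow hmain hp0.le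
  rwa [ENNReal.mul_rpow_of_nonneg _ _ hp0.le, ← ENNReal.rpow_mul, ← ENNReal.rpow_mul,
    one_div_mul_cancel hp0.ne', ENNReal.rpow_one, ENNReal.rpow_one] at this

end IsNondegeneratePhase

/-! ### Consequences of the hypotheses on the curve -/

section Curve

variable {γ : ℝ → ℝ}

lemma hasDerivAt_deriv_of_contDiff (hγ : ContDiff ℝ 3 γ) (t : ℝ) : HasDerivAt γ (deriv γ t) t :=
  (hγ.differentiable (by norm_num) t).hasDerivAt

lemma hasDerivAt_iteratedDeriv_two (hγ : ContDiff ℝ 3 γ) (t : ℝ) :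
    HasDerivAt (deriv γ) (iteratedDeriv 2 γ t) t := by
  have h := hγ.differentiable_iteratedDeriv 1 (by norm_num)
  have h2 := (h t).hasDerivAt
  rwa [← iteratedDeriv_succ, iteratedDeriv_one] at h2

lemma hasDerivAt_iteratedDeriv_three (hγ : ContDiff ℝ 3 γ) (t : ℝ) :
    HasDerivAt (iteratedDeriv 2 γ) (iteratedDeriv 3 γ t) t := by
  have h := hγ.differentiable_iteratedDeriv 2 (by norm_num)
  have h2 := (h t).hasDerivAt
  rwa [← iteratedDeriv_succ] at h2

lemma monotoneOn_deriv_of_convexOn (hγ : ContDiff ℝ 3 γ) (hconv : ConvexOn ℝ (Ioi 0) γ) :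
    MonotoneOn (deriv γ) (Ioi 0) :=
  hconv.monotoneOn_deriv fun t _ => (hasDerivAt_deriv_of_contDiff hγ t).differentiableAt

lemma deriv_nonneg_of_convexOn (hγ : ContDiff ℝ 3 γ) (hγ0' : deriv γ 0 = 0)
    (hconv : ConvexOn ℝ (Ioi 0) γ) {t : ℝ} (ht : 0 < t) : 0 ≤ deriv γ t := by
  have hc : Tendsto (deriv γ) (𝓝[>] 0) (𝓝 0) := by
    have := (hasDerivAt_iteratedDeriv_two hγ 0).continuousAt.tendsto
    rw [hγ0'] at this
    exact this.mono_left nhdsWithin_le_nhds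
  refine le_of_tendsto hc ?_
  filter_upwards [Ioo_mem_nhdsGT ht] with s hs
  exact monotoneOn_deriv_of_convexOn hγ hconv hs.1 ht hs.2.le

lemma iteratedDeriv_two_nonneg_of_convexOn (hγ : ContDiff ℝ 3 γ)
    (hconv : ConvexOn ℝ (Ioi 0) γ) {t : ℝ} (ht : 0 < t) : 0 ≤ iteratedDeriv 2 γ t := by
  have h1 := (hasDerivAt_iteratedDeriv_two hγ t).hasDerivWithinAt (s := Ioi 0)
  rw [← h1.derivWithin (isOpen_Ioi.uniqueDiffWithinAt ht)]
  exact (monotoneOn_deriv_of_convexOn hγ hconv).derivWithin_nonneg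

/-- If `γ'` vanished somewhere on `(0, ∞)`, it would vanish on an interval, on which the quotient
`γ'' / γ'` would be constant. -/
lemma deriv_pos_of_curvature (hγ : ContDiff ℝ 3 γ) (hγ0' : deriv γ 0 = 0)
    (hconv : ConvexOn ℝ (Ioi 0) γ) {C₃ : ℝ} (hC₃ : 0 < C₃)
    (hiii : ∀ t : ℝ, 0 < t →
      C₃ / t ^ 2 ≤ |deriv (fun s : ℝ => iteratedDeriv 2 γ s / deriv γ s) t|)
    {t : ℝ} (ht : 0 < t) : 0 < deriv γ t := by
  refine (deriv_nonneg_of_convexOn hγ hγ0' hconv ht).lt_of_ne fun h0 => ?_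
  have hz : (fun s : ℝ => iteratedDeriv 2 γ s / deriv γ s) =ᶠ[𝓝 (t / 2)] fun _ => 0 := by
    filter_upwards [Ioo_mem_nhds (half_pos ht) (half_lt_self ht)] with s hs
    have h1 := monotoneOn_deriv_of_convexOn hγ hconv hs.1 ht hs.2.le
    have h2 := deriv_nonneg_of_convexOn hγ hγ0' hconv hs.1
    rw [le_antisymm (h1.trans h0.symm.le) h2, div_zero]
  have h3 := hiii (t / 2) (half_pos ht)
  rw [hz.deriv_eq, deriv_const, abs_zero] at h3
  have : 0 < C₃ / (t / 2) ^ 2 := by positivity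
  linarith

/-- The quotient `h = γ'' / γ'` satisfies `h' ≤ -C₃ / t²`: its derivative has constant sign by
Darboux's theorem, and `h' ≥ C₃ / t²` would make `h` negative near the origin. -/
lemma curvature_gap (hγ : ContDiff ℝ 3 γ) (hγ0' : deriv γ 0 = 0)
    (hconv : ConvexOn ℝ (Ioi 0) γ) {C₃ : ℝ} (hC₃ : 0 < C₃)
    (hiii : ∀ t : ℝ, 0 < t →
      C₃ / t ^ 2 ≤ |deriv (fun s : ℝ => iteratedDeriv 2 γ s / deriv γ s) t|)
    {s t : ℝ} (hs : 0 < s) (hst : s < t) : C₃ * (1 / s - 1 / t) ≤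
      iteratedDeriv 2 γ s / deriv γ s - iteratedDeriv 2 γ t / deriv γ t := by
  set h : ℝ → ℝ := fun s => iteratedDeriv 2 γ s / deriv γ s with hh
  have hpos : ∀ t, 0 < t → 0 < deriv γ t := fun t ht =>
    deriv_pos_of_curvature hγ hγ0' hconv hC₃ hiii ht
  have hder : ∀ t, 0 < t → HasDerivAt h (deriv h t) t := fun t ht =>
    (((hasDerivAt_iteratedDeriv_three hγ t).div (hasDerivAt_iteratedDeriv_two hγ t)
      (hpos t ht).ne').differentiableAt).hasDerivAt
  have hnn : ∀ t, 0 < t → 0 ≤ h t := fun t ht =>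
    div_nonneg (iteratedDeriv_two_nonneg_of_convexOn hγ hconv ht) (hpos t ht).le
  have hinv : ∀ c t : ℝ, 0 < t → HasDerivAt (fun s => c / s) (-(c / t ^ 2)) t := by
    intro c t ht
    have := (hasDerivAt_inv ht.ne').const_mul c
    simpa only [div_eq_mul_inv, mul_neg] using this
  have hne : ∀ t ∈ Ioi (0 : ℝ), deriv h t ≠ 0 := by
    intro t ht h0
    have h1 := hiii t ht
    rw [h0, abs_zero] at h1
    have : 0 < C₃ / t ^ 2 := div_pos hC₃ (pow_pos ht 2)
    linarith
  rcases hasDerivWithinAt_forall_lt_or_forall_gt_of_forall_ne (convex_Ioi (0 : ℝ))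
    (fun t ht => (hder t ht).hasDerivWithinAt) hne with hneg | hpos'
  · have hanti : AntitoneOn (fun t => h t - C₃ / t) (Ioi 0) := by
      refine antitoneOn_of_hasDerivWithinAt_nonpos (convex_Ioi 0)
        (f' := fun t => deriv h t - -(C₃ / t ^ 2)) (fun t ht => ?_) (fun t ht => ?_) fun t ht => ?_
      · exact ((hder t ht).sub (hinv C₃ t ht)).continuousAt.continuousWithinAt
      · rw [interior_Ioi] at ht
        exact ((hder t ht).sub (hinv C₃ t ht)).hasDerivWithinAt
      · rw [interior_Ioi] at ht
        have h1 := hiii t ht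
        rw [abs_of_neg (hneg t ht)] at h1
        linarith
    have h1 := hanti hs (hs.trans hst) hst.le
    simp only at h1
    have e : C₃ * (1 / s - 1 / t) = C₃ / s - C₃ / t := by ring
    rw [e]
    linarith
  · exfalso
    have hmono : MonotoneOn (fun t => h t + C₃ / t) (Ioi 0) := by
      refine monotoneOn_of_hasDerivWithinAt_nonneg (convex_Ioi 0)
        (f' := fun t => deriv h t + -(C₃ / t ^ 2)) (fun t ht => ?_) (fun t ht => ?_) fun t ht => ?_
      · exact ((hder t ht).add (hinv C₃ t ht)).continuousAt.continuousWithinAt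
      · rw [interior_Ioi] at ht
        exact ((hder t ht).add (hinv C₃ t ht)).hasDerivWithinAt
      · rw [interior_Ioi] at ht
        have h1 := hiii t ht
        rw [abs_of_pos (hpos' t ht)] at h1
        linarith
    have h1 := hnn 1 one_pos
    have hd : 0 < C₃ / (2 * (h 1 + C₃)) := by positivity
    have hd1 : C₃ / (2 * (h 1 + C₃)) ≤ 1 := (div_le_one (by positivity)).2 (by linarith)
    have h2 := hmono hd (mem_Ioi.2 one_pos) hd1
    have h3 := hnn _ hd
    have e : C₃ / (C₃ / (2 * (h 1 + C₃))) = 2 * (h 1 + C₃) := div_div_cancel₀ hC₃.ne'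
    simp only [e, div_one] at h2
    linarith

lemma iteratedDeriv_two_pos_of_curvature (hγ : ContDiff ℝ 3 γ) (hγ0' : deriv γ 0 = 0)
    (hconv : ConvexOn ℝ (Ioi 0) γ) {C₃ : ℝ} (hC₃ : 0 < C₃)
    (hiii : ∀ t : ℝ, 0 < t →
      C₃ / t ^ 2 ≤ |deriv (fun s : ℝ => iteratedDeriv 2 γ s / deriv γ s) t|)
    {t : ℝ} (ht : 0 < t) : 0 < iteratedDeriv 2 γ t := by
  have h1 := curvature_gap hγ hγ0' hconv hC₃ hiii ht (show t < 2 * t by linarith)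
  have h2 : 0 ≤ iteratedDeriv 2 γ (2 * t) / deriv γ (2 * t) :=
    div_nonneg (iteratedDeriv_two_nonneg_of_convexOn hγ hconv (by linarith))
      (deriv_nonneg_of_convexOn hγ hγ0' hconv (by linarith))
  have h3 : 0 < C₃ * (1 / t - 1 / (2 * t)) := by
    refine mul_pos hC₃ (sub_pos.2 ?_)
    apply one_div_lt_one_div_of_lt ht
    linarith
  have h4 : 0 < iteratedDeriv 2 γ t / deriv γ t := by linarith
  rwa [div_pos_iff_of_pos_right (deriv_pos_of_curvature hγ hγ0' hconv hC₃ hiii ht)] at h4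

/-- If the logarithmic derivative of a positive function is monotone, then its ratios under
translations are monotone. -/
lemma monotoneOn_or_antitoneOn_comp_add_div {g g' : ℝ → ℝ} (hg : ∀ t, 0 < t → HasDerivAt g (g' t) t)
    (hpos : ∀ t, 0 < t → 0 < g t)
    (hmono : MonotoneOn (fun t => g' t / g t) (Ioi 0) ∨ AntitoneOn (fun t => g' t / g t) (Ioi 0))
    (s : ℝ) : MonotoneOn (fun t => g (t + s) / g t) (Ioi (max 0 (-s))) ∨
      AntitoneOn (fun t => g (t + s) / g t) (Ioi (max 0 (-s))) := by
  have h0 : ∀ t ∈ Ioi (max 0 (-s)), 0 < t ∧ 0 < t + s := fun t ht => by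
    have := max_lt_iff.1 (mem_Ioi.1 ht)
    constructor <;> linarith [this.1, this.2]
  have hder : ∀ t ∈ Ioi (max 0 (-s)), HasDerivAt (fun t => g (t + s) / g t)
      (g (t + s) / g t * (g' (t + s) / g (t + s) - g' t / g t)) t := by
    intro t ht
    obtain ⟨h1, h2⟩ := h0 t ht
    have h3 := ((hg (t + s) h2).comp_add_const t s).div (hg t h1) (hpos t h1).ne'
    refine h3.congr_deriv ?_
    have := (hpos t h1).ne'
    have := (hpos (t + s) h2).ne'
    field_simp
  have hup : (∀ t ∈ Ioi (max 0 (-s)), g' t / g t ≤ g' (t + s) / g (t + s)) →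
      MonotoneOn (fun t => g (t + s) / g t) (Ioi (max 0 (-s))) := by
    intro h
    refine monotoneOn_of_hasDerivWithinAt_nonneg (convex_Ioi _)
      (fun t ht => (hder t ht).continuousAt.continuousWithinAt)
      (fun t ht => (hder t (interior_subset ht)).hasDerivWithinAt) fun t ht => ?_
    obtain ⟨h1, h2⟩ := h0 t (interior_subset ht)
    exact mul_nonneg (div_pos (hpos _ h2) (hpos _ h1)).le
      (sub_nonneg.2 (h t (interior_subset ht)))
  have hdown : (∀ t ∈ Ioi (max 0 (-s)), g' (t + s) / g (t + s) ≤ g' t / g t) →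
      AntitoneOn (fun t => g (t + s) / g t) (Ioi (max 0 (-s))) := by
    intro h
    refine antitoneOn_of_hasDerivWithinAt_nonpos (convex_Ioi _)
      (fun t ht => (hder t ht).continuousAt.continuousWithinAt)
      (fun t ht => (hder t (interior_subset ht)).hasDerivWithinAt) fun t ht => ?_
    obtain ⟨h1, h2⟩ := h0 t (interior_subset ht)
    exact mul_nonpos_of_nonneg_of_nonpos (div_pos (hpos _ h2) (hpos _ h1)).le
      (sub_nonpos.2 (h t (interior_subset ht)))
  rcases hmono with hm | hm <;> rcases le_total 0 s with hs | hs
  · exact .inl (hup fun t ht => hm (h0 t ht).1 (h0 t ht).2 (by linarith))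
  · exact .inr (hdown fun t ht => hm (h0 t ht).2 (h0 t ht).1 (by linarith))
  · exact .inr (hdown fun t ht => hm (h0 t ht).1 (h0 t ht).2 (by linarith))
  · exact .inl (hup fun t ht => hm (h0 t ht).2 (h0 t ht).1 (by linarith))

lemma convexOn_Ici_of_convexOn_Ioi (hγ : ContDiff ℝ 3 γ) (hconv : ConvexOn ℝ (Ioi 0) γ) :
    ConvexOn ℝ (Ici 0) γ := by
  refine MonotoneOn.convexOn_of_deriv (convex_Ici 0) hγ.continuous.continuousOn
    (hγ.differentiable (by norm_num)).differentiableOn ?_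
  rw [interior_Ici]
  exact monotoneOn_deriv_of_convexOn hγ hconv

/-- Everything the oscillatory estimates need follows from the positivity of `γ'` and `γ''` and from
convexity on `[0, ∞)` together with `γ 0 = 0`. -/
theorem isNondegeneratePhase_of_curvature (hγ : ContDiff ℝ 3 γ)
    (hγ0 : γ 0 = 0) (hγ0' : deriv γ 0 = 0) (hconv : ConvexOn ℝ (Ioi 0) γ) {C₂ C₃ : ℝ}
    (hC₂ : 0 < C₂) (hii : ∀ t : ℝ, 0 < t → t * iteratedDeriv 2 γ t / deriv γ t ≤ C₂)
    (hC₃ : 0 < C₃)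
    (hiii : ∀ t : ℝ, 0 < t →
      C₃ / t ^ 2 ≤ |deriv (fun s : ℝ => iteratedDeriv 2 γ s / deriv γ s) t|)
    (hiv : StrictMonoOn (fun t : ℝ => iteratedDeriv 3 γ t / iteratedDeriv 2 γ t) (Ioi 0) ∨
      StrictAntiOn (fun t : ℝ => iteratedDeriv 3 γ t / iteratedDeriv 2 γ t) (Ioi 0) ∨
      ∃ c : ℝ, ∀ t : ℝ, 0 < t → iteratedDeriv 3 γ t / iteratedDeriv 2 γ t = c) :
    IsNondegeneratePhase γ (deriv γ) (iteratedDeriv 2 γ) C₂ C₃ := by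
  have hpos : ∀ t, 0 < t → 0 < deriv γ t := fun t ht =>
    deriv_pos_of_curvature hγ hγ0' hconv hC₃ hiii ht
  have hmv : ∀ t, 0 < t → ∃ ξ, 0 < ξ ∧ ξ < t ∧ γ t = t * deriv γ ξ := by
    intro t ht
    obtain ⟨ξ, hξ, he⟩ := exists_deriv_eq_slope γ ht hγ.continuous.continuousOn
      (hγ.differentiable (by norm_num)).differentiableOn
    refine ⟨ξ, hξ.1, hξ.2, ?_⟩
    rw [he, hγ0, sub_zero, sub_zero]
    field_simp
  refine ⟨hC₂, hC₃, fun t _ => hasDerivAt_deriv_of_contDiff hγ t,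
    fun t _ => hasDerivAt_iteratedDeriv_two hγ t,
    fun t _ => (hasDerivAt_iteratedDeriv_three hγ t).continuousAt.continuousWithinAt, fun t ht => ?_,
    hpos, fun t ht => iteratedDeriv_two_pos_of_curvature hγ hγ0' hconv hC₃ hiii ht,
    fun c t hc ht => ?_, fun t ht => ?_, fun t ht => ?_,
    fun s t hs hst => curvature_gap hγ hγ0' hconv hC₃ hiii hs hst,
    monotoneOn_or_antitoneOn_comp_add_div (fun t _ => hasDerivAt_iteratedDeriv_three hγ t)
      (fun t ht => iteratedDeriv_two_pos_of_curvature hγ hγ0' hconv hC₃ hiii ht) ?_⟩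
  · obtain ⟨ξ, h1, -, h3⟩ := hmv t ht
    rw [h3]
    exact mul_pos ht (hpos ξ h1)
  · have hc0 : 0 < c := by linarith
    have h1 := (convexOn_Ici_of_convexOn_Ioi hγ hconv).2 (mem_Ici.2 (mul_pos hc0 ht).le)
      (mem_Ici.2 le_rfl) (one_div_pos.2 hc0).le (sub_nonneg.2 ((div_le_one hc0).2 hc))
      (by ring : 1 / c + (1 - 1 / c) = 1)
    simp only [smul_eq_mul, mul_zero, add_zero, hγ0] at h1
    rw [← mul_assoc, one_div_mul_cancel hc0.ne', one_mul, one_div_mul_eq_div,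
      le_div_iff₀ hc0] at h1
    linarith
  · obtain ⟨ξ, h1, h2, h3⟩ := hmv t ht
    rw [h3]
    exact mul_le_mul_of_nonneg_left (monotoneOn_deriv_of_convexOn hγ hconv h1 ht h2.le) ht.le
  · exact (div_le_iff₀ (hpos t ht)).1 (hii t ht)
  · rcases hiv with h | h | ⟨c, h⟩
    · exact .inl h.monotoneOn
    · exact .inr h.antitoneOn
    · refine .inl fun s hs t ht _ => ?_
      simp only
      rw [h s hs, h t ht]

end Curve

namespace IsNondegeneratePhase

variable {γ g₁ g₂ : ℝ → ℝ} {C₂ C₃ : ℝ}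

/-- The scale at which the phase `v γ` has size one, as a measurable function of `v`. -/
lemma exists_measurable_scale (h : IsNondegeneratePhase γ g₁ g₂ C₂ C₃) (hγ : Continuous γ)
    (hγ0 : γ 0 = 0) :
    ∃ τ : ℝ → ℝ, Measurable τ ∧ ∀ v, v ≠ 0 → 0 < τ v ∧ |v| * γ (τ v) = 1 := by
  have hex : ∀ y : ℝ, 0 < y → ∃ t, 0 < t ∧ γ t = y := by
    intro y hy
    have h1 := h.pos 1 one_pos
    set c := max 1 (y / γ 1) with hc
    have h2 : y ≤ γ c := by
      have h3 := h.mul_le_comp_mul c 1 (le_max_left _ _) one_pos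
      rw [mul_one] at h3
      refine le_trans ?_ h3
      rw [← div_le_iff₀ h1]
      exact le_max_right _ _
    have hc0 : 0 ≤ c := zero_le_one.trans (le_max_left _ _)
    obtain ⟨t, ht, rfl⟩ := intermediate_value_Icc hc0 hγ.continuousOn
      ⟨hγ0.trans_le hy.le, h2⟩
    refine ⟨t, ht.1.lt_of_ne fun h0 => ?_, rfl⟩
    rw [← h0, hγ0] at hy
    exact lt_irrefl _ hy
  choose! T hT0 hT using hex
  set S : ℝ → ℝ := fun y => if 0 < y then T y else 0 with hS
  have hmono : Monotone S := by
    intro a b hab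
    simp only [hS]
    split_ifs with ha hb hb
    · by_contra! hlt
      have h1 := h.le_of_le (hT0 b hb) hlt.le
      rw [hT b hb, hT a ha] at h1
      have h2 := le_antisymm hab h1
      rw [h2] at hlt
      exact lt_irrefl _ hlt
    · exact absurd (ha.trans_le hab) hb
    · exact (hT0 b hb).le
    · exact le_rfl
  refine ⟨fun v => S (1 / |v|), hmono.measurable.comp (by fun_prop), fun v hv => ?_⟩
  have hv' : 0 < 1 / |v| := by positivity
  simp only [hS, if_pos hv']
  refine ⟨hT0 _ hv', ?_⟩
  rw [hT _ hv', mul_one_div_cancel (abs_pos.2 hv).ne']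

end IsNondegeneratePhase

/-! ### Existence of the principal value and the pointwise bound -/

lemma lintegral_enorm_ball_ne_top {f : ℝ → ℂ} {p : ℝ} (hp : 1 < p)
    (hfp : ∫⁻ t, ‖f t‖ₑ ^ p ≠ ∞) (x r : ℝ) : ∫⁻ y in Metric.ball x r, ‖f y‖ₑ ≠ ∞ := by
  have h1 : ∀ y, ‖f y‖ₑ ≤ 1 + ‖f y‖ₑ ^ p := fun y => by
    rcases le_total ‖f y‖ₑ 1 with h | h
    · exact h.trans le_self_add
    · exact (ENNReal.le_rpow_self_of_one_le h hp.le).trans le_add_self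
  refine ((lintegral_mono fun y => h1 y).trans_lt ?_).ne
  rw [lintegral_add_left measurable_const]
  refine ENNReal.add_lt_top.2 ⟨?_, (setLIntegral_le_lintegral _ _).trans_lt hfp.lt_top⟩
  rw [lintegral_const, one_mul, Measure.restrict_apply_univ]
  exact measure_ball_lt_top

/-- The difference between the integrand of the Carleson operator and that of the Hilbert transform
on `|t| ≤ r`, extended by zero. -/
noncomputable def nearIntegrand (u γ : ℝ → ℝ) (f : ℝ → ℂ) (r x : ℝ) : ℝ → ℂ :=
  {t : ℝ | |t| ≤ r}.indicator fun t => carlesonIntegrand u γ f x t - f (x - t) / (t : ℂ)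

lemma measurable_nearIntegrand {γ : ℝ → ℝ} (hγ : Measurable γ) (u : ℝ → ℝ) {f : ℝ → ℂ}
    (hf : Measurable f) (r x : ℝ) : Measurable (nearIntegrand u γ f r x) :=
  ((measurable_carlesonIntegrand hγ u hf x).sub (by fun_prop)).indicator
    (measurableSet_le (by fun_prop) measurable_const)

namespace IsNondegeneratePhase

variable {γ g₁ g₂ : ℝ → ℝ} {C₂ C₃ : ℝ}

lemma norm_nearIntegrand_le (h : IsNondegeneratePhase γ g₁ g₂ C₂ C₃)
    (habs : ∀ t, |γ t| = γ |t|) {u : ℝ → ℝ} {x r : ℝ} (hr : 0 < r) (hu : |u x| * γ r ≤ 1)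
    (f : ℝ → ℂ) (t : ℝ) : ‖nearIntegrand u γ f r x t‖ ≤
      1 / r * {t : ℝ | |t| ≤ r}.indicator (fun t => ‖f (x - t)‖) t := by
  by_cases ht : t ∈ {t : ℝ | |t| ≤ r}
  swap
  · rw [nearIntegrand, indicator_of_notMem ht, indicator_of_notMem ht, norm_zero, mul_zero]
  rw [nearIntegrand, indicator_of_mem ht, indicator_of_mem ht]
  have ht' : |t| ≤ r := ht
  have e : carlesonIntegrand u γ f x t - f (x - t) / (t : ℂ) =
      (Complex.exp (Complex.I * ((u x * γ t : ℝ) : ℂ)) - 1) * (f (x - t) / (t : ℂ)) := by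
    rw [carlesonIntegrand]
    ring
  rw [e, norm_mul, norm_div, Complex.norm_real, Real.norm_eq_abs]
  rcases eq_or_ne t 0 with rfl | ht0
  · simp only [abs_zero, div_zero, mul_zero]
    positivity
  have ht1 : 0 < |t| := abs_pos.2 ht0
  have h1 : ‖Complex.exp (Complex.I * ((u x * γ t : ℝ) : ℂ)) - 1‖ ≤ |t| / r := by
    refine (Real.norm_exp_I_mul_ofReal_sub_one_le).trans ?_
    rw [Real.norm_eq_abs, abs_mul, habs]
    have h2 := h.mul_le_comp_mul (r / |t|) |t| ((one_le_div ht1).2 ht') ht1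
    rw [div_mul_cancel₀ _ ht1.ne'] at h2
    have h3 : γ |t| ≤ |t| / r * γ r := by
      calc γ |t| = |t| / r * (r / |t| * γ |t|) := by field_simp
        _ ≤ _ := by gcongr
    calc |u x| * γ |t| ≤ |u x| * (|t| / r * γ r) := by gcongr
      _ = |t| / r * (|u x| * γ r) := by ring
      _ ≤ |t| / r * 1 := by gcongr
      _ = _ := mul_one _
  calc _ ≤ |t| / r * (‖f (x - t)‖ / |t|) := by gcongr
    _ = _ := by field_simp

lemma lintegral_nearIntegrand_le (h : IsNondegeneratePhase γ g₁ g₂ C₂ C₃)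
    (habs : ∀ t, |γ t| = γ |t|) {u : ℝ → ℝ} {x r : ℝ} (hr : 0 < r) (hu : |u x| * γ r ≤ 1)
    (f : ℝ → ℂ) : ∫⁻ t, ‖nearIntegrand u γ f r x t‖ₑ ≤
      ENNReal.ofReal (1 / r) * ∫⁻ y in Metric.ball x (2 * r), ‖f y‖ₑ := by
  rw [← lintegral_indicator Metric.isOpen_ball.measurableSet,
    ← lintegral_const_mul' _ _ ENNReal.ofReal_ne_top, ← lintegral_sub_left_eq_self
      (fun t => ENNReal.ofReal (1 / r) * (Metric.ball x (2 * r)).indicator (fun y => ‖f y‖ₑ) t) x]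
  refine lintegral_mono fun t => ?_
  rw [← ofReal_norm]
  refine (ENNReal.ofReal_le_ofReal (h.norm_nearIntegrand_le habs hr hu f t)).trans ?_
  rw [ENNReal.ofReal_mul (by positivity)]
  gcongr
  by_cases ht : t ∈ {t : ℝ | |t| ≤ r}
  · have ht' : |t| ≤ r := ht
    have : x - t ∈ Metric.ball x (2 * r) := by
      rw [Metric.mem_ball, Real.dist_eq, sub_sub_cancel_left, abs_neg]
      linarith
    rw [indicator_of_mem ht, indicator_of_mem this, ofReal_norm]
  · rw [indicator_of_notMem ht, ENNReal.ofReal_zero]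
    exact zero_le

end IsNondegeneratePhase

lemma hasPrincipalValue_zero_phase {u : ℝ → ℝ} (γ : ℝ → ℝ) {f : ℝ → ℂ} {x : ℝ} (hu : u x = 0)
    (hint : ∀ ε : ℝ, 0 < ε → IntegrableOn (fun t => f (x - t) / (t : ℂ)) {t : ℝ | ε < |t|}) {L : ℂ}
    (hL : Tendsto (fun ε => hilbertTrunc f ε x) (𝓝[>] 0) (𝓝 L)) :
    HasPrincipalValue (carlesonIntegrand u γ f x) L := by
  have : carlesonIntegrand u γ f x = fun t => f (x - t) / (t : ℂ) := by
    funext t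
    simp [carlesonIntegrand, hu]
  rw [this]
  exact ⟨hint, hL⟩

lemma setIntegral_lt_abs {F : ℝ → ℂ} {r : ℝ} (hr : 0 < r) (hF : IntegrableOn F {t : ℝ | r < |t|}) :
    ∫ t in {t : ℝ | r < |t|}, F t = (∫ t in Ioi r, F t) + ∫ t in Iio (-r), F t := by
  have e : {t : ℝ | r < |t|} = Ioi r ∪ Iio (-r) := by
    ext t
    simp only [mem_ofPred_eq, mem_union, mem_Ioi, mem_Iio, lt_abs, lt_neg]
  rw [e] at hF ⊢
  refine setIntegral_union ?_ measurableSet_Iio (hF.mono_set subset_union_left)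
    (hF.mono_set subset_union_right)
  rw [Set.disjoint_left]
  intro t ht ht'
  simp only [mem_Ioi, mem_Iio] at ht ht'
  linarith

/-- Below the scale `r` the integrand is an integrable perturbation of that of the Hilbert
transform, so the two principal values exist simultaneously. -/
lemma hasPrincipalValue_of_integrable_near {u γ : ℝ → ℝ} (hγ : Measurable γ) {f : ℝ → ℂ}
    (hf : Measurable f) {x r : ℝ} (hr : 0 < r) (hG : Integrable (nearIntegrand u γ f r x))
    (hint : ∀ ε : ℝ, 0 < ε → IntegrableOn (fun t => f (x - t) / (t : ℂ)) {t : ℝ | ε < |t|}) {L : ℂ}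
    (hL : Tendsto (fun ε => hilbertTrunc f ε x) (𝓝[>] 0) (𝓝 L)) :
    HasPrincipalValue (carlesonIntegrand u γ f x) ((∫ t, nearIntegrand u γ f r x t) + L -
      hilbertTrunc f r x + ((∫ t in Ioi r, carlesonIntegrand u γ f x t) +
        ∫ t in Iio (-r), carlesonIntegrand u γ f x t)) := by
  have hintC : ∀ ε : ℝ, 0 < ε → IntegrableOn (carlesonIntegrand u γ f x) {t : ℝ | ε < |t|} :=
    fun ε hε => integrableOn_carlesonIntegrand hγ u hf (hint ε hε)
  refine ⟨hintC, ?_⟩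
  rw [← setIntegral_lt_abs hr (hintC r hr)]
  refine ((((tendsto_truncatedIntegral_of_integrable hG).add hL).sub_const _).add_const _).congr' ?_
  filter_upwards [Ioo_mem_nhdsGT hr] with ε hε
  have hm := measurableSet_lt_abs ε
  have hmr := measurableSet_lt_abs r
  simp only [hilbertTrunc, truncatedIntegral_eq_integral_indicator]
  rw [← integral_indicator hmr, ← integral_add' (hG.indicator hm)
    ((hint ε hε.1).integrable_indicator hm), ← integral_sub' ((hG.indicator hm).add
      ((hint ε hε.1).integrable_indicator hm)) ((hint r hr).integrable_indicator hmr),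
    ← integral_add' (((hG.indicator hm).add ((hint ε hε.1).integrable_indicator hm)).sub
      ((hint r hr).integrable_indicator hmr)) ((hintC r hr).integrable_indicator hmr)]
  refine integral_congr_ae (ae_of_all _ fun t => ?_)
  simp only [nearIntegrand, indicator, mem_ofPred_eq, Pi.add_apply, Pi.sub_apply]
  have h1 := hε.2
  by_cases h2 : ε < |t| <;> by_cases h3 : r < |t|
  · simp [h2, h3, not_le.2 h3]
  · simp [h2, h3, not_lt.1 h3]
  · exact absurd (h1.trans h3) h2
  · simp [h2, h3]

lemma HasPrincipalValue.principalValue_eq {F : ℝ → ℂ} {L : ℂ} (h : HasPrincipalValue F L) :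
    principalValue F = L :=
  h.2.limUnder_eq

lemma enorm_le_hilbertMax_of_tendsto {f : ℝ → ℂ} {x : ℝ}
    (hint : ∀ ε : ℝ, 0 < ε → IntegrableOn (fun t => f (x - t) / (t : ℂ)) {t : ℝ | ε < |t|}) {L : ℂ}
    (hL : Tendsto (fun ε => hilbertTrunc f ε x) (𝓝[>] 0) (𝓝 L)) : ‖L‖ₑ ≤ hilbertMax f x := by
  refine le_of_tendsto hL.enorm ?_
  filter_upwards [self_mem_nhdsWithin] with ε hε
  exact enorm_hilbertTrunc_le_hilbertMax hint hε

namespace IsNondegeneratePhase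

variable {γ g₁ g₂ : ℝ → ℝ} {C₂ C₃ : ℝ}

/-- Wherever the principal value of the Hilbert transform exists, so does that of the Carleson
operator, and it is bounded by maximal functions and the two tails. The value of `r x` is
irrelevant at the zeros of `u`. -/
lemma hasPrincipalValue_carlesonOperator (h : IsNondegeneratePhase γ g₁ g₂ C₂ C₃)
    (hγ : Measurable γ) (habs : ∀ t, |γ t| = γ |t|) {u r : ℝ → ℝ} {x : ℝ} (hr : 0 < r x)
    (hu : u x ≠ 0 → |u x| * γ (r x) = 1) {f : ℝ → ℂ} (hf : Measurable f) {p : ℝ} (hp : 1 < p)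
    (hfp : ∫⁻ t, ‖f t‖ₑ ^ p ≠ ∞) {L : ℂ}
    (hL : Tendsto (fun ε => hilbertTrunc f ε x) (𝓝[>] 0) (𝓝 L)) :
    HasPrincipalValue (carlesonIntegrand u γ f x) (carlesonOperator u γ f x) ∧
      (u x = 0 → ‖carlesonOperator u γ f x‖ₑ ≤ hilbertMax f x) ∧
      (u x ≠ 0 → ‖carlesonOperator u γ f x‖ₑ ≤
        4 * hlMaximal (fun z => ‖f z‖ₑ) x + (2 * hilbertMax f x +
          (‖∫ t in Ioi (r x), carlesonIntegrand u γ f x t‖ₑ +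
            ‖∫ t in Iio (-r x), carlesonIntegrand u γ f x t‖ₑ))) := by
  have hint : ∀ ε : ℝ, 0 < ε → IntegrableOn (fun t => f (x - t) / (t : ℂ)) {t : ℝ | ε < |t|} :=
    fun ε hε => integrableOn_div_lt_abs hf hp hfp x hε
  have hLM := enorm_le_hilbertMax_of_tendsto hint hL
  by_cases h0 : u x = 0
  · have hpv := hasPrincipalValue_zero_phase γ h0 hint hL
    have e : carlesonOperator u γ f x = L := hpv.principalValue_eq
    rw [e]
    exact ⟨hpv, fun _ => hLM, fun h' => absurd h0 h'⟩
  have hG := h.lintegral_nearIntegrand_le habs hr (hu h0).le f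
  have hGint : Integrable (nearIntegrand u γ f (r x) x) := by
    refine ⟨(measurable_nearIntegrand hγ u hf _ x).aestronglyMeasurable, ?_⟩
    rw [hasFiniteIntegral_iff_enorm]
    exact hG.trans_lt (ENNReal.mul_lt_top ENNReal.ofReal_lt_top
      (lintegral_enorm_ball_ne_top hp hfp x _).lt_top)
  have hpv := hasPrincipalValue_of_integrable_near hγ hf hr hGint hint hL
  have e : carlesonOperator u γ f x = _ := hpv.principalValue_eq
  rw [e]
  refine ⟨hpv, fun h' => absurd h' h0, fun _ => ?_⟩
  have h4 : ‖∫ t, nearIntegrand u γ f (r x) x t‖ₑ ≤ 4 * hlMaximal (fun z => ‖f z‖ₑ) x := by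
    refine (enorm_integral_le_lintegral_enorm _).trans (hG.trans ?_)
    refine (mul_le_mul_right (lintegral_ball_le_hlMaximal _ x (by positivity)) _).trans
      (le_of_eq ?_)
    rw [← mul_assoc, ← ENNReal.ofReal_mul (by positivity),
      show 1 / r x * (2 * (2 * r x)) = 4 by field_simp; norm_num]
    norm_num
  refine (enorm_add_le _ _).trans ?_
  rw [← add_assoc]
  refine add_le_add ?_ (enorm_add_le _ _)
  refine (enorm_sub_le).trans ?_
  rw [two_mul, ← add_assoc]
  exact add_le_add ((enorm_add_le _ _).trans (add_le_add h4 hLM))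
    (enorm_hilbertTrunc_le_hilbertMax hint hr)

end IsNondegeneratePhase

/-! ### Boundedness on `Lᵖ` -/

lemma measurable_uncurry_carlesonIntegrand {u γ : ℝ → ℝ} (hu : Measurable u) (hγ : Measurable γ)
    {f : ℝ → ℂ} (hf : Measurable f) :
    Measurable fun s : ℝ × ℝ => carlesonIntegrand u γ f s.1 s.2 := by
  unfold carlesonIntegrand
  fun_prop

lemma measurable_setIntegral_Ioi_carlesonIntegrand {u γ r : ℝ → ℝ} (hu : Measurable u)
    (hγ : Measurable γ) (hr : Measurable r) {f : ℝ → ℂ} (hf : Measurable f) :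
    Measurable fun x => ∫ t in Ioi (r x), carlesonIntegrand u γ f x t := by
  have hset : MeasurableSet {s : ℝ × ℝ | r s.1 < s.2} := measurableSet_lt (by fun_prop) (by fun_prop)
  have hm := (measurable_uncurry_carlesonIntegrand hu hγ hf).indicator hset
  simp only [← integral_indicator measurableSet_Ioi]
  exact (hm.stronglyMeasurable.integral_prod_right' (ν := volume)).measurable

lemma measurable_truncatedIntegral_carlesonIntegrand {u γ : ℝ → ℝ} (hu : Measurable u)
    (hγ : Measurable γ) {f : ℝ → ℂ} (hf : Measurable f) (ε : ℝ) :
    Measurable fun x => truncatedIntegral (carlesonIntegrand u γ f x) ε :=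
  ((measurable_uncurry_carlesonIntegrand hu hγ hf).stronglyMeasurable.integral_prod_right'
    (ν := volume.restrict {t : ℝ | ε < |t|})).measurable

/-- Reflection in the origin interchanges the two tails. -/
lemma setIntegral_Iio_carlesonIntegrand {γ : ℝ → ℝ} {σ : ℝ} (hσ : ∀ t, γ (-t) = σ * γ t)
    (u : ℝ → ℝ) (f : ℝ → ℂ) (r x : ℝ) :
    ∫ t in Iio (-r), carlesonIntegrand u γ f x t =
      -∫ t in Ioi r, carlesonIntegrand (fun y => σ * u (-y)) γ (fun y => f (-y)) (-x) t := by
  rw [← integral_Iic_eq_integral_Iio, ← integral_comp_neg_Ioi, ← integral_neg]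
  refine integral_congr_ae (ae_of_all _ fun t => ?_)
  simp only [carlesonIntegrand, hσ, neg_neg, Complex.ofReal_neg, div_neg, sub_neg_eq_add,
    neg_sub]
  rw [add_comm x t, show u x * (σ * γ t) = σ * u x * γ t by ring]

lemma lintegral_comp_neg (F : ℝ → ℝ≥0∞) : ∫⁻ x, F (-x) = ∫⁻ x, F x := by
  simpa using lintegral_sub_left_eq_self (μ := (volume : Measure ℝ)) F 0

lemma add_four_rpow_le {p : ℝ} (hp : 1 ≤ p) (a b c d : ℝ≥0∞) :
    (a + (b + (c + d))) ^ p ≤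
      2 ^ (p - 1) * (a ^ p + 2 ^ (p - 1) * (b ^ p + 2 ^ (p - 1) * (c ^ p + d ^ p))) := by
  refine (ENNReal.rpow_add_le_mul_rpow_add_rpow _ _ hp).trans ?_
  gcongr
  refine (ENNReal.rpow_add_le_mul_rpow_add_rpow _ _ hp).trans ?_
  gcongr
  exact ENNReal.rpow_add_le_mul_rpow_add_rpow _ _ hp

namespace IsNondegeneratePhase

variable {γ g₁ g₂ : ℝ → ℝ} {C₂ C₃ : ℝ}

lemma abs_eq_comp_abs (h : IsNondegeneratePhase γ g₁ g₂ C₂ C₃) (hγ0 : γ 0 = 0)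
    (hparity : Function.Odd γ ∨ Function.Even γ) (t : ℝ) : |γ t| = γ |t| := by
  have hnn : ∀ s, 0 ≤ s → |γ s| = γ s := fun s hs => by
    rcases hs.eq_or_lt with rfl | hs
    · rw [hγ0, abs_zero]
    · exact abs_of_pos (h.pos s hs)
  rcases le_total 0 t with ht | ht
  · rw [abs_of_nonneg ht, hnn t ht]
  · rw [abs_of_nonpos ht, ← hnn (-t) (neg_nonneg.2 ht)]
    rcases hparity with ho | he
    · rw [ho, abs_neg]
    · rw [he]

/-- The `Lᵖ` bound for Borel measurable `u` and `f`. The constant depends on `γ` and `p` only, since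
`u` enters the bounds for the tails only through the scale at which its phase has size one. -/
lemma exists_lintegral_carlesonOperator_rpow_le (h : IsNondegeneratePhase γ g₁ g₂ C₂ C₃)
    (hγ : Continuous γ) (hγ0 : γ 0 = 0) (hparity : Function.Odd γ ∨ Function.Even γ)
    {p : ℝ} (hp : 1 < p) :
    ∃ K : ℝ≥0∞, K ≠ ∞ ∧ ∀ u : ℝ → ℝ, Measurable u → ∀ f : ℝ → ℂ, Measurable f →
      ∫⁻ t, ‖f t‖ₑ ^ p ≠ ∞ →
      (∀ᵐ x, ∃ L, Tendsto (fun ε => hilbertTrunc f ε x) (𝓝[>] 0) (𝓝 L)) →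
      ∫⁻ x, ‖carlesonOperator u γ f x‖ₑ ^ p ≤ K * ∫⁻ z, ‖f z‖ₑ ^ p := by
  have hp0 : 0 < p := by linarith
  obtain ⟨K₁, hK₁, hM⟩ := exists_lintegral_hlMaximal_rpow_le hp
  obtain ⟨K₂, hK₂, hH⟩ := exists_lintegral_hilbertMax_rpow_le hp
  obtain ⟨K₃, hK₃, hT⟩ := h.exists_lintegral_tail_rpow_le hγ.measurable hp
  obtain ⟨τ, hτm, hτ⟩ := h.exists_measurable_scale hγ hγ0
  obtain ⟨σ, hσ1, hσ⟩ : ∃ σ : ℝ, |σ| = 1 ∧ ∀ t, γ (-t) = σ * γ t := by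
    rcases hparity with ho | he
    · exact ⟨-1, by norm_num, fun t => by rw [ho]; ring⟩
    · exact ⟨1, by norm_num, fun t => by rw [he]; ring⟩
  refine ⟨2 ^ (p - 1) * (4 ^ p * K₁ + 2 ^ (p - 1) * (2 ^ p * K₂ + 2 ^ (p - 1) * (K₃ + K₃))),
    by finiteness, fun u hu f hf hfp hlim => ?_⟩
  -- the tails are only needed off the zeros of `u`, where `u` may be changed
  set v : ℝ → ℝ := fun x => if u x = 0 then 1 else u x with hv
  have hvm : Measurable v :=
    Measurable.ite (measurableSet_eq_fun hu measurable_const) measurable_const hu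
  have hv0 : ∀ x, v x ≠ 0 := fun x => by
    by_cases h0 : u x = 0 <;> simp [hv, h0]
  have hvu : ∀ x, u x ≠ 0 → v x = u x := fun x h0 => if_neg h0
  set r : ℝ → ℝ := fun x => τ (v x) with hr
  have hrm : Measurable r := hτm.comp hvm
  have hr0 : ∀ x, 0 < r x := fun x => (hτ _ (hv0 x)).1
  have hvr : ∀ x, |v x| * γ (r x) = 1 := fun x => (hτ _ (hv0 x)).2
  set I := ∫⁻ z, ‖f z‖ₑ ^ p with hI
  set A : ℝ → ℂ := fun x => ∫ t in Ioi (r x), carlesonIntegrand v γ f x t with hA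
  set B : ℝ → ℂ := fun x => ∫ t in Iio (-r x), carlesonIntegrand v γ f x t with hB
  have hAm : Measurable A := measurable_setIntegral_Ioi_carlesonIntegrand hvm hγ.measurable hrm hf
  have hAle : ∫⁻ x, ‖A x‖ₑ ^ p ≤ K₃ * I := hT v r hvm hrm hr0 (fun x => (hvr x).ge) f hf hfp
  have hBle : ∫⁻ x, ‖B x‖ₑ ^ p ≤ K₃ * I := by
    have h1 := hT (fun y => σ * v (-y)) (fun y => r (-y)) (by fun_prop) (by fun_prop)
      (fun x => hr0 _) (fun x => by rw [abs_mul, hσ1, one_mul, hvr]) (fun y => f (-y)) (by fun_prop)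
      (by rwa [lintegral_comp_neg fun t => ‖f t‖ₑ ^ p])
    rw [lintegral_comp_neg fun t => ‖f t‖ₑ ^ p, ← lintegral_comp_neg] at h1
    refine le_trans (le_of_eq (lintegral_congr fun x => ?_)) h1
    simp only [hB, neg_neg]
    rw [setIntegral_Iio_carlesonIntegrand hσ, enorm_neg]
  have hpt : ∀ᵐ x, ‖carlesonOperator u γ f x‖ₑ ≤ 4 * hlMaximal (fun z => ‖f z‖ₑ) x +
      (2 * hilbertMax f x + (‖A x‖ₑ + ‖B x‖ₑ)) := by
    filter_upwards [hlim] with x hx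
    obtain ⟨L, hL⟩ := hx
    obtain ⟨-, h1, h2⟩ := h.hasPrincipalValue_carlesonOperator (r := r) hγ.measurable
      (h.abs_eq_comp_abs hγ0 hparity) (hr0 x)
      (fun h0 => hvu x h0 ▸ hvr x) hf hp hfp hL
    by_cases h0 : u x = 0
    · refine (h1 h0).trans (le_trans ?_ le_add_self)
      refine le_trans ?_ le_self_add
      rw [two_mul]
      exact le_self_add
    · refine (h2 h0).trans (le_of_eq ?_)
      have e : ∀ t, carlesonIntegrand v γ f x t = carlesonIntegrand u γ f x t := fun t => by
        simp only [carlesonIntegrand, hvu x h0]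
      simp only [hA, hB, e]
  have hMm := (measurable_hlMaximal fun z => ‖f z‖ₑ).const_mul 4
  have hHm := (measurable_hilbertMax hf).const_mul 2
  calc ∫⁻ x, ‖carlesonOperator u γ f x‖ₑ ^ p
      ≤ ∫⁻ x, 2 ^ (p - 1) * ((4 * hlMaximal (fun z => ‖f z‖ₑ) x) ^ p + 2 ^ (p - 1) *
          ((2 * hilbertMax f x) ^ p + 2 ^ (p - 1) * (‖A x‖ₑ ^ p + ‖B x‖ₑ ^ p))) := by
        refine lintegral_mono_ae (hpt.mono fun x hx => ?_)
        exact (ENNReal.rpow_le_rpow hx hp0.le).trans (add_four_rpow_le hp.le _ _ _ _)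
    _ = 2 ^ (p - 1) * (4 ^ p * (∫⁻ x, hlMaximal (fun z => ‖f z‖ₑ) x ^ p) + 2 ^ (p - 1) *
          (2 ^ p * (∫⁻ x, hilbertMax f x ^ p) +
            2 ^ (p - 1) * ((∫⁻ x, ‖A x‖ₑ ^ p) + ∫⁻ x, ‖B x‖ₑ ^ p))) := by
        have h2 : (2 : ℝ≥0∞) ^ (p - 1) ≠ ∞ := by finiteness
        have h4 : (4 : ℝ≥0∞) ^ p ≠ ∞ := by finiteness
        have h2' : (2 : ℝ≥0∞) ^ p ≠ ∞ := by finiteness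
        rw [lintegral_const_mul' _ _ h2, lintegral_add_left (hMm.pow_const _),
          lintegral_const_mul' _ _ h2, lintegral_add_left (hHm.pow_const _),
          lintegral_const_mul' _ _ h2, lintegral_add_left (hAm.enorm.pow_const _)]
        simp only [ENNReal.mul_rpow_of_nonneg _ _ hp0.le]
        rw [lintegral_const_mul' _ _ h4, lintegral_const_mul' _ _ h2']
    _ ≤ 2 ^ (p - 1) * (4 ^ p * (K₁ * I) + 2 ^ (p - 1) *
          (2 ^ p * (K₂ * I) + 2 ^ (p - 1) * (K₃ * I + K₃ * I))) := by
        gcongr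
        · exact hM _ hf.enorm fun _ => enorm_ne_top
        · exact hH f hf
    _ = _ := by ring

end IsNondegeneratePhase

/-! ### Passage to equivalence classes -/

lemma carlesonIntegrand_congr_left {u v : ℝ → ℝ} {x : ℝ} (h : u x = v x) (γ : ℝ → ℝ) (f : ℝ → ℂ) :
    carlesonIntegrand u γ f x = carlesonIntegrand v γ f x := by
  funext t
  simp only [carlesonIntegrand, h]

lemma carlesonIntegrand_ae_eq {f g : ℝ → ℂ} (h : f =ᵐ[volume] g) (u γ : ℝ → ℝ) (x : ℝ) :
    carlesonIntegrand u γ f x =ᵐ[volume] carlesonIntegrand u γ g x := by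
  have h1 : ∀ᵐ t : ℝ, f (x - t) = g (x - t) :=
    (quasiMeasurePreserving_sub_left volume x).ae h
  filter_upwards [h1] with t ht
  simp only [carlesonIntegrand, ht]

lemma truncatedIntegral_congr_ae {F G : ℝ → ℂ} (h : F =ᵐ[volume] G) :
    truncatedIntegral F = truncatedIntegral G :=
  funext fun _ => integral_congr_ae (ae_restrict_of_ae h)

lemma principalValue_congr_ae {F G : ℝ → ℂ} (h : F =ᵐ[volume] G) :
    principalValue F = principalValue G := by
  rw [principalValue, principalValue, truncatedIntegral_congr_ae h]

lemma HasPrincipalValue.congr_ae {F G : ℝ → ℂ} {L : ℂ} (hF : HasPrincipalValue F L)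
    (h : F =ᵐ[volume] G) : HasPrincipalValue G L := by
  refine ⟨fun ε hε => (hF.1 ε hε).congr (ae_restrict_of_ae h), ?_⟩
  rw [← truncatedIntegral_congr_ae h]
  exact hF.2

lemma aestronglyMeasurable_carlesonOperator {u γ : ℝ → ℝ} (hu : Measurable u) (hγ : Measurable γ)
    {f : ℝ → ℂ} (hf : Measurable f) (hpv : ∀ᵐ x,
      HasPrincipalValue (carlesonIntegrand u γ f x) (carlesonOperator u γ f x)) :
    AEStronglyMeasurable (carlesonOperator u γ f) := by
  refine aestronglyMeasurable_of_tendsto_ae atTop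
    (f := fun (n : ℕ) x => truncatedIntegral (carlesonIntegrand u γ f x) (1 / ((n : ℝ) + 1)))
    (fun n => (measurable_truncatedIntegral_carlesonIntegrand hu hγ hf _).aestronglyMeasurable) ?_
  filter_upwards [hpv] with x hx
  refine hx.2.comp (g := truncatedIntegral _) (tendsto_nhdsWithin_iff.2
    ⟨tendsto_one_div_add_atTop_nhds_zero_nat, ?_⟩)
  exact Eventually.of_forall fun n => mem_Ioi.2 (by positivity)

namespace IsNondegeneratePhase

variable {γ g₁ g₂ : ℝ → ℝ} {C₂ C₃ : ℝ}

lemma hasPrincipalValue_of_tendsto_hilbertTrunc (h : IsNondegeneratePhase γ g₁ g₂ C₂ C₃)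
    (hγ : Continuous γ) (hγ0 : γ 0 = 0) (hparity : Function.Odd γ ∨ Function.Even γ) (u : ℝ → ℝ)
    {f : ℝ → ℂ} (hf : Measurable f) {p : ℝ} (hp : 1 < p) (hfp : ∫⁻ t, ‖f t‖ₑ ^ p ≠ ∞) {x : ℝ} {L : ℂ}
    (hL : Tendsto (fun ε => hilbertTrunc f ε x) (𝓝[>] 0) (𝓝 L)) :
    HasPrincipalValue (carlesonIntegrand u γ f x) (carlesonOperator u γ f x) := by
  obtain ⟨τ, -, hτ⟩ := h.exists_measurable_scale hγ hγ0
  have hr : 0 < (if u x = 0 then 1 else τ (u x)) := by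
    split_ifs with h0
    · exact one_pos
    · exact (hτ _ h0).1
  refine (h.hasPrincipalValue_carlesonOperator (r := fun x => if u x = 0 then 1 else τ (u x))
    hγ.measurable (h.abs_eq_comp_abs hγ0 hparity) hr (fun h0 => ?_) hf hp hfp hL).1
  simp only [if_neg h0]
  exact (hτ _ h0).2

lemma hasPrincipalValue_schwartz (h : IsNondegeneratePhase γ g₁ g₂ C₂ C₃)
    (hγ : Continuous γ) (hγ0 : γ 0 = 0) (hparity : Function.Odd γ ∨ Function.Even γ) (u : ℝ → ℝ)
    (f : 𝓢(ℝ, ℂ)) (x : ℝ) :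
    HasPrincipalValue (carlesonIntegrand u γ f x) (carlesonOperator u γ f x) := by
  have hf : Measurable f := f.continuous.measurable
  have hfp : ∫⁻ t, ‖f t‖ₑ ^ (2 : ℝ) ≠ ∞ := by
    simpa using lintegral_rpow_ne_top_of_memLp ENNReal.one_lt_two ENNReal.ofNat_lt_top
      (f.memLp 2 (volume : Measure ℝ))
  obtain ⟨L, hL⟩ := exists_tendsto_hilbertTrunc_of_contDiff (f.smooth 1) x
    fun ε hε => integrableOn_div_lt_abs hf one_lt_two hfp x hε
  exact h.hasPrincipalValue_of_tendsto_hilbertTrunc hγ hγ0 hparity u hf one_lt_two hfp hL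

theorem exists_eLpNorm_carlesonOperator_le (h : IsNondegeneratePhase γ g₁ g₂ C₂ C₃)
    (hγ : Continuous γ) (hγ0 : γ 0 = 0) (hparity : Function.Odd γ ∨ Function.Even γ)
    {p : ℝ≥0∞} (hp1 : 1 < p) (hp2 : p < ∞) :
    ∃ C : ℝ≥0, 0 < C ∧ ∀ u : ℝ → ℝ, AEMeasurable u volume → ∀ f : ℝ → ℂ, MemLp f p volume →
      (∀ᵐ x : ℝ ∂volume,
        HasPrincipalValue (carlesonIntegrand u γ f x) (carlesonOperator u γ f x)) ∧
      MemLp (carlesonOperator u γ f) p volume ∧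
      eLpNorm (carlesonOperator u γ f) p volume ≤ C * eLpNorm f p volume := by
  have hq := one_lt_toReal hp1 hp2
  have hq0 : 0 < p.toReal := by linarith
  have hp0 : p ≠ 0 := (zero_lt_one.trans hp1).ne'
  obtain ⟨K, hK, hKf⟩ := h.exists_lintegral_carlesonOperator_rpow_le hγ hγ0 hparity hq
  have hK' : K ^ (1 / p.toReal) ≠ ∞ := by finiteness
  refine ⟨(K ^ (1 / p.toReal)).toNNReal + 1, by positivity, fun u hu f hf => ?_⟩
  -- replace `u` and `f` by Borel measurable representatives
  set v := hu.mk u with hv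
  have hvm : Measurable v := hu.measurable_mk
  have hfv : f =ᵐ[volume] hf.1.mk f := hf.1.ae_eq_mk
  set g := hf.1.mk f with hg
  have hgm : Measurable g := hf.1.stronglyMeasurable_mk.measurable
  have hgp : MemLp g p volume := hf.ae_eq hfv
  have hgq := lintegral_rpow_ne_top_of_memLp hp1 hp2 hgp
  have hlim := ae_exists_tendsto_hilbertTrunc hp1 hp2 hgm hgp
  have hpv : ∀ᵐ x, HasPrincipalValue (carlesonIntegrand v γ g x) (carlesonOperator v γ g x) := by
    filter_upwards [hlim] with x ⟨L, hL⟩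
    exact h.hasPrincipalValue_of_tendsto_hilbertTrunc hγ hγ0 hparity v hgm hq hgq hL
  have heq : ∀ᵐ x, carlesonIntegrand v γ g x =ᵐ[volume] carlesonIntegrand u γ f x := by
    filter_upwards [hu.ae_eq_mk] with x hx
    rw [carlesonIntegrand_congr_left hx]
    exact (carlesonIntegrand_ae_eq hfv v γ x).symm
  have hop : carlesonOperator u γ f =ᵐ[volume] carlesonOperator v γ g :=
    heq.mono fun x hx => (principalValue_congr_ae hx).symm
  have hbound : eLpNorm (carlesonOperator v γ g) p volume ≤
      ((K ^ (1 / p.toReal)).toNNReal + 1 : ℝ≥0) * eLpNorm g p volume := by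
    rw [eLpNorm_eq_lintegral_rpow_enorm_toReal hp0 hp2.ne,
      eLpNorm_eq_lintegral_rpow_enorm_toReal hp0 hp2.ne, ENNReal.coe_add,
      ENNReal.coe_toNNReal hK']
    calc _ ≤ (K * ∫⁻ z, ‖g z‖ₑ ^ p.toReal) ^ (1 / p.toReal) := by
          gcongr
          exact hKf v hvm g hgm hgq hlim
      _ = K ^ (1 / p.toReal) * (∫⁻ z, ‖g z‖ₑ ^ p.toReal) ^ (1 / p.toReal) :=
          ENNReal.mul_rpow_of_nonneg _ _ (by positivity)
      _ ≤ _ := by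
          gcongr
          exact le_self_add
  rw [eLpNorm_congr_ae hop, eLpNorm_congr_ae hfv]
  refine ⟨?_, MemLp.ae_eq hop.symm ⟨?_, hbound.trans_lt ?_⟩, hbound⟩
  · filter_upwards [hpv, heq, hop] with x h1 h2 h3
    rw [h3]
    exact h1.congr_ae h2
  · exact aestronglyMeasurable_carlesonOperator hvm hγ.measurable hgm hpv
  · exact ENNReal.mul_lt_top ENNReal.coe_lt_top hgp.eLpNorm_lt_top

end IsNondegeneratePhase

theorem theorem1p2 (γ : ℝ → ℝ) (hγ : ContDiff ℝ 3 γ)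
    (hparity : Function.Odd γ ∨ Function.Even γ)
    (hγ0 : γ 0 = 0) (hγ0' : deriv γ 0 = 0)
    (hconv : ConvexOn ℝ (Ioi 0) γ)
    (C₁ C₂ C₃ : ℝ)
    -- (i)
    (hi : AntitoneOn (fun t : ℝ => deriv γ (2 * t) / deriv γ t) (Ioi 0))
    (hi' : ∀ t : ℝ, 0 < t → deriv γ (2 * t) / deriv γ t ≤ C₁)
    -- (ii)
    (hC₂ : 0 < C₂)
    (hii : ∀ t : ℝ, 0 < t → t * iteratedDeriv 2 γ t / deriv γ t ≤ C₂)
    -- (iii); for curves as above this forces `γ' > 0` and `γ'' > 0` on `(0, ∞)`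
    (hC₃ : 0 < C₃)
    (hiii : ∀ t : ℝ, 0 < t →
      C₃ / t ^ 2 ≤ |deriv (fun s : ℝ => iteratedDeriv 2 γ s / deriv γ s) t|)
    -- (iv)
    (hiv : StrictMonoOn (fun t : ℝ => iteratedDeriv 3 γ t / iteratedDeriv 2 γ t) (Ioi 0) ∨
      StrictAntiOn (fun t : ℝ => iteratedDeriv 3 γ t / iteratedDeriv 2 γ t) (Ioi 0) ∨
      ∃ c : ℝ, ∀ t : ℝ, 0 < t → iteratedDeriv 3 γ t / iteratedDeriv 2 γ t = c)
    (p : ℝ≥0∞) (hp1 : 1 < p) (hp2 : p < ∞) :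
    ∃ C : ℝ≥0, 0 < C ∧ ∀ u : ℝ → ℝ, AEMeasurable u volume →
      -- the defining principal value exists at every point for Schwartz functions
      (∀ (f : 𝓢(ℝ, ℂ)) (x : ℝ),
        HasPrincipalValue (carlesonIntegrand u γ f x) (carlesonOperator u γ f x)) ∧
      -- on `L^p` it exists almost everywhere and defines a bounded operator
      (∀ f : ℝ → ℂ, MemLp f p volume →
        (∀ᵐ x : ℝ ∂volume,
          HasPrincipalValue (carlesonIntegrand u γ f x) (carlesonOperator u γ f x)) ∧
        MemLp (carlesonOperator u γ f) p volume ∧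
        eLpNorm (carlesonOperator u γ f) p volume ≤ C * eLpNorm f p volume) := by
  have h := isNondegeneratePhase_of_curvature hγ hγ0 hγ0' hconv hC₂ hii hC₃ hiii hiv
  obtain ⟨C, hC, hCu⟩ := h.exists_eLpNorm_carlesonOperator_le hγ.continuous hγ0 hparity hp1 hp2
  exact ⟨C, hC, fun u hu =>
    ⟨h.hasPrincipalValue_schwartz hγ.continuous hγ0 hparity u, hCu u hu⟩⟩
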